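/- Let $M\in\mathbb N$, let $X_1,\dots,X_M\in\mathbb R^3$ be distinct points (the nuclei), let $Z_1,\dots,Z_M>0$ (their charges) and let $b>0$. Let $\mathcal P$ be the set of Borel probability measures on $\mathbb R^3$, and let $\mathcal P^-$ be the set of Borel measures $\rho\ge 0$ on $\mathbb R^3$ with $\rho(\mathbb R^3)\le 1$, endowed with the weak* topology, that is, the coarsest topology for which $\rho\mapsto\int f\,d\rho$ is continuous for every continuous $f:\mathbb R^3\to\mathbb R$ vanishing at infinity. For $\rho\in\mathcal P$ put $$T(\rho)=\int_{\mathbb R^3}|\nabla\sqrt\rho|^2\,dx,\qquad C(\rho)=\inf\Big\{\int_{\mathbb R^3\times\mathbb R^3}\frac{dP(x,y)}{|x-y|}\ :\ P\ \text{has both marginals equal to}\ \rho\Big\},\qquad U(\rho)=\sum_{k=1}^M Z_k\int_{\mathbb R^3}\frac{d\rho(x)}{|x-X_k|},$$ where $T(\rho)=+\infty$ unless $\rho$ is absolutely continuous with $\sqrt\rho\in H^1(\mathbb R^3)$. ($C$ is the Coulomb transport cost for $N=2$ electrons.) For $\varepsilon>0$ let $$G_\varepsilon(\rho)=\varepsilon^2T(\rho)+\varepsilon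 b\,C(\rho)-\varepsilon U(\rho)\quad\text{if }\rho\in\mathcal P\text{ and }T(\rho)<\infty,\qquad G_\varepsilon(\rho)=+\infty\quad\text{for all other }\rho\in\mathcal P^-.$$ Then the family $(G_\varepsilon)_{\varepsilon>0}$ has a $\Gamma$-limit on $\mathcal P^-$ as $\varepsilon\to0^+$: there is a functional $G:\mathcal P^-\to[-\infty,+\infty]$ such that, for every $\rho\in\mathcal P^-$, one has $G(\rho)\le\liminf_{\varepsilon\to0^+}G_\varepsilon(\rho_\varepsilon)$ for every family $(\rho_\varepsilon)_{\varepsilon>0}$ in $\mathcal P^-$ converging weakly* to $\rho$ as $\varepsilon\to 0^+$, and $\limsup_{\varepsilon\to0^+}G_\varepsilon(\rho_\varepsilon)\le G(\rho)$ for at least one such family. Moreover, for every $\rho\in\mathcal P^-$, $$G(\rho)=G(\rho^\#),\qquad\text{where}\quad \rho^\#=\sum_{i=1}^M\rho(\{X_i\})\,\delta_{X_i}.$$ -/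

import Mathlib

open MeasureTheory Filter Topology
open scoped ENNReal ContDiff ZeroAtInfty

noncomputable section

/-- The physical space `ℝ³` with its Euclidean norm. -/
abbrev E3 : Type := EuclideanSpace ℝ (Fin 3)

/-- The class `𝒫⁻` of Borel subprobabilities on `ℝ³`. -/
structure SubProb where
  toMeasure : Measure E3
  mass_le_one : toMeasure Set.univ ≤ 1

/-- The weak* topology of `𝒫⁻`: the coarsest topology making `ρ ↦ ∫ f dρ` continuous for every
continuous `f : ℝ³ → ℝ` vanishing at infinity. -/
instance SubProb.instTopologicalSpace : TopologicalSpace SubProb :=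
  TopologicalSpace.induced (fun (ρ : SubProb) (f : C₀(E3, ℝ)) => ∫ x, f x ∂ρ.toMeasure)
    inferInstance

/-- `g` is the weak (distributional) gradient of `u`. -/
def HasWeakGradient (u : E3 → ℝ) (g : E3 → E3) : Prop :=
  LocallyIntegrable u ∧ LocallyIntegrable g ∧
    ∀ φ : E3 → ℝ, ContDiff ℝ ∞ φ → HasCompactSupport φ →
      ∫ x, u x • gradient φ x = -∫ x, φ x • g x

/-- `ρ` has a Lebesgue density, `u` is the square root of that density, and `g = ∇u` weakly. -/
def IsSqrtDensityGradient (ρ : Measure E3) (u : E3 → ℝ) (g : E3 → E3) : Prop :=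
  (∀ x, 0 ≤ u x) ∧ ρ = volume.withDensity (fun x => ENNReal.ofReal (u x ^ 2)) ∧
    HasWeakGradient u g

/-- The kinetic energy `T(ρ) = ∫ |∇√ρ|² dx`, equal to `∞` if `ρ` has no density or `√ρ` has no
weak gradient. Both `u = √ρ` and `g = ∇√ρ` are unique up to null sets, so that the infimum is over
at most one value. -/
def kinetic (ρ : Measure E3) : ℝ≥0∞ :=
  ⨅ (u : E3 → ℝ) (g : E3 → E3) (_ : IsSqrtDensityGradient ρ u g), ∫⁻ x, ‖g x‖ₑ ^ 2

/-- The correlation term for two electrons: the optimal transport cost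
`C(ρ) = inf { ∫ 1/|x-y| dP(x,y) : both marginals of P equal ρ }`, with `1/0 = ∞`. -/
def correlation (ρ : Measure E3) : ℝ≥0∞ :=
  ⨅ (P : Measure (E3 × E3)) (_ : P.map Prod.fst = ρ ∧ P.map Prod.snd = ρ),
    ∫⁻ p, (edist p.1 p.2)⁻¹ ∂P

/-- The potential term `U(ρ) = ∑ₖ Zₖ ∫ 1/|x-Xₖ| dρ(x)`, with `1/0 = ∞`. -/
def potential {M : ℕ} (X : Fin M → E3) (Z : Fin M → ℝ) (ρ : Measure E3) : ℝ≥0∞ :=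
  ∑ k, ENNReal.ofReal (Z k) * ∫⁻ x, (edist x (X k))⁻¹ ∂ρ

open Classical in
/-- The rescaled energy `G_ε(ρ) = ε² T(ρ) + ε b C(ρ) - ε U(ρ)` on the probabilities `ρ` with
`√ρ ∈ H¹(ℝ³)`, extended by `+∞` to the rest of `𝒫⁻`. (If `T(ρ) < ∞` then `U(ρ) < ∞`, so the
subtraction is never `∞ - ∞`.) -/
def rescaledEnergy {M : ℕ} (X : Fin M → E3) (Z : Fin M → ℝ) (b ε : ℝ) (ρ : SubProb) : EReal :=
  if IsProbabilityMeasure ρ.toMeasure ∧ kinetic ρ.toMeasure < ⊤ then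
    ((ENNReal.ofReal (ε ^ 2) * kinetic ρ.toMeasure
        + ENNReal.ofReal (ε * b) * correlation ρ.toMeasure : ℝ≥0∞) : EReal)
      - ((ENNReal.ofReal ε * potential X Z ρ.toMeasure : ℝ≥0∞) : EReal)
  else ⊤

/-- `G` is the `Γ`-limit, as `ε → 0⁺`, of the family `F ε`, in terms of converging families.
(The weak* topology of `𝒫⁻` is metrizable, so this agrees with the definition through
neighbourhoods.) -/
def IsGammaLimit {S : Type*} [TopologicalSpace S] (F : ℝ → S → EReal) (G : S → EReal) : Prop :=
  ∀ x : S,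
    (∀ y : ℝ → S, Tendsto y (𝓝[>] 0) (𝓝 x) → G x ≤ liminf (fun ε => F ε (y ε)) (𝓝[>] 0)) ∧
    ∃ y : ℝ → S, Tendsto y (𝓝[>] 0) (𝓝 x) ∧ limsup (fun ε => F ε (y ε)) (𝓝[>] 0) ≤ G x

/-- The atomic measure `ρ^# = ∑ᵢ ρ({Xᵢ}) δ_{Xᵢ}` for distinct nuclei `Xᵢ`. -/
def SubProb.sharp {M : ℕ} (X : Fin M → E3) (hX : Function.Injective X) (ρ : SubProb) : SubProb where
  toMeasure := ∑ i, ρ.toMeasure {X i} • Measure.dirac (X i)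
  mass_le_one := by
    have h : ∑ i, ρ.toMeasure {X i} = ρ.toMeasure (⋃ i ∈ (Finset.univ : Finset (Fin M)), {X i}) :=
      (measure_biUnion_finset
        (fun i _ j _ hij => Set.disjoint_singleton.2 fun h => hij (hX h))
        (fun i _ => measurableSet_singleton _)).symm
    simp only [Measure.coe_finsetSum, Finset.sum_apply, Measure.smul_apply, measure_univ,
      smul_eq_mul, mul_one]
    rw [h]
    exact (measure_mono (Set.subset_univ _)).trans ρ.mass_le_one

end

noncomputable section

/-! ### Gradients of smooth functions and weak gradients -/

/-! Kinetic energy scales like length⁻² and Coulomb energy like length⁻¹. Around one nucleus,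
passing from ε = s to a smaller ε while contracting by ε/s therefore leaves ε²T, εbC and εU
unchanged. Charge spread at scale √ε costs only O(√ε), so just the charge concentrated at the nuclei
contributes in the limit. The weak* limit constrains that charge only by requiring that its mass at
`X i` be at most the atom of ρ there.

This identifies the Γ-limit as `limitEnergy`: the infimum, over all scales, of the energies of
`Fragments` lying below the atoms of ρ. Their transport plan is only partial, since unpaired charge
can be coupled with remote charge at vanishing cost. Enough remote charge must exist for that, which
is the field `mass`. This functional sees ρ only through the numbers ρ({X i}), which ρ and `ρ.sharp`
share, so the last claim of the theorem is immediate.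

Lower bound (`limitEnergy_le_liminf`): multiply √ρ_ε by cutoffs around the nuclei and restrict the
plan accordingly. The cutoffs have a `sin` profile, so localizing costs only O(ε²)
(`exists_cutoff`), and the attraction from outside the cutoff region is O(ε). Cut masses may
slightly exceed the atoms. They are thinned by factors t i, and `HasWeakGradient.coulomb_le` bounds
the cost by Z² times the excess (`exists_fragments_le`).

Upper bound (`exists_recovery_family`): contract near-optimal fragments towards the nuclei. Quantize
the rest of ρ, together with its missing mass placed far away, on a lattice of mesh √ε avoiding the
nuclei, and put a smooth bump on each lattice point (`exists_recovery`). `correlation_add_le` then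
completes the partial plan using the bounded potential of the bumps. -/

theorem continuous_gradient {φ : E3 → ℝ} (hφ : ContDiff ℝ ∞ φ) : Continuous (gradient φ) :=
  (InnerProductSpace.toDual ℝ E3).symm.continuous.comp (hφ.continuous_fderiv (by simp))

theorem hasCompactSupport_gradient {φ : E3 → ℝ} (hφ : HasCompactSupport φ) :
    HasCompactSupport (gradient φ) :=
  (hφ.fderiv (𝕜 := ℝ)).comp_left (g := (InnerProductSpace.toDual ℝ E3).symm) (map_zero _)

theorem inner_gradient (φ : E3 → ℝ) (x v : E3) : inner ℝ (gradient φ x) v = fderiv ℝ φ x v := by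
  rw [← toDual_gradient]
  simp

theorem gradient_mul {η φ : E3 → ℝ} (hη : ContDiff ℝ ∞ η) (hφ : ContDiff ℝ ∞ φ) (x : E3) :
    gradient (fun y => η y * φ y) x = η x • gradient φ x + φ x • gradient η x := by
  apply ext_inner_right ℝ
  intro v
  rw [inner_add_left, inner_smul_left, inner_smul_left, inner_gradient, inner_gradient,
    inner_gradient, fderiv_fun_mul (hη.differentiable (by simp) x) (hφ.differentiable (by simp) x)]
  simp

/-- The product of a weakly differentiable function with a smooth one. -/
theorem HasWeakGradient.mul_smooth {u : E3 → ℝ} {g : E3 → E3} (h : HasWeakGradient u g)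
    {η : E3 → ℝ} (hη : ContDiff ℝ ∞ η) :
    HasWeakGradient (fun x => η x * u x) (fun x => η x • g x + u x • gradient η x) := by
  obtain ⟨hu, hg, hw⟩ := h
  have hg1 : LocallyIntegrable (fun x => η x • g x) := by
    rw [locallyIntegrable_iff]
    intro k hk
    exact (hg.integrableOn_isCompact hk).continuousOn_smul hη.continuous.continuousOn hk
  have hg2 : LocallyIntegrable (fun x => u x • gradient η x) := by
    rw [locallyIntegrable_iff]
    intro k hk
    exact (hu.integrableOn_isCompact hk).smul_continuousOn
      (continuous_gradient hη).continuousOn hk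
  refine ⟨?_, hg1.add hg2, ?_⟩
  · rw [locallyIntegrable_iff]
    intro k hk
    exact (hu.integrableOn_isCompact hk).continuousOn_mul hη.continuous.continuousOn hk
  · intro φ hφ hc
    have hcm : HasCompactSupport (fun x => η x * φ x) :=
      hc.mono fun x hx => right_ne_zero_of_mul hx
    have key := hw (fun x => η x * φ x) (hη.mul hφ) hcm
    have i1 : Integrable (fun x => u x • (η x • gradient φ x)) :=
      hu.integrable_smul_right_of_hasCompactSupport
        (hη.continuous.smul (continuous_gradient hφ)) ((hasCompactSupport_gradient hc).mono
          fun x hx => right_ne_zero_of_smul hx)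
    have i2 : Integrable (fun x => u x • (φ x • gradient η x)) :=
      hu.integrable_smul_right_of_hasCompactSupport
        (hφ.continuous.smul (continuous_gradient hη)) (hc.mono fun x hx => left_ne_zero_of_smul hx)
    have i3 : Integrable (fun x => φ x • (η x • g x)) :=
      hg1.integrable_smul_left_of_hasCompactSupport hφ.continuous hc
    have i4 : Integrable (fun x => φ x • (u x • gradient η x)) :=
      hg2.integrable_smul_left_of_hasCompactSupport hφ.continuous hc
    simp_rw [gradient_mul hη hφ, smul_add] at key
    rw [integral_add i1 i2] at key
    simp_rw [smul_add]
    rw [integral_add i3 i4]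
    have e1 : ∀ x, (η x * u x) • gradient φ x = u x • (η x • gradient φ x) := fun x => by
      rw [smul_smul, mul_comm]
    have e2 : ∀ x, φ x • (u x • gradient η x) = u x • (φ x • gradient η x) := fun x => by
      rw [smul_smul, smul_smul, mul_comm]
    have e3 : ∀ x, (η x * φ x) • g x = φ x • (η x • g x) := fun x => by
      rw [smul_smul, mul_comm]
    simp_rw [e1, e2]
    simp_rw [e3] at key
    rw [eq_sub_of_add_eq key]
    abel

theorem HasWeakGradient.const_mul {u : E3 → ℝ} {g : E3 → E3} (h : HasWeakGradient u g) (c : ℝ) :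
    HasWeakGradient (fun x => c * u x) (fun x => c • g x) := by
  obtain ⟨hu, hg, hw⟩ := h
  refine ⟨hu.smul c, hg.smul c, fun φ hφ hc => ?_⟩
  simp_rw [← smul_smul, smul_comm (φ _) c]
  rw [integral_smul, integral_smul, hw φ hφ hc, smul_neg]

theorem HasWeakGradient.sum {ι : Type*} (s : Finset ι) {u : ι → E3 → ℝ} {g : ι → E3 → E3}
    (h : ∀ i ∈ s, HasWeakGradient (u i) (g i)) :
    HasWeakGradient (fun x => ∑ i ∈ s, u i x) (fun x => ∑ i ∈ s, g i x) := by
  refine ⟨?_, ?_, fun φ hφ hc => ?_⟩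
  · simpa using locallyIntegrable_finsetSum s (fun i hi => (h i hi).1)
  · simpa using locallyIntegrable_finsetSum s (fun i hi => (h i hi).2.1)
  · simp_rw [Finset.sum_smul, Finset.smul_sum]
    rw [integral_finsetSum, integral_finsetSum, ← Finset.sum_neg_distrib]
    · exact Finset.sum_congr rfl fun i hi => (h i hi).2.2 φ hφ hc
    · exact fun i hi => (h i hi).2.1.integrable_smul_left_of_hasCompactSupport hφ.continuous hc
    · exact fun i hi => (h i hi).1.integrable_smul_right_of_hasCompactSupport
        (continuous_gradient hφ) (hasCompactSupport_gradient hc)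

/-! ### Affine changes of variables -/

theorem integral_comp_affine {F : Type*} [NormedAddCommGroup F] [NormedSpace ℝ F]
    (f : E3 → F) (l : ℝ) (p : E3) :
    ∫ x, f (l⁻¹ • (x - p)) = |l ^ 3| • ∫ x, f x := by
  rw [integral_sub_right_eq_self (fun x => f (l⁻¹ • x)) p, Measure.integral_comp_inv_smul]
  simp

theorem LocallyIntegrable.comp_affine {F : Type*} [NormedAddCommGroup F] {f : E3 → F}
    (hf : LocallyIntegrable f) {l : ℝ} (hl : l ≠ 0) (p : E3) :
    LocallyIntegrable (fun x => f (l⁻¹ • (x - p))) := by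
  rw [locallyIntegrable_iff]
  intro k hk
  have hB : Continuous (fun x : E3 => l⁻¹ • (x - p)) := by fun_prop
  have hk' := hk.image hB
  have h1 := (hf.integrableOn_isCompact hk').integrable_indicator hk'.measurableSet
  have h2 := ((integrable_comp_smul_iff volume _ (inv_ne_zero hl)).2 h1).comp_sub_right p
  rw [← integrable_indicator_iff hk.measurableSet]
  refine h2.congr (Eventually.of_forall fun x => ?_)
  dsimp only
  by_cases hx : x ∈ k
  · rw [Set.indicator_of_mem hx, Set.indicator_of_mem (Set.mem_image_of_mem _ hx)]
  · rw [Set.indicator_of_notMem hx, Set.indicator_of_notMem]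
    rintro ⟨y, hy, hxy⟩
    have : y = x := by simpa [hl] using hxy
    exact hx (this ▸ hy)

/-- Pulling the test function back along y ↦ p + l • y reduces this to the hypothesis; the Jacobians
on the two sides agree and the chain rule supplies the factor l⁻¹. -/
theorem HasWeakGradient.comp_affine {u : E3 → ℝ} {g : E3 → E3} (h : HasWeakGradient u g)
    {l : ℝ} (hl : l ≠ 0) (p : E3) :
    HasWeakGradient (fun x => u (l⁻¹ • (x - p))) (fun x => l⁻¹ • g (l⁻¹ • (x - p))) := by
  obtain ⟨hu, hg, hw⟩ := h
  refine ⟨LocallyIntegrable.comp_affine hu hl p,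
    (LocallyIntegrable.comp_affine hg hl p).smul l⁻¹, fun φ hφ hc => ?_⟩
  have inv : ∀ x : E3, p + l • (l⁻¹ • (x - p)) = x := fun x => by simp [smul_smul, hl]
  have hA : ContDiff ℝ ∞ (fun y : E3 => p + l • y) := by fun_prop
  have hgr : ∀ y, gradient (fun y => φ (p + l • y)) y = l • gradient φ (p + l • y) := by
    intro y
    apply ext_inner_right ℝ
    intro v
    have h1 : HasFDerivAt (fun y : E3 => p + l • y) (l • ContinuousLinearMap.id ℝ E3) y :=
      ((hasFDerivAt_id y).const_smul l).const_add p
    have h2 := ((hφ.differentiable (by simp) (p + l • y)).hasFDerivAt.comp y h1).fderiv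
    rw [Function.comp_def] at h2
    rw [inner_smul_left, inner_gradient, inner_gradient, h2]
    simp
  have hcl : HasCompactSupport (fun y => φ (p + l • y)) :=
    hc.comp_homeomorph ((Homeomorph.smulOfNeZero l hl).trans (Homeomorph.addLeft p))
  have key := hw _ (hφ.comp hA) hcl
  simp only [Function.comp_def] at key
  have e1 := integral_comp_affine (fun y => u y • gradient φ (p + l • y)) l p
  have e2 := integral_comp_affine (fun y => φ (p + l • y) • g y) l p
  simp only [inv] at e1 e2
  rw [e1]
  simp_rw [hgr, smul_comm _ l] at key
  simp_rw [smul_comm (φ _) l⁻¹]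
  rw [integral_smul, e2]
  rw [integral_smul] at key
  rw [show ∫ y, u y • gradient φ (p + l • y) = l⁻¹ • (l • ∫ y, u y • gradient φ (p + l • y)) by
    rw [smul_smul, inv_mul_cancel₀ hl, one_smul], key]
  rw [smul_neg, smul_neg, smul_comm]

/-- Smooth functions are weakly differentiable. -/
theorem ContDiff.hasWeakGradient {v : E3 → ℝ} (hv : ContDiff ℝ ∞ v) :
    HasWeakGradient v (gradient v) := by
  refine ⟨hv.continuous.locallyIntegrable, (continuous_gradient hv).locallyIntegrable,
    fun φ hφ hc => ?_⟩
  have i1 : Integrable (fun x => v x • gradient φ x) :=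
    (hv.continuous.smul (continuous_gradient hφ)).integrable_of_hasCompactSupport
      (hasCompactSupport_gradient hc).smul_left
  have i2 : Integrable (fun x => φ x • gradient v x) :=
    (hφ.continuous.smul (continuous_gradient hv)).integrable_of_hasCompactSupport hc.smul_right
  apply ext_inner_right ℝ
  intro w
  rw [inner_neg_left, real_inner_comm, real_inner_comm w, ← integral_inner i1 w,
    ← integral_inner i2 w]
  simp_rw [inner_smul_right, fun a => real_inner_comm a w, inner_gradient]
  have := integral_mul_fderiv_eq_neg_fderiv_mul_of_integrable (𝕜 := ℝ) (μ := volume)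
    (f := v) (g := φ) (v := w) ?_ ?_ ?_ (fun x _ => hv.differentiable (by simp) x)
    (fun x _ => hφ.differentiable (by simp) x)
  · rw [this]
    simp_rw [mul_comm]
  · have := i2.inner_const (𝕜 := ℝ) w
    simpa [inner_smul_left, inner_gradient, mul_comm] using this
  · have := i1.inner_const (𝕜 := ℝ) w
    simpa [inner_smul_left, inner_gradient] using this
  · exact (hv.continuous.mul hφ.continuous).integrable_of_hasCompactSupport hc.mul_left

/-! ### The Coulomb singularity is controlled by the kinetic energy -/

theorem enorm_sq_eq_ofReal (t : ℝ) : ‖t‖ₑ ^ 2 = ENNReal.ofReal (t ^ 2) := by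
  rw [Real.enorm_eq_ofReal_abs, ← ENNReal.ofReal_pow (abs_nonneg t), sq_abs]

theorem enorm_sq_eq_ofReal_norm_sq (t : E3) : ‖t‖ₑ ^ 2 = ENNReal.ofReal (‖t‖ ^ 2) := by
  rw [← ofReal_norm, ← ENNReal.ofReal_pow (norm_nonneg t)]

/-- The smooth approximation `√(|x|² + d²)` of `|x|`. -/
def smoothNorm (d : ℝ) (x : E3) : ℝ := √(‖x‖ ^ 2 + d ^ 2)

theorem smoothNorm_pos {d : ℝ} (hd : 0 < d) (x : E3) : 0 < smoothNorm d x := by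
  unfold smoothNorm; positivity

theorem norm_le_smoothNorm (d : ℝ) (x : E3) : ‖x‖ ≤ smoothNorm d x :=
  Real.le_sqrt_of_sq_le (by nlinarith [sq_nonneg d])

theorem smoothNorm_sq (d : ℝ) (x : E3) : smoothNorm d x ^ 2 = ‖x‖ ^ 2 + d ^ 2 :=
  Real.sq_sqrt (by positivity)

theorem contDiff_smoothNorm {d : ℝ} (hd : 0 < d) : ContDiff ℝ ∞ (smoothNorm d) := by
  unfold smoothNorm
  exact ((contDiff_norm_sq ℝ).add contDiff_const).sqrt fun x => by positivity

theorem hasFDerivAt_smoothNorm {d : ℝ} (hd : 0 < d) (x : E3) :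
    HasFDerivAt (smoothNorm d) ((smoothNorm d x)⁻¹ • innerSL ℝ x) x := by
  have h : HasFDerivAt (fun x : E3 => ‖x‖ ^ 2 + d ^ 2) (2 • innerSL ℝ x) x :=
    (hasStrictFDerivAt_norm_sq x).hasFDerivAt.add_const _
  have h2 := h.sqrt (by positivity)
  refine h2.congr_fderiv ?_
  ext v
  have := smoothNorm_pos hd x
  simp only [smoothNorm] at this ⊢
  simp
  field_simp

/-- Summed over j, this is the divergence 3/s - |x-p|²/s³ ≥ 2/s of the field (x-p)/s, where s is the
smoothed distance to p. That field has length at most 1. -/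
theorem fderiv_coord_div_smoothNorm {d : ℝ} (hd : 0 < d) (p x : E3) (j : Fin 3) :
    fderiv ℝ (fun y : E3 => (y - p) j * (smoothNorm d (y - p))⁻¹) x (EuclideanSpace.single j 1)
      = (smoothNorm d (x - p))⁻¹ - ((x - p) j) ^ 2 * (smoothNorm d (x - p))⁻¹ ^ 3 := by
  have hs := smoothNorm_pos hd (x - p)
  have h1 : HasFDerivAt (fun y : E3 => smoothNorm d (y - p))
      ((smoothNorm d (x - p))⁻¹ • innerSL ℝ (x - p)) x := by
    have := (hasFDerivAt_smoothNorm hd (x - p)).comp x ((hasFDerivAt_id x).sub_const p)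
    rwa [ContinuousLinearMap.comp_id] at this
  have h2 : HasFDerivAt (fun y : E3 => (smoothNorm d (y - p))⁻¹)
      (-(smoothNorm d (x - p) ^ 2)⁻¹ • ((smoothNorm d (x - p))⁻¹ • innerSL ℝ (x - p))) x :=
    (hasDerivAt_inv hs.ne').comp_hasFDerivAt x h1
  have h3 : HasFDerivAt (fun y : E3 => (y - p) j) (EuclideanSpace.proj j : E3 →L[ℝ] ℝ) x := by
    have := (EuclideanSpace.proj j : E3 →L[ℝ] ℝ).hasFDerivAt.comp x
      ((hasFDerivAt_id x).sub_const p)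
    rwa [ContinuousLinearMap.comp_id] at this
  rw [(h3.fun_mul h2).fderiv]
  simp [EuclideanSpace.inner_single_right]
  field_simp
  ring

/-- Since div((x-p)/s) dominates 1/s, integrating v² against this divergence and integrating by
parts leaves 2|v||∇v|, which Young's inequality splits with weight a. Smoothing by d keeps the field
smooth at p; the bound does not depend on d. -/
theorem hardy_smooth {v : E3 → ℝ} (hv : ContDiff ℝ ∞ v) (hc : HasCompactSupport v) (p : E3)
    {a d : ℝ} (ha : 0 < a) (hd : 0 < d) :
    ∫ x, v x ^ 2 * (smoothNorm d (x - p))⁻¹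
      ≤ ∫ x, (a * ‖gradient v x‖ ^ 2 + a⁻¹ * v x ^ 2) := by
  set s : E3 → ℝ := fun x => smoothNorm d (x - p) with hs
  have hspos : ∀ x, 0 < s x := fun x => smoothNorm_pos hd _
  have hsd : ContDiff ℝ ∞ s := (contDiff_smoothNorm hd).comp (contDiff_id.sub contDiff_const)
  have hsi : ContDiff ℝ ∞ (fun x => (s x)⁻¹) := hsd.inv fun x => (hspos x).ne'
  let φ : E3 → ℝ := fun x => v x ^ 2
  have hφ : ContDiff ℝ ∞ φ := hv.pow 2
  have hφc : HasCompactSupport φ := hc.mono fun x hx h => hx (by simp [φ, h])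
  let w : Fin 3 → E3 → ℝ := fun j x => (x - p) j * (s x)⁻¹
  have hw : ∀ j, ContDiff ℝ ∞ (w j) := fun j => by
    have : ContDiff ℝ ∞ (fun x : E3 => (x - p) j) :=
      (EuclideanSpace.proj j : E3 →L[ℝ] ℝ).contDiff.comp (contDiff_id.sub contDiff_const)
    exact this.mul hsi
  have hdφ : ∀ e : E3, Continuous fun x => fderiv ℝ φ x e := fun e =>
    (hφ.continuous_fderiv (by simp)).clm_apply continuous_const
  have hdφc : ∀ e : E3, HasCompactSupport fun x => fderiv ℝ φ x e := fun e =>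
    (hφc.fderiv (𝕜 := ℝ)).mono fun x hx h => hx (by simp [h])
  have hdw : ∀ j, ∀ e : E3, Continuous fun x => fderiv ℝ (w j) x e := fun j e =>
    ((hw j).continuous_fderiv (by simp)).clm_apply continuous_const
  have i1 : ∀ j, Integrable (fun x => w j x * fderiv ℝ φ x (EuclideanSpace.single j 1)) := fun j =>
    ((hw j).continuous.mul (hdφ _)).integrable_of_hasCompactSupport
      ((hdφc (EuclideanSpace.single j 1)).mono fun x hx => right_ne_zero_of_mul hx)
  have i2 : ∀ j, Integrable (fun x => fderiv ℝ (w j) x (EuclideanSpace.single j 1) * φ x) :=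
    fun j => ((hdw j _).mul hφ.continuous).integrable_of_hasCompactSupport
      (hφc.mono fun x hx => right_ne_zero_of_mul hx)
  have ibp : ∀ j, ∫ x, w j x * fderiv ℝ φ x (EuclideanSpace.single j 1)
      = -∫ x, fderiv ℝ (w j) x (EuclideanSpace.single j 1) * φ x := fun j =>
    integral_mul_fderiv_eq_neg_fderiv_mul_of_integrable (i2 j) (i1 j)
      (((hw j).continuous.mul hφ.continuous).integrable_of_hasCompactSupport
        (hφc.mono fun x hx => right_ne_zero_of_mul hx))
      (fun x _ => (hw j).differentiable (by simp) x) (fun x _ => hφ.differentiable (by simp) x)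
  have hsum : ∫ x, ∑ j, fderiv ℝ (w j) x (EuclideanSpace.single j 1) * φ x
      = ∫ x, -∑ j, w j x * fderiv ℝ φ x (EuclideanSpace.single j 1) := by
    rw [integral_neg, integral_finsetSum _ fun j _ => i1 j,
      integral_finsetSum _ fun j _ => i2 j, ← Finset.sum_neg_distrib]
    exact Finset.sum_congr rfl fun j _ => by rw [ibp j, neg_neg]
  have hgc : HasCompactSupport fun x => a * ‖gradient v x‖ ^ 2 + a⁻¹ * v x ^ 2 := by
    have h1 : HasCompactSupport fun x => a * ‖gradient v x‖ ^ 2 :=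
      (hasCompactSupport_gradient hc).mono fun x hx h => hx (by simp [h])
    have h2 : HasCompactSupport fun x => a⁻¹ * v x ^ 2 := hc.mono fun x hx h => hx (by simp [h])
    exact h1.add h2
  calc ∫ x, v x ^ 2 * (s x)⁻¹
      ≤ ∫ x, ∑ j, fderiv ℝ (w j) x (EuclideanSpace.single j 1) * φ x := by
        refine integral_mono ((hφ.continuous.mul hsi.continuous).integrable_of_hasCompactSupport
          (hφc.mono fun x hx => left_ne_zero_of_mul hx)) (integrable_finsetSum _ fun j _ => i2 j)
          fun x => ?_
        have hx := hspos x
        simp only [w, hs, fderiv_coord_div_smoothNorm hd]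
        rw [← Finset.sum_mul, mul_comm]
        refine mul_le_mul_of_nonneg_right ?_ (sq_nonneg _)
        rw [Finset.sum_sub_distrib, ← Finset.sum_mul]
        have e1 : ∑ j, (x - p) j ^ 2 = ‖x - p‖ ^ 2 := by
          rw [EuclideanSpace.norm_sq_eq]; simp
        have e2 : ‖x - p‖ ^ 2 * (smoothNorm d (x - p))⁻¹ ^ 3 ≤ (smoothNorm d (x - p))⁻¹ := by
          have h3 : ‖x - p‖ ^ 2 ≤ smoothNorm d (x - p) ^ 2 := by
            rw [smoothNorm_sq]; nlinarith [sq_nonneg d]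
          calc _ ≤ smoothNorm d (x - p) ^ 2 * (smoothNorm d (x - p))⁻¹ ^ 3 := by gcongr
            _ = _ := by
              have : smoothNorm d (x - p) ≠ 0 := hx.ne'
              field_simp
        have e3 : 0 < (smoothNorm d (x - p))⁻¹ := inv_pos.2 hx
        rw [e1, Finset.sum_const, Finset.card_univ, Fintype.card_fin, nsmul_eq_mul]
        push_cast
        linarith
    _ = ∫ x, -∑ j, w j x * fderiv ℝ φ x (EuclideanSpace.single j 1) := hsum
    _ ≤ ∫ x, (a * ‖gradient v x‖ ^ 2 + a⁻¹ * v x ^ 2) := by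
        refine integral_mono (integrable_finsetSum _ fun j _ => i1 j).neg
          ((((continuous_gradient hv).norm.pow 2).const_mul a |>.add
            ((hv.continuous.pow 2).const_mul a⁻¹)).integrable_of_hasCompactSupport hgc)
          fun x => ?_
        have e1 : ∑ j, w j x * fderiv ℝ φ x (EuclideanSpace.single j 1)
            = 2 * v x * ((s x)⁻¹ * inner ℝ (gradient v x) (x - p)) := by
          have hf : fderiv ℝ φ x = (2 * v x) • fderiv ℝ v x := by
            have := ((hv.differentiable (by simp) x).hasFDerivAt.pow 2).fderiv
            simpa using this
          have hx : x - p = ∑ j, (x - p) j • (EuclideanSpace.single j 1 : E3) := by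
            ext i; fin_cases i <;> simp [Fin.sum_univ_three]
          rw [inner_gradient]
          conv_rhs => rw [hx]
          rw [map_sum, Finset.mul_sum, Finset.mul_sum]
          refine Finset.sum_congr rfl fun j _ => ?_
          simp only [w, hf, map_smul, smul_eq_mul, smul_apply]
          ring
        have e2 : |(s x)⁻¹ * inner ℝ (gradient v x) (x - p)| ≤ ‖gradient v x‖ := by
          rw [abs_mul, abs_of_pos (inv_pos.2 (hspos x)), inv_mul_le_iff₀ (hspos x), mul_comm]
          exact (abs_real_inner_le_norm _ _).trans
            (mul_le_mul_of_nonneg_left (norm_le_smoothNorm d _) (norm_nonneg _))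
        dsimp only
        rw [e1]
        set q := (s x)⁻¹ * inner ℝ (gradient v x) (x - p)
        have e3 : q ^ 2 ≤ ‖gradient v x‖ ^ 2 := sq_le_sq' (by linarith [neg_abs_le q])
          ((le_abs_self q).trans e2)
        -- Young's inequality in the form of a completed square.
        have e4 : 0 ≤ a⁻¹ * (a * q + v x) ^ 2 := by positivity
        have e5 : a⁻¹ * (a * q + v x) ^ 2 = a * q ^ 2 + 2 * v x * q + a⁻¹ * v x ^ 2 := by
          field_simp; ring
        nlinarith

/-- Averaging against a probability density does not increase the `L²` norm. -/
theorem lintegral_enorm_sq_convolution_le {F : Type*} [NormedAddCommGroup F] [NormedSpace ℝ F]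
    {k : E3 → ℝ} (hk : Continuous k) (hk0 : ∀ x, 0 ≤ k x) (hk1 : ∫⁻ x, ENNReal.ofReal (k x) = 1)
    {f : E3 → F} (hf : AEStronglyMeasurable f) :
    ∫⁻ x, ‖∫ y, k (x - y) • f y‖ₑ ^ 2 ≤ ∫⁻ x, ‖f x‖ₑ ^ 2 := by
  have hkm : ∀ x, Measurable fun y => ENNReal.ofReal (k (x - y)) := fun x =>
    (hk.comp (continuous_const.sub continuous_id)).measurable.ennreal_ofReal
  have hint : ∀ x, ∫⁻ y, ENNReal.ofReal (k (x - y)) = 1 := fun x => by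
    rw [lintegral_sub_left_eq_self (fun y => ENNReal.ofReal (k y)) x, hk1]
  have hint' : ∀ y, ∫⁻ x, ENNReal.ofReal (k (x - y)) = 1 := fun y => by
    rw [lintegral_sub_right_eq_self (fun y => ENNReal.ofReal (k y)) y, hk1]
  have jensen : ∀ x, ‖∫ y, k (x - y) • f y‖ₑ ^ 2
      ≤ ∫⁻ y, ENNReal.ofReal (k (x - y)) * ‖f y‖ₑ ^ 2 := by
    intro x
    set m : Measure E3 := volume.withDensity fun y => ENNReal.ofReal (k (x - y)) with hm
    have hfm : AEMeasurable (fun y => ‖f y‖ₑ) m :=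
      hf.enorm.mono_ac (withDensity_absolutelyContinuous _ _)
    have e1 : ‖∫ y, k (x - y) • f y‖ₑ ≤ ∫⁻ y, ‖f y‖ₑ ∂m := by
      refine (enorm_integral_le_lintegral_enorm _).trans ?_
      rw [hm, lintegral_withDensity_eq_lintegral_mul₀ (hkm x).aemeasurable hf.enorm]
      refine (lintegral_congr fun y => ?_).le
      rw [enorm_smul, Real.enorm_eq_ofReal (hk0 _)]
      rfl
    -- Jensen's inequality, as Cauchy–Schwarz against the constant 1 for the probability measure m.
    have e2 := ENNReal.lintegral_mul_le_Lp_mul_Lq m Real.HolderConjugate.two_two hfm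
      (aemeasurable_const (b := (1 : ℝ≥0∞)))
    have e3 : m Set.univ = 1 := by simp [hm, hint x]
    have e4 : ∫⁻ y, ‖f y‖ₑ ^ 2 ∂m = ∫⁻ y, ENNReal.ofReal (k (x - y)) * ‖f y‖ₑ ^ 2 := by
      rw [hm, lintegral_withDensity_eq_lintegral_mul₀ (hkm x).aemeasurable (hf.enorm.pow_const 2)]
      rfl
    simp only [Pi.mul_apply, mul_one, lintegral_const, e3,
      ENNReal.rpow_ofNat, e4, one_pow, ENNReal.one_rpow] at e2
    calc ‖∫ y, k (x - y) • f y‖ₑ ^ 2 ≤ (∫⁻ y, ‖f y‖ₑ ∂m) ^ 2 := by gcongr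
      _ ≤ ((∫⁻ y, ENNReal.ofReal (k (x - y)) * ‖f y‖ₑ ^ 2) ^ (1 / 2 : ℝ)) ^ 2 := by gcongr
      _ = _ := by
        rw [← ENNReal.rpow_natCast, ← ENNReal.rpow_mul]; norm_num
  calc ∫⁻ x, ‖∫ y, k (x - y) • f y‖ₑ ^ 2
      ≤ ∫⁻ x, ∫⁻ y, ENNReal.ofReal (k (x - y)) * ‖f y‖ₑ ^ 2 := lintegral_mono jensen
    _ = ∫⁻ y, ∫⁻ x, ENNReal.ofReal (k (x - y)) * ‖f y‖ₑ ^ 2 := by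
        refine lintegral_lintegral_swap ?_
        have h1 : AEMeasurable (fun z : E3 × E3 => ENNReal.ofReal (k (z.1 - z.2)))
            (volume.prod volume) :=
          (hk.comp (continuous_fst.sub continuous_snd)).measurable.ennreal_ofReal.aemeasurable
        exact h1.mul (hf.enorm.pow_const 2).comp_snd
    _ = ∫⁻ y, ‖f y‖ₑ ^ 2 := by
        refine lintegral_congr fun y => ?_
        rw [lintegral_mul_const'' _ ?_, hint' y, one_mul]
        exact (hk.comp (continuous_id.sub continuous_const)).measurable.ennreal_ofReal.aemeasurable

/-- The gradient of a mollification is the mollification of the weak gradient. -/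
theorem HasWeakGradient.gradient_convolution {u : E3 → ℝ} {g : E3 → E3} (h : HasWeakGradient u g)
    {k : E3 → ℝ} (hk : ContDiff ℝ ∞ k) (hkc : HasCompactSupport k) (x : E3) :
    gradient (convolution k u (ContinuousLinearMap.lsmul ℝ ℝ) volume) x
      = ∫ y, k (x - y) • g y := by
  obtain ⟨hu, hg, hw⟩ := h
  have hψ : ContDiff ℝ ∞ (fun y => k (x - y)) := hk.comp (contDiff_const.sub contDiff_id)
  have hψc : HasCompactSupport (fun y => k (x - y)) :=
    hkc.comp_homeomorph (Homeomorph.subLeft x)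
  have key := hw _ hψ hψc
  have hgr : ∀ y, gradient (fun y => k (x - y)) y = -gradient k (x - y) := by
    intro y
    apply ext_inner_right ℝ
    intro v
    have h1 : HasFDerivAt (fun y : E3 => x - y) (-ContinuousLinearMap.id ℝ E3) y :=
      (hasFDerivAt_id y).const_sub x
    have h2 := ((hk.differentiable (by simp) (x - y)).hasFDerivAt.comp y h1).fderiv
    rw [Function.comp_def] at h2
    rw [inner_neg_left, inner_gradient, inner_gradient, h2]
    simp
  have hd := (hkc.hasFDerivAt_convolution_left (ContinuousLinearMap.lsmul ℝ ℝ)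
    (hk.of_le (by simp)) hu x).fderiv
  simp_rw [hgr, smul_neg, integral_neg, neg_inj] at key
  rw [← key]
  apply ext_inner_right ℝ
  intro v
  have i1 : Integrable (fun y => u y • gradient k (x - y)) := by
    have h1 : HasCompactSupport (fun y => gradient k (x - y)) :=
      (hasCompactSupport_gradient hkc).comp_homeomorph (Homeomorph.subLeft x)
    exact hu.integrable_smul_right_of_hasCompactSupport
      ((continuous_gradient hk).comp (continuous_const.sub continuous_id)) h1
  rw [inner_gradient, hd, convolution_eq_swap, real_inner_comm, ← integral_inner i1 v]
  have i2 : Integrable (fun y => (ContinuousLinearMap.precompL E3 (ContinuousLinearMap.lsmul ℝ ℝ))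
      (fderiv ℝ k (x - y)) (u y)) := by
    have h3 : Continuous fun y => fderiv ℝ k (x - y) :=
      (hk.continuous_fderiv (by simp)).comp (continuous_const.sub continuous_id)
    have h4 : HasCompactSupport fun y => fderiv ℝ k (x - y) :=
      (hkc.fderiv (𝕜 := ℝ)).comp_homeomorph (Homeomorph.subLeft x)
    have h5 : Integrable fun y => u y • fderiv ℝ k (x - y) :=
      hu.integrable_smul_right_of_hasCompactSupport h3 h4
    refine h5.congr (Eventually.of_forall fun y => ?_)
    ext v
    simp [mul_comm]
  rw [ContinuousLinearMap.integral_apply i2]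
  refine integral_congr_ae (Eventually.of_forall fun y => ?_)
  simp only [ContinuousLinearMap.precompL_apply, ContinuousLinearMap.lsmul_apply, smul_eq_mul,
    inner_smul_right]
  rw [real_inner_comm, inner_gradient, mul_comm]

/-- A mollification of a compactly supported function with a square integrable weak gradient
satisfies the regularized Hardy type bound with the norms of that function. -/
theorem HasWeakGradient.hardy_mollified {u : E3 → ℝ} {g : E3 → E3} (h : HasWeakGradient u g)
    (hc : HasCompactSupport u) (p : E3) {a d : ℝ} (ha : 0 < a) (hd : 0 < d)
    (k : ContDiffBump (0 : E3)) :
    ∫⁻ x, ENNReal.ofReal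
        (convolution (k.normed volume) u (ContinuousLinearMap.lsmul ℝ ℝ) volume x ^ 2
          * (smoothNorm d (x - p))⁻¹)
      ≤ ENNReal.ofReal a * (∫⁻ x, ‖g x‖ₑ ^ 2) + ENNReal.ofReal a⁻¹ * ∫⁻ x, ‖u x‖ₑ ^ 2 := by
  set v := convolution (k.normed volume) u (ContinuousLinearMap.lsmul ℝ ℝ) volume with hvdef
  have hkd : ContDiff ℝ ∞ (k.normed volume) := k.contDiff_normed
  have hv : ContDiff ℝ ∞ v :=
    k.hasCompactSupport_normed.contDiff_convolution_left _ k.contDiff_normed h.1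
  have hvc : HasCompactSupport v := k.hasCompactSupport_normed.convolution _ hc
  have hs : Continuous fun x => (smoothNorm d (x - p))⁻¹ :=
    ((contDiff_smoothNorm hd).continuous.comp (continuous_id.sub continuous_const)).inv₀
      fun x => (smoothNorm_pos hd _).ne'
  have hk1 : ∫⁻ x, ENNReal.ofReal (k.normed volume x) = 1 := by
    rw [← ofReal_integral_eq_lintegral_ofReal k.integrable_normed
      (Eventually.of_forall k.nonneg_normed), k.integral_normed, ENNReal.ofReal_one]
  have hgrad : ∫⁻ x, ‖gradient v x‖ₑ ^ 2 ≤ ∫⁻ x, ‖g x‖ₑ ^ 2 := by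
    simp_rw [hvdef, h.gradient_convolution hkd k.hasCompactSupport_normed]
    exact lintegral_enorm_sq_convolution_le hkd.continuous k.nonneg_normed hk1
      h.2.1.aestronglyMeasurable
  have hval : ∫⁻ x, ‖v x‖ₑ ^ 2 ≤ ∫⁻ x, ‖u x‖ₑ ^ 2 := by
    simp_rw [hvdef, convolution_lsmul_swap]
    exact lintegral_enorm_sq_convolution_le hkd.continuous k.nonneg_normed hk1
      h.1.aestronglyMeasurable
  have hcs1 : HasCompactSupport fun x => v x ^ 2 * (smoothNorm d (x - p))⁻¹ :=
    hvc.mono fun x hx h => hx (by simp [h])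
  have hcs2 : HasCompactSupport fun x => a * ‖gradient v x‖ ^ 2 :=
    (hasCompactSupport_gradient hvc).mono fun x hx h => hx (by simp [h])
  have hcs3 : HasCompactSupport fun x => a⁻¹ * v x ^ 2 := hvc.mono fun x hx h => hx (by simp [h])
  have hc2 : Continuous fun x => a * ‖gradient v x‖ ^ 2 :=
    ((continuous_gradient hv).norm.pow 2).const_mul a
  have hc3 : Continuous fun x => a⁻¹ * v x ^ 2 := (hv.continuous.pow 2).const_mul a⁻¹
  have hc1 : Continuous fun x => v x ^ 2 * (smoothNorm d (x - p))⁻¹ := (hv.continuous.pow 2).mul hs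
  rw [← ofReal_integral_eq_lintegral_ofReal (hc1.integrable_of_hasCompactSupport hcs1)
    (Eventually.of_forall fun x => mul_nonneg (sq_nonneg _)
      (inv_nonneg.2 (smoothNorm_pos hd _).le))]
  refine (ENNReal.ofReal_le_ofReal (hardy_smooth hv hvc p ha hd)).trans ?_
  have hi : Integrable fun x => a * ‖gradient v x‖ ^ 2 + a⁻¹ * v x ^ 2 :=
    (hc2.integrable_of_hasCompactSupport hcs2).add (hc3.integrable_of_hasCompactSupport hcs3)
  rw [ofReal_integral_eq_lintegral_ofReal hi
    (Eventually.of_forall fun x => by positivity)]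
  have e : ∀ x, ENNReal.ofReal (a * ‖gradient v x‖ ^ 2 + a⁻¹ * v x ^ 2)
      = ENNReal.ofReal a * ‖gradient v x‖ₑ ^ 2 + ENNReal.ofReal a⁻¹ * ‖v x‖ₑ ^ 2 := fun x => by
    rw [ENNReal.ofReal_add (by positivity) (by positivity), ENNReal.ofReal_mul ha.le,
      ENNReal.ofReal_mul (inv_pos.2 ha).le, enorm_sq_eq_ofReal, enorm_sq_eq_ofReal_norm_sq]
  simp_rw [e]
  rw [lintegral_add_left' (((continuous_gradient hv).measurable.enorm.pow_const 2).const_mul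
      _).aemeasurable, lintegral_const_mul _ ((continuous_gradient hv).measurable.enorm.pow_const 2),
    lintegral_const_mul _ (hv.continuous.measurable.enorm.pow_const 2)]
  exact add_le_add (mul_le_mul' le_rfl hgrad) (mul_le_mul' le_rfl hval)

theorem tendsto_inv_smoothNorm {x : E3} (hx : x ≠ 0) {d : ℕ → ℝ} (hd : Tendsto d atTop (𝓝 0)) :
    Tendsto (fun n => (smoothNorm (d n) x)⁻¹) atTop (𝓝 ‖x‖⁻¹) := by
  refine Tendsto.inv₀ ?_ (norm_ne_zero_iff.2 hx)
  have h : Tendsto (fun n => √(‖x‖ ^ 2 + d n ^ 2)) atTop (𝓝 √(‖x‖ ^ 2 + 0 ^ 2)) :=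
    (tendsto_const_nhds.add (hd.pow 2)).sqrt
  simpa [smoothNorm] using h

/-- For a compactly supported function in `H¹(ℝ³)`, the Coulomb energy with respect to a point
charge is bounded by the `L²` norms of the gradient and of the function. -/
theorem HasWeakGradient.hardy {u : E3 → ℝ} {g : E3 → E3} (h : HasWeakGradient u g)
    (hc : HasCompactSupport u) (p : E3) {a : ℝ} (ha : 0 < a) :
    ∫⁻ x, ENNReal.ofReal (u x ^ 2) * (edist x p)⁻¹
      ≤ ENNReal.ofReal a * (∫⁻ x, ‖g x‖ₑ ^ 2)
        + ENNReal.ofReal a⁻¹ * ∫⁻ x, ENNReal.ofReal (u x ^ 2) := by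
  let d : ℕ → ℝ := fun n => 1 / ((n : ℝ) + 1)
  have hdpos : ∀ n, 0 < d n := fun n => Nat.one_div_pos_of_nat
  have hd : Tendsto d atTop (𝓝 0) := tendsto_one_div_add_atTop_nhds_zero_nat
  -- The mollification radius and the smoothing of the norm shrink together. The ratio 2 of the two
  -- radii stays fixed, as the almost everywhere convergence of the mollifications requires.
  let k : ℕ → ContDiffBump (0 : E3) := fun n =>
    ⟨d n / 2, d n, half_pos (hdpos n), half_lt_self (hdpos n)⟩
  let v : ℕ → E3 → ℝ := fun n =>
    convolution ((k n).normed volume) u (ContinuousLinearMap.lsmul ℝ ℝ) volume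
  have hlim : ∀ᵐ x, Tendsto (fun n => v n x) atTop (𝓝 (u x)) :=
    ContDiffBump.ae_convolution_tendsto_right_of_locallyIntegrable (K := 2) hd
      (Eventually.of_forall fun n => by simp [k]; linarith) h.1
  have hne : ∀ᵐ x : E3, x ≠ p := by simp [ae_iff]
  let F : ℕ → E3 → ℝ≥0∞ := fun n x =>
    ENNReal.ofReal (v n x ^ 2 * (smoothNorm (d n) (x - p))⁻¹)
  have hFm : ∀ n, Measurable (F n) := fun n => by
    have h1 : ContDiff ℝ ∞ (v n) := (k n).hasCompactSupport_normed.contDiff_convolution_left _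
      (k n).contDiff_normed h.1
    have h2 : Continuous fun x => smoothNorm (d n) (x - p) :=
      (contDiff_smoothNorm (hdpos n)).continuous.comp (continuous_id.sub continuous_const)
    exact ((h1.continuous.measurable.pow_const 2).mul h2.measurable.inv).ennreal_ofReal
  have hFlim : ∀ᵐ x, ENNReal.ofReal (u x ^ 2) * (edist x p)⁻¹
      = liminf (fun n => F n x) atTop := by
    filter_upwards [hlim, hne] with x hx hxp
    have hxp' : x - p ≠ 0 := sub_ne_zero.2 hxp
    have h1 : Tendsto (fun n => F n x) atTop (𝓝 (ENNReal.ofReal (u x ^ 2 * ‖x - p‖⁻¹))) :=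
      ENNReal.tendsto_ofReal ((hx.pow 2).mul (tendsto_inv_smoothNorm hxp' hd))
    rw [h1.liminf_eq, ENNReal.ofReal_mul (sq_nonneg _), edist_dist, dist_eq_norm,
      ENNReal.ofReal_inv_of_pos (norm_pos_iff.2 hxp')]
  rw [lintegral_congr_ae hFlim]
  -- Fatou's lemma; the bound for the mollifications is uniform in n.
  refine (lintegral_liminf_le hFm).trans ?_
  refine liminf_le_of_frequently_le' (Frequently.of_forall fun n => ?_)
  have := h.hardy_mollified hc p ha (hdpos n) (k n)
  simpa only [enorm_sq_eq_ofReal] using this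

/-! ### Measures with a given square root of the density -/

/-- The measure with density `u²`. -/
def sqDensity (u : E3 → ℝ) : Measure E3 := volume.withDensity fun x => ENNReal.ofReal (u x ^ 2)

theorem HasWeakGradient.aemeasurable_sq {u : E3 → ℝ} {g : E3 → E3} (h : HasWeakGradient u g) :
    AEMeasurable fun x => ENNReal.ofReal (u x ^ 2) :=
  (h.1.aestronglyMeasurable.aemeasurable.pow_const 2).ennreal_ofReal

theorem HasWeakGradient.lintegral_sqDensity {u : E3 → ℝ} {g : E3 → E3} (h : HasWeakGradient u g)
    {f : E3 → ℝ≥0∞} (hf : Measurable f) :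
    ∫⁻ x, f x ∂sqDensity u = ∫⁻ x, ENNReal.ofReal (u x ^ 2) * f x := by
  rw [sqDensity, lintegral_withDensity_eq_lintegral_mul₀ h.aemeasurable_sq hf.aemeasurable]
  rfl

theorem sqDensity_univ (u : E3 → ℝ) :
    sqDensity u Set.univ = ∫⁻ x, ENNReal.ofReal (u x ^ 2) := by
  simp [sqDensity]

theorem sqDensity_eq_zero {u : E3 → ℝ} {s : Set E3} (hs : MeasurableSet s)
    (hu : ∀ x ∈ s, u x = 0) : sqDensity u s = 0 := by
  rw [sqDensity, withDensity_apply _ hs]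
  exact setLIntegral_eq_zero hs fun x hx => by simp [hu x hx]

/-- If the functions `v k` live on disjoint sets, their sum is the square root of the density of
the sum of the measures, and the kinetic energies add up. -/
theorem kinetic_sum_le {ι : Type*} [Fintype ι] {v : ι → E3 → ℝ} {γ : ι → E3 → E3}
    {S : ι → Set E3} (hw : ∀ k, HasWeakGradient (v k) (γ k)) (hv0 : ∀ k x, 0 ≤ v k x)
    (hS : ∀ k l, k ≠ l → Disjoint (S k) (S l)) (hvS : ∀ k, ∀ x ∉ S k, v k x = 0)
    (hγS : ∀ k, ∀ x ∉ S k, γ k x = 0) :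
    kinetic (∑ k, sqDensity (v k)) ≤ ∑ k, ∫⁻ x, ‖γ k x‖ₑ ^ 2 := by
  classical
  have hcase : ∀ x, (∃ k, ∀ l, l ≠ k → x ∉ S l) ∨ ∀ l, x ∉ S l := by
    intro x
    by_cases hx : ∃ k, x ∈ S k
    · obtain ⟨k, hk⟩ := hx
      exact Or.inl ⟨k, fun l hl hxl => Set.disjoint_left.1 (hS l k hl) hxl hk⟩
    · exact Or.inr (not_exists.1 hx)
  have hsq : ∀ x, ENNReal.ofReal ((∑ k, v k x) ^ 2) = ∑ k, ENNReal.ofReal (v k x ^ 2) := by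
    intro x
    rcases hcase x with ⟨k, hk⟩ | h
    · rw [Finset.sum_eq_single k (fun l _ hl => hvS l x (hk l hl)) (by simp),
        Finset.sum_eq_single k (fun l _ hl => by simp [hvS l x (hk l hl)]) (by simp)]
    · simp [fun k => hvS k x (h k)]
  have hgr : ∀ x, ‖∑ k, γ k x‖ₑ ^ 2 = ∑ k, ‖γ k x‖ₑ ^ 2 := by
    intro x
    rcases hcase x with ⟨k, hk⟩ | h
    · rw [Finset.sum_eq_single k (fun l _ hl => hγS l x (hk l hl)) (by simp),
        Finset.sum_eq_single k (fun l _ hl => by simp [hγS l x (hk l hl)]) (by simp)]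
    · simp [fun k => hγS k x (h k)]
  have hmeas : ∀ k, AEMeasurable (fun x => ‖γ k x‖ₑ ^ 2) := fun k =>
    (hw k).2.1.aestronglyMeasurable.enorm.pow_const 2
  rw [← lintegral_finsetSum' _ fun k _ => hmeas k]
  simp_rw [← hgr]
  refine iInf_le_of_le (fun x => ∑ k, v k x) (iInf_le_of_le (fun x => ∑ k, γ k x)
    (iInf_le_of_le ⟨fun x => Finset.sum_nonneg fun k _ => hv0 k x, ?_,
      HasWeakGradient.sum _ fun k _ => hw k⟩ le_rfl))
  ext s hs
  rw [withDensity_apply _ hs]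
  simp_rw [hsq]
  rw [lintegral_finsetSum' _ fun k _ => (hw k).aemeasurable_sq.restrict]
  simp [sqDensity, withDensity_apply _ hs]

/-! ### Dilations -/

/-- The mass preserving dilation of the square root of a density by the factor `l`, followed by
the translation by `p`. -/
def dilate (l : ℝ) (p : E3) (u : E3 → ℝ) (x : E3) : ℝ := √(l⁻¹ ^ 3) * u (l⁻¹ • (x - p))

/-- The weak gradient of a dilation. -/
def dilateGradient (l : ℝ) (p : E3) (g : E3 → E3) (x : E3) : E3 :=
  √(l⁻¹ ^ 3) • l⁻¹ • g (l⁻¹ • (x - p))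

theorem HasWeakGradient.dilate {u : E3 → ℝ} {g : E3 → E3} (h : HasWeakGradient u g)
    {l : ℝ} (hl : l ≠ 0) (p : E3) :
    HasWeakGradient (dilate l p u) (dilateGradient l p g) :=
  (h.comp_affine hl p).const_mul _

theorem lintegral_comp_affine (F : E3 → ℝ≥0∞) {l : ℝ} (hl : 0 < l) (p : E3) :
    ∫⁻ x, F (l⁻¹ • (x - p)) = ENNReal.ofReal (l ^ 3) * ∫⁻ x, F x := by
  have hl' : l⁻¹ ≠ 0 := inv_ne_zero hl.ne'
  rw [lintegral_sub_right_eq_self (fun x => F (l⁻¹ • x)) p]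
  have h1 := lintegral_map_equiv (μ := volume) F
    (Homeomorph.smulOfNeZero l⁻¹ hl' : E3 ≃ₜ E3).toMeasurableEquiv
  have h2 : (Homeomorph.smulOfNeZero l⁻¹ hl' : E3 ≃ₜ E3).toMeasurableEquiv
      = (fun x : E3 => l⁻¹ • x) := rfl
  rw [h2, Measure.map_addHaar_smul _ hl', lintegral_smul_measure] at h1
  rw [← h1]
  simp [abs_of_pos hl]

/-- The factor √(l⁻³) in `dilate` is chosen so that its square cancels the Jacobian l³. The case f =
1 is conservation of mass. -/
theorem lintegral_dilate {l : ℝ} (hl : 0 < l) (p : E3) (u : E3 → ℝ) (f : E3 → ℝ≥0∞) :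
    ∫⁻ x, ENNReal.ofReal (dilate l p u x ^ 2) * f x
      = ∫⁻ x, ENNReal.ofReal (u x ^ 2) * f (p + l • x) := by
  have inv : ∀ x : E3, p + l • (l⁻¹ • (x - p)) = x := fun x => by simp [smul_smul, hl.ne']
  have h := lintegral_comp_affine
    (fun x => ENNReal.ofReal (l⁻¹ ^ 3) * (ENNReal.ofReal (u x ^ 2) * f (p + l • x))) hl p
  conv_rhs at h => rw [lintegral_const_mul' _ _ ENNReal.ofReal_ne_top]
  rw [← mul_assoc (ENNReal.ofReal (l ^ 3)), ← ENNReal.ofReal_mul (by positivity), ← mul_pow,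
    mul_inv_cancel₀ hl.ne', one_pow,
    ENNReal.ofReal_one, one_mul] at h
  rw [← h]
  refine lintegral_congr fun x => ?_
  rw [inv, ← mul_assoc, ← ENNReal.ofReal_mul (by positivity), dilate, mul_pow,
    Real.sq_sqrt (by positivity)]

theorem lintegral_dilateGradient {l : ℝ} (hl : 0 < l) (p : E3) (g : E3 → E3) :
    ∫⁻ x, ‖dilateGradient l p g x‖ₑ ^ 2 = ENNReal.ofReal (l⁻¹ ^ 2) * ∫⁻ x, ‖g x‖ₑ ^ 2 := by
  have h := lintegral_comp_affine
    (fun x => ENNReal.ofReal (l⁻¹ ^ 3 * l⁻¹ ^ 2) * ‖g x‖ₑ ^ 2) hl p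
  conv_rhs at h => rw [lintegral_const_mul' _ _ ENNReal.ofReal_ne_top]
  rw [← mul_assoc (ENNReal.ofReal (l ^ 3)), ← ENNReal.ofReal_mul (by positivity), ← mul_assoc,
    ← mul_pow, mul_inv_cancel₀ hl.ne', one_pow,
    one_mul] at h
  rw [← h]
  refine lintegral_congr fun x => ?_
  rw [dilateGradient, smul_smul, enorm_smul, mul_pow, enorm_sq_eq_ofReal, mul_pow,
    Real.sq_sqrt (by positivity)]

theorem dilate_nonneg (l : ℝ) (p : E3) {u : E3 → ℝ} (hu : ∀ x, 0 ≤ u x) (x : E3) :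
    0 ≤ dilate l p u x :=
  mul_nonneg (Real.sqrt_nonneg _) (hu _)

theorem sqDensity_dilate {l : ℝ} (hl : 0 < l) (p : E3) (u : E3 → ℝ) :
    sqDensity (dilate l p u) = (sqDensity u).map fun x => p + l • x := by
  have hA : Measurable fun x : E3 => p + l • x := by fun_prop
  ext s hs
  rw [Measure.map_apply hA hs, sqDensity, sqDensity, withDensity_apply _ hs,
    withDensity_apply _ (hA hs), ← lintegral_indicator hs, ← lintegral_indicator (hA hs)]
  have := lintegral_dilate hl p u (s.indicator 1)
  refine Eq.trans (lintegral_congr fun x => ?_) (this.trans (lintegral_congr fun x => ?_))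
  · by_cases hx : x ∈ s <;> simp [hx]
  · by_cases hx : p + l • x ∈ s <;> simp [hx, Set.indicator]

/-! ### Completing a partial transport plan -/

/-- A partial plan `Q` for `μ` can be completed to a plan for `μ + σ` at a bounded price, if the
potential of `σ` is bounded. -/
theorem correlation_add_le {μ σ : Measure E3} {Q : Measure (E3 × E3)}
    (hQ1 : Q.map Prod.fst ≤ μ) (hQ2 : Q.map Prod.snd ≤ μ)
    (hprob : μ Set.univ + σ Set.univ = 1) (hmass : 2 * μ Set.univ ≤ Q Set.univ + 1)
    {K : ℝ≥0∞} (hK : ∀ x, ∫⁻ y, (edist x y)⁻¹ ∂σ ≤ K) :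
    correlation (μ + σ) ≤ ∫⁻ p, (edist p.1 p.2)⁻¹ ∂Q + 3 * K := by
  have hμ1 : μ Set.univ ≤ 1 := hprob ▸ le_self_add
  have hσ1 : σ Set.univ ≤ 1 := hprob ▸ le_add_self
  have : IsFiniteMeasure μ := ⟨hμ1.trans_lt ENNReal.one_lt_top⟩
  have : IsFiniteMeasure σ := ⟨hσ1.trans_lt ENNReal.one_lt_top⟩
  have hm1 : (Q.map Prod.fst) Set.univ = Q Set.univ := by
    rw [Measure.map_apply measurable_fst MeasurableSet.univ]; rfl
  have hm2 : (Q.map Prod.snd) Set.univ = Q Set.univ := by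
    rw [Measure.map_apply measurable_snd MeasurableSet.univ]; rfl
  have hQμ : Q Set.univ ≤ μ Set.univ := hm1 ▸ hQ1 Set.univ
  have : IsFiniteMeasure Q := ⟨hQμ.trans_lt (measure_lt_top μ _)⟩
  set ν₁ := μ - Q.map Prod.fst
  set ν₂ := μ - Q.map Prod.snd
  have h1 : ν₁ + Q.map Prod.fst = μ := Measure.sub_add_cancel_of_le hQ1
  have h2 : ν₂ + Q.map Prod.snd = μ := Measure.sub_add_cancel_of_le hQ2
  have : IsFiniteMeasure ν₁ := isFiniteMeasure_of_le μ Measure.sub_le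
  have : IsFiniteMeasure ν₂ := isFiniteMeasure_of_le μ Measure.sub_le
  set s := σ Set.univ with hs
  set n := ν₁ Set.univ with hn
  have hn1 : n + Q Set.univ = μ Set.univ := by
    rw [← hm1, hn, ← Measure.add_apply, h1]
  have hn2 : ν₂ Set.univ = n := by
    have : ν₂ Set.univ + Q Set.univ = μ Set.univ := by
      rw [← hm2, ← Measure.add_apply, h2]
    exact (ENNReal.add_left_inj (measure_ne_top Q _)).1 (this.trans hn1.symm)
  have hns : n ≤ s := by
    -- With n the unpaired mass and s the mass of σ, the hypothesis on masses says exactly n ≤ s: σ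
    -- has enough charge to absorb what is unpaired.
    rw [← hprob, ← hn1] at hmass
    have e : Q Set.univ + Q Set.univ + n + n ≤ Q Set.univ + Q Set.univ + n + s := by
      calc _ = 2 * (n + Q Set.univ) := by ring
        _ ≤ _ := hmass
        _ = _ := by ring
    exact (ENNReal.add_le_add_iff_left (by finiteness)).1 e
  have hedist : Measurable fun p : E3 × E3 => (edist p.1 p.2)⁻¹ :=
    (measurable_fst.edist measurable_snd).inv
  -- For σ = 0 nothing is unpaired and Q is already a full plan; otherwise division by s is
  -- legitimate.
  rcases eq_or_ne s 0 with hs0 | hs0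
  · have hσ0 : σ = 0 := Measure.measure_univ_eq_zero.1 hs0
    have hν1 : ν₁ = 0 := Measure.measure_univ_eq_zero.1 (le_antisymm (hns.trans hs0.le) zero_le)
    have hν2 : ν₂ = 0 := Measure.measure_univ_eq_zero.1
      (hn2.trans (le_antisymm (hns.trans hs0.le) zero_le))
    rw [hν1, zero_add] at h1
    rw [hν2, zero_add] at h2
    rw [hσ0, add_zero]
    exact (iInf₂_le Q ⟨h1, h2⟩).trans le_self_add
  have hsT : s ≠ ⊤ := measure_ne_top σ _
  set c := (s - n) * s⁻¹ * s⁻¹ with hc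
  have hcs : s⁻¹ * n + c * s = 1 := by
    calc s⁻¹ * n + c * s = s⁻¹ * n + (s - n) * s⁻¹ * (s⁻¹ * s) := by rw [hc]; ring
      _ = s⁻¹ * (n + (s - n)) := by rw [ENNReal.inv_mul_cancel hs0 hsT]; ring
      _ = 1 := by rw [add_tsub_cancel_of_le hns, ENNReal.inv_mul_cancel hs0 hsT]
  -- Each unpaired remainder is coupled with σ by a normalized product, which uses the share n/s of
  -- σ in each marginal. The constant c lets σ ⊗ σ use up the remaining share (s - n)/s. Each added
  -- term costs at most K.
  let P : Measure (E3 × E3) :=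
    Q + s⁻¹ • (ν₁.prod σ) + s⁻¹ • (σ.prod ν₂) + c • (σ.prod σ)
  have hP1 : P.map Prod.fst = μ + σ := by
    simp only [P, Measure.map_add _ _ measurable_fst, Measure.map_smul, Measure.map_fst_prod]
    rw [← hs, hn2, smul_smul, smul_smul, smul_smul, ENNReal.inv_mul_cancel hs0 hsT, one_smul,
      add_assoc _ (_ • σ), ← add_smul, hcs, one_smul, add_comm (Q.map _), h1]
  have hP2 : P.map Prod.snd = μ + σ := by
    simp only [P, Measure.map_add _ _ measurable_snd, Measure.map_smul, Measure.map_snd_prod]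
    rw [← hs, ← hn, smul_smul, smul_smul, smul_smul, ENNReal.inv_mul_cancel hs0 hsT, one_smul,
      add_right_comm (Q.map _), add_comm (Q.map _), h2, add_assoc, ← add_smul, hcs, one_smul]
  refine (iInf₂_le P ⟨hP1, hP2⟩).trans ?_
  have c1 : ∀ τ : Measure E3, SFinite τ →
      ∫⁻ p, (edist p.1 p.2)⁻¹ ∂(τ.prod σ) ≤ K * τ Set.univ := by
    intro τ _
    rw [lintegral_prod _ hedist.aemeasurable]
    exact (lintegral_mono fun x => hK x).trans (by simp)
  have c2 : ∫⁻ p, (edist p.1 p.2)⁻¹ ∂(σ.prod ν₂) ≤ K * n := by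
    rw [lintegral_prod_symm _ hedist.aemeasurable]
    refine (lintegral_mono fun y => ?_).trans (b := ∫⁻ _, K ∂ν₂) (by simp [hn2])
    simpa [edist_comm] using hK y
  have e1 : s⁻¹ * (K * n) ≤ K := by
    calc s⁻¹ * (K * n) ≤ s⁻¹ * (K * s) := by gcongr
      _ = K * (s⁻¹ * s) := by ring
      _ = K := by rw [ENNReal.inv_mul_cancel hs0 hsT, mul_one]
  have e2 : c * (K * s) ≤ K := by
    calc c * (K * s) = K * (c * s) := by ring
      _ ≤ K * 1 := by gcongr; exact hcs ▸ le_add_self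
      _ = K := mul_one K
  simp only [P, lintegral_add_measure, lintegral_smul_measure, smul_eq_mul]
  calc _ ≤ ∫⁻ p, (edist p.1 p.2)⁻¹ ∂Q + s⁻¹ * (K * n) + s⁻¹ * (K * n) + c * (K * s) := by
        gcongr
        · exact c1 ν₁ inferInstance
        · exact c1 σ inferInstance
    _ ≤ ∫⁻ p, (edist p.1 p.2)⁻¹ ∂Q + K + K + K := by gcongr
    _ = _ := by ring

/-! ### Fragments around the nuclei -/

/-- A family of pieces of charge, one around each nucleus, together with a partial transport plan
that leaves at most as much charge unpaired as there is outside of the fragments. -/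
structure Fragments {M : ℕ} (X : Fin M → E3) (r : ℝ) where
  scale : ℝ
  scale_pos : 0 < scale
  u : Fin M → E3 → ℝ
  g : Fin M → E3 → E3
  u_nonneg : ∀ i x, 0 ≤ u i x
  weak : ∀ i, HasWeakGradient (u i) (g i)
  u_eq_zero : ∀ i, ∀ x ∉ Metric.ball (X i) r, u i x = 0
  g_eq_zero : ∀ i, ∀ x ∉ Metric.ball (X i) r, g i x = 0
  kinetic_lt_top : ∀ i, ∫⁻ x, ‖g i x‖ₑ ^ 2 < ⊤
  plan : Measure (E3 × E3)
  plan_fst : plan.map Prod.fst ≤ ∑ i, sqDensity (u i)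
  plan_snd : plan.map Prod.snd ≤ ∑ i, sqDensity (u i)
  mass : 2 * (∑ i, sqDensity (u i)) Set.univ ≤ plan Set.univ + 1

namespace Fragments

variable {M : ℕ} {X : Fin M → E3} {r : ℝ}

/-- The kinetic energy and the interaction energy of the fragments. -/
def repulsion (κ : Fragments X r) (b : ℝ) : ℝ≥0∞ :=
  ENNReal.ofReal (κ.scale ^ 2) * (∑ i, ∫⁻ x, ‖κ.g i x‖ₑ ^ 2)
    + ENNReal.ofReal (κ.scale * b) * ∫⁻ p, (edist p.1 p.2)⁻¹ ∂κ.plan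

/-- The absolute value of the energy of each fragment in the field of its own nucleus. -/
def attraction (κ : Fragments X r) (Z : Fin M → ℝ) : ℝ≥0∞ :=
  ENNReal.ofReal κ.scale *
    ∑ i, ENNReal.ofReal (Z i) * ∫⁻ x, ENNReal.ofReal (κ.u i x ^ 2) * (edist x (X i))⁻¹

/-- The total energy of the fragments. -/
def energy (κ : Fragments X r) (Z : Fin M → ℝ) (b : ℝ) : EReal :=
  (κ.repulsion b : EReal) - (κ.attraction Z : EReal)

/-- The fragments have at most the charge that `ρ` has in the nuclei. -/
def Fits (κ : Fragments X r) (ρ : SubProb) : Prop :=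
  ∀ i, sqDensity (κ.u i) Set.univ ≤ ρ.toMeasure {X i}

end Fragments

/-- The limit energy: the infimum of the energies of fragments below the atoms of `ρ`. -/
def limitEnergy {M : ℕ} (X : Fin M → E3) (r : ℝ) (Z : Fin M → ℝ) (b : ℝ) (ρ : SubProb) : EReal :=
  ⨅ (κ : Fragments X r) (_ : κ.Fits ρ), κ.energy Z b

/-- Allows estimates to be carried out in `ℝ≥0∞` with all negative terms moved across. Only the
subtracted quantities need be finite; if A is infinite, so is the right side. -/
theorem ereal_sub_le_sub_add {p a A B : ℝ≥0∞} (ha : a ≠ ⊤) (hB : B ≠ ⊤) (d : NNReal)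
    (h : p + B ≤ A + a + d) : (p : EReal) - a ≤ (A : EReal) - B + (d : ℝ) := by
  lift a to NNReal using ha
  lift B to NNReal using hB
  induction A with
  | top => simp [EReal.coe_nnreal_eq_coe_real]
  | coe A =>
    have hp : p ≠ ⊤ := ne_top_of_le_ne_top (by finiteness) (le_self_add.trans h)
    lift p to NNReal using hp
    have h' : (p : ℝ) + B ≤ A + a + d := by exact_mod_cast h
    simp only [EReal.coe_nnreal_eq_coe_real]
    norm_cast
    linarith

/-- The `sin` profile makes the square of a cutoff and the square of its gradient compatible. -/
theorem exists_cutoff (p : E3) {r : ℝ} (hr : 0 < r) :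
    ∃ η : E3 → ℝ, ContDiff ℝ ∞ η ∧ (∀ x, 0 ≤ η x) ∧ (∀ x, η x ≤ 1) ∧
      (∀ x ∈ Metric.closedBall p r, η x = 1) ∧
      (∀ x ∉ Metric.closedBall p (2 * r), η x = 0 ∧ gradient η x = 0) ∧
      ∃ B : ℝ, 0 ≤ B ∧ ∀ x (a : E3) (c : ℝ),
        ‖η x • a + c • gradient η x‖ ^ 2 ≤ ‖a‖ ^ 2 + B * c ^ 2 := by
  let χ : ContDiffBump p := ⟨r, 2 * r, hr, by linarith⟩
  have hχ : ContDiff ℝ ∞ (fun x => Real.pi / 2 * χ x) := contDiff_const.mul χ.contDiff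
  have hχc : HasCompactSupport (fun x => Real.pi / 2 * χ x) :=
    χ.hasCompactSupport.mono fun x hx => right_ne_zero_of_mul hx
  let f : E3 → ℝ := fun x => Real.pi / 2 * χ x
  have hη : ContDiff ℝ ∞ (fun x => Real.sin (f x)) := Real.contDiff_sin.comp hχ
  have hgr : ∀ x, gradient (fun x => Real.sin (f x)) x = Real.cos (f x) • gradient f x := by
    intro x
    apply ext_inner_right ℝ
    intro v
    rw [inner_smul_left, inner_gradient, inner_gradient,
      ((hχ.differentiable (by simp) x).hasFDerivAt.sin).fderiv]
    simp [f]
  obtain ⟨C, hC⟩ := (continuous_gradient hχ).bounded_above_of_compact_support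
    (hasCompactSupport_gradient hχc)
  have hpi := Real.pi_pos
  have h0 : ∀ x, 0 ≤ f x := fun x => mul_nonneg (by positivity) χ.nonneg
  have h1 : ∀ x, f x ≤ Real.pi / 2 := fun x =>
    mul_le_of_le_one_right (by positivity) χ.le_one
  have hzero : ∀ x ∉ Metric.closedBall p (2 * r), (fun x => Real.sin (f x)) x = 0 := by
    intro x hx
    have : χ x = 0 := χ.zero_of_le_dist (by simpa [χ] using (not_le.1 hx).le)
    simp [f, this]
  refine ⟨fun x => Real.sin (f x), hη,
    fun x => Real.sin_nonneg_of_nonneg_of_le_pi (h0 x) (by linarith [h1 x]),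
    fun x => Real.sin_le_one _, fun x hx => ?_, fun x hx => ⟨hzero x hx, ?_⟩,
    C ^ 2, sq_nonneg C, fun x a c => ?_⟩
  · have : χ x = 1 := χ.one_of_mem_closedBall hx
    simp [f, this]
  · have hev : (fun x => Real.sin (f x)) =ᶠ[𝓝 x] fun _ => (0 : ℝ) :=
      Filter.eventually_of_mem (Metric.isClosed_closedBall.isOpen_compl.mem_nhds hx) hzero
    rw [gradient, hev.fderiv_eq]
    simp
  · dsimp only
    rw [hgr x, smul_smul, mul_comm c, ← smul_smul]
    set q := c • gradient f x with hq
    have hqn : ‖q‖ ^ 2 ≤ C ^ 2 * c ^ 2 := by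
      rw [hq, norm_smul, mul_pow, mul_comm, Real.norm_eq_abs, sq_abs]
      gcongr
      exact hC x
    have htri : ‖Real.sin (f x) • a + Real.cos (f x) • q‖
        ≤ |Real.sin (f x)| * ‖a‖ + |Real.cos (f x)| * ‖q‖ := by
      refine (norm_add_le _ _).trans (by rw [norm_smul, norm_smul]; rfl)
    have hsc : |Real.sin (f x)| ^ 2 + |Real.cos (f x)| ^ 2 = 1 := by
      rw [sq_abs, sq_abs]; exact Real.sin_sq_add_cos_sq _
    -- Cauchy–Schwarz with the unit vector (sin, cos), through Lagrange's identity. It keeps the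
    -- coefficient of ‖a‖² equal to 1, so that cutting off does not multiply the kinetic energy.
    have hcs : (|Real.sin (f x)| * ‖a‖ + |Real.cos (f x)| * ‖q‖) ^ 2 ≤ ‖a‖ ^ 2 + ‖q‖ ^ 2 := by
      have e : (|Real.sin (f x)| * ‖a‖ + |Real.cos (f x)| * ‖q‖) ^ 2
          = (|Real.sin (f x)| ^ 2 + |Real.cos (f x)| ^ 2) * (‖a‖ ^ 2 + ‖q‖ ^ 2)
            - (|Real.sin (f x)| * ‖q‖ - |Real.cos (f x)| * ‖a‖) ^ 2 := by ring
      rw [e, hsc]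
      nlinarith [sq_nonneg (|Real.sin (f x)| * ‖q‖ - |Real.cos (f x)| * ‖a‖)]
    calc _ ≤ (|Real.sin (f x)| * ‖a‖ + |Real.cos (f x)| * ‖q‖) ^ 2 := by gcongr
      _ ≤ _ := hcs
      _ ≤ _ := by linarith

/-- The Coulomb energy in the field of a unit charge, at the natural scale `ε`. -/
theorem HasWeakGradient.coulomb_le {u : E3 → ℝ} {g : E3 → E3} (h : HasWeakGradient u g)
    (hc : HasCompactSupport u) (p : E3) {ε z : ℝ} (hε : 0 < ε) (hz : 0 < z) :
    ENNReal.ofReal ε * (ENNReal.ofReal z * ∫⁻ x, ENNReal.ofReal (u x ^ 2) * (edist x p)⁻¹)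
      ≤ ENNReal.ofReal (ε ^ 2) * (∫⁻ x, ‖g x‖ₑ ^ 2)
        + ENNReal.ofReal (z ^ 2) * ∫⁻ x, ENNReal.ofReal (u x ^ 2) := by
  -- This weight turns the gradient coefficient into exactly ε², the one of the kinetic energy, and
  -- the mass coefficient into z².
  have := h.hardy hc p (a := ε / z) (by positivity)
  calc _ ≤ ENNReal.ofReal ε * (ENNReal.ofReal z * (ENNReal.ofReal (ε / z) * (∫⁻ x, ‖g x‖ₑ ^ 2)
        + ENNReal.ofReal (ε / z)⁻¹ * ∫⁻ x, ENNReal.ofReal (u x ^ 2))) := by gcongr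
    _ = _ := by
      rw [mul_add, mul_add, ← mul_assoc, ← mul_assoc, ← mul_assoc, ← mul_assoc,
        ← ENNReal.ofReal_mul hε.le, ← ENNReal.ofReal_mul (by positivity),
        ← ENNReal.ofReal_mul (by positivity)]
      have e1 : ε * z * (ε / z) = ε ^ 2 := by field_simp
      have e2 : ε * z * (ε / z)⁻¹ = z ^ 2 := by field_simp
      rw [e1, e2]

theorem hasCompactSupport_of_ball {u : E3 → ℝ} {p : E3} {r : ℝ}
    (h : ∀ x ∉ Metric.ball p r, u x = 0) : HasCompactSupport u :=
  HasCompactSupport.of_support_subset_isCompact (isCompact_closedBall p r) fun x hx => by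
    by_contra hx'
    exact hx (h x fun h' => hx' (Metric.ball_subset_closedBall h'))

namespace Fragments

variable {M : ℕ} {X : Fin M → E3} {r : ℝ} {Z : Fin M → ℝ}

/-- The kinetic part alone controls the attraction, fragment by fragment, because each mass is at
most 1. This bounds fragment energies below, uniformly in the scale. -/
theorem attraction_le (κ : Fragments X r) (hZ : ∀ k, 0 < Z k) (b : ℝ) {ρ : SubProb}
    (h : κ.Fits ρ) :
    κ.attraction Z ≤ κ.repulsion b + ∑ i, ENNReal.ofReal (Z i ^ 2) := by
  have hm : ∀ i, ∫⁻ x, ENNReal.ofReal (κ.u i x ^ 2) ≤ 1 := fun i => by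
    rw [← sqDensity_univ]
    exact (h i).trans ((measure_mono (Set.subset_univ _)).trans ρ.mass_le_one)
  unfold attraction repulsion
  rw [Finset.mul_sum, Finset.mul_sum, add_right_comm, ← Finset.sum_add_distrib]
  refine le_add_right (Finset.sum_le_sum fun i _ => ?_)
  refine ((κ.weak i).coulomb_le (hasCompactSupport_of_ball (κ.u_eq_zero i)) (X i) κ.scale_pos
    (hZ i)).trans ?_
  gcongr
  exact mul_le_of_le_one_right zero_le (hm i)

theorem attraction_ne_top (κ : Fragments X r) (Z : Fin M → ℝ) {ρ : SubProb}
    (h : κ.Fits ρ) : κ.attraction Z ≠ ⊤ := by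
  unfold attraction
  refine ENNReal.mul_ne_top ENNReal.ofReal_ne_top (ENNReal.sum_ne_top.2 fun i _ =>
    ENNReal.mul_ne_top ENNReal.ofReal_ne_top (ne_top_of_le_ne_top ?_
      ((κ.weak i).hardy (hasCompactSupport_of_ball (κ.u_eq_zero i)) (X i) one_pos)))
  have := (κ.kinetic_lt_top i).ne
  have hm : ∫⁻ x, ENNReal.ofReal (κ.u i x ^ 2) ≤ 1 := by
    rw [← sqDensity_univ]
    exact (h i).trans ((measure_mono (Set.subset_univ _)).trans ρ.mass_le_one)
  exact ENNReal.add_ne_top.2 ⟨ENNReal.mul_ne_top ENNReal.ofReal_ne_top this,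
    ENNReal.mul_ne_top ENNReal.ofReal_ne_top (ne_top_of_le_ne_top ENNReal.one_ne_top hm)⟩

end Fragments

/-! ### Cutting a density into fragments -/

/-- A family of cutoffs near the nuclei at the scale `r`. -/
structure IsCutoffFamily {M : ℕ} (X : Fin M → E3) (r B : ℝ) (η : Fin M → E3 → ℝ) : Prop where
  contDiff : ∀ i, ContDiff ℝ ∞ (η i)
  nonneg : ∀ i x, 0 ≤ η i x
  le_one : ∀ i x, η i x ≤ 1
  eq_one : ∀ i, ∀ x ∈ Metric.closedBall (X i) r, η i x = 1
  eq_zero : ∀ i, ∀ x ∉ Metric.closedBall (X i) (2 * r), η i x = 0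
  gradient_eq_zero : ∀ i, ∀ x ∉ Metric.closedBall (X i) (2 * r), gradient (η i) x = 0
  bound_nonneg : 0 ≤ B
  bound : ∀ i x (a : E3) (c : ℝ),
    ‖η i x • a + c • gradient (η i) x‖ ^ 2 ≤ ‖a‖ ^ 2 + B * c ^ 2

theorem exists_isCutoffFamily {M : ℕ} (X : Fin M → E3) {r : ℝ} (hr : 0 < r) :
    ∃ B η, IsCutoffFamily X r B η := by
  choose η h1 h2 h3 h4 h5 B h6 h7 using fun i => exists_cutoff (X i) hr
  refine ⟨∑ i, B i, η, ⟨h1, h2, h3, h4, fun i x hx => (h5 i x hx).1, fun i x hx => (h5 i x hx).2,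
    Finset.sum_nonneg fun i _ => h6 i, fun i x a c => (h7 i x a c).trans ?_⟩⟩
  gcongr
  exact Finset.single_le_sum (fun i _ => h6 i) (Finset.mem_univ i)

namespace IsCutoffFamily

variable {M : ℕ} {X : Fin M → E3} {r r₀ B : ℝ} {η : Fin M → E3 → ℝ}

theorem hasCompactSupport (h : IsCutoffFamily X r B η) (i : Fin M) : HasCompactSupport (η i) :=
  HasCompactSupport.of_support_subset_isCompact (isCompact_closedBall (X i) (2 * r)) fun x hx => by
    by_contra hx'
    exact hx (h.eq_zero i x hx')

theorem measurable (h : IsCutoffFamily X r B η) (i : Fin M) : Measurable (η i) :=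
  (h.contDiff i).continuous.measurable

theorem subsingleton (hr : 2 * r < r₀) (hX : ∀ i j, i ≠ j → 4 * r₀ ≤ dist (X i) (X j))
    (hr₀ : 0 < r₀) (x : E3) :
    (∃ k, ∀ l, l ≠ k → x ∉ Metric.closedBall (X l) (2 * r)) ∨
      ∀ l, x ∉ Metric.closedBall (X l) (2 * r) := by
  by_cases hx : ∃ k, x ∈ Metric.closedBall (X k) (2 * r)
  · obtain ⟨k, hk⟩ := hx
    refine Or.inl ⟨k, fun l hl hxl => ?_⟩
    have h1 := hX l k hl
    have h2 := dist_triangle_left (X l) (X k) x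
    have h3 := Metric.mem_closedBall.1 hk
    have h4 := Metric.mem_closedBall.1 hxl
    linarith
  · exact Or.inr (not_exists.1 hx)

theorem sum_sq_le_one (h : IsCutoffFamily X r B η) (hr : 2 * r < r₀)
    (hX : ∀ i j, i ≠ j → 4 * r₀ ≤ dist (X i) (X j)) (hr₀ : 0 < r₀) {t : Fin M → ℝ}
    (ht1 : ∀ i, t i ≤ 1) (x : E3) : ∑ i, t i * η i x ^ 2 ≤ 1 := by
  rcases subsingleton hr hX hr₀ x with ⟨k, hk⟩ | hk
  · rw [Finset.sum_eq_single k (fun l _ hl => by simp [h.eq_zero l x (hk l hl)]) (by simp)]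
    have h1 : η k x ^ 2 ≤ 1 := pow_le_one₀ (h.nonneg k x) (h.le_one k x)
    nlinarith [ht1 k, sq_nonneg (η k x)]
  · simp [fun l => h.eq_zero l x (hk l)]

/-- At most one cutoff is active at each point, so the localization error is paid once and ‖a‖²
keeps the coefficient 1. -/
theorem sum_gradient_le (h : IsCutoffFamily X r B η) (hr : 2 * r < r₀)
    (hX : ∀ i j, i ≠ j → 4 * r₀ ≤ dist (X i) (X j)) (hr₀ : 0 < r₀) (x a : E3) (c : ℝ) :
    ∑ i, ‖η i x • a + c • gradient (η i) x‖ₑ ^ 2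
      ≤ ‖a‖ₑ ^ 2 + ENNReal.ofReal B * ENNReal.ofReal (c ^ 2) := by
  have hz : ∀ l, x ∉ Metric.closedBall (X l) (2 * r) →
      ‖η l x • a + c • gradient (η l) x‖ₑ ^ 2 = 0 := fun l hl => by
    simp [h.eq_zero l x hl, h.gradient_eq_zero l x hl]
  rcases subsingleton hr hX hr₀ x with ⟨k, hk⟩ | hk
  · rw [Finset.sum_eq_single k (fun l _ hl => hz l (hk l hl)) (by simp),
      enorm_sq_eq_ofReal_norm_sq, enorm_sq_eq_ofReal_norm_sq, ← ENNReal.ofReal_mul h.bound_nonneg,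
      ← ENNReal.ofReal_add (by positivity) (mul_nonneg h.bound_nonneg (sq_nonneg c))]
    exact ENNReal.ofReal_le_ofReal (h.bound k x a c)
  · rw [Finset.sum_eq_zero fun l _ => hz l (hk l)]
    exact zero_le

/-- Within distance r of the nucleus the cutoff is 1, and beyond it the potential is at most 1/r. -/
theorem coulomb_le (h : IsCutoffFamily X r B η) (hr : 0 < r) (i : Fin M) (x : E3) (c : ℝ) :
    ENNReal.ofReal (c ^ 2) * (edist x (X i))⁻¹
      ≤ ENNReal.ofReal ((η i x * c) ^ 2) * (edist x (X i))⁻¹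
        + ENNReal.ofReal r⁻¹ * ENNReal.ofReal (c ^ 2) := by
  by_cases hx : x ∈ Metric.closedBall (X i) r
  · rw [h.eq_one i x hx, one_mul]
    exact le_self_add
  · refine le_add_left ?_
    rw [mul_comm, ENNReal.ofReal_inv_of_pos hr]
    gcongr
    rw [edist_dist]
    exact ENNReal.ofReal_le_ofReal (not_le.1 hx).le

end IsCutoffFamily

/-- Weighting a transport plan by `w ⊗ w` with a function `0 ≤ w ≤ 1`. -/
theorem weighted_plan {ρ : Measure E3} [IsProbabilityMeasure ρ] {P : Measure (E3 × E3)}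
    (hP1 : P.map Prod.fst = ρ) (hP2 : P.map Prod.snd = ρ) {w : E3 → ℝ} (hw : Measurable w)
    (hw0 : ∀ x, 0 ≤ w x) (hw1 : ∀ x, w x ≤ 1) :
    ∃ Q : Measure (E3 × E3), Q ≤ P ∧
      Q.map Prod.fst ≤ ρ.withDensity (fun x => ENNReal.ofReal (w x)) ∧
      Q.map Prod.snd ≤ ρ.withDensity (fun x => ENNReal.ofReal (w x)) ∧
      2 * ∫⁻ x, ENNReal.ofReal (w x) ∂ρ ≤ Q Set.univ + 1 := by
  have hm : Measurable fun x => ENNReal.ofReal (w x) := hw.ennreal_ofReal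
  have hle : ∀ x, ENNReal.ofReal (w x) ≤ 1 := fun x => ENNReal.ofReal_le_one.2 (hw1 x)
  have hm1 : Measurable fun p : E3 × E3 => ENNReal.ofReal (w p.1) := hm.comp measurable_fst
  have hm2 : Measurable fun p : E3 × E3 => ENNReal.ofReal (w p.2) := hm.comp measurable_snd
  have hPu : P Set.univ = 1 := by
    have h1 := Measure.map_apply (μ := P) (measurable_fst : Measurable (Prod.fst : E3 × E3 → E3))
      MeasurableSet.univ
    rw [hP1, measure_univ] at h1
    exact h1.symm
  refine ⟨P.withDensity fun p => ENNReal.ofReal (w p.1) * ENNReal.ofReal (w p.2), ?_, ?_, ?_, ?_⟩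
  · calc _ ≤ P.withDensity 1 := withDensity_mono (Eventually.of_forall fun p =>
          mul_le_one' (hle p.1) (hle p.2))
      _ = P := withDensity_one
  · refine Measure.le_iff.2 fun s hs => ?_
    rw [Measure.map_apply measurable_fst hs, withDensity_apply _ (measurable_fst hs),
      withDensity_apply _ hs, ← hP1, setLIntegral_map hs hm measurable_fst]
    exact lintegral_mono fun p => mul_le_of_le_one_right zero_le (hle p.2)
  · refine Measure.le_iff.2 fun s hs => ?_
    rw [Measure.map_apply measurable_snd hs, withDensity_apply _ (measurable_snd hs),
      withDensity_apply _ hs, ← hP2, setLIntegral_map hs hm measurable_snd]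
    exact lintegral_mono fun p => mul_le_of_le_one_left zero_le (hle p.1)
  · have e1 : ∫⁻ x, ENNReal.ofReal (w x) ∂ρ = ∫⁻ p, ENNReal.ofReal (w p.1) ∂P := by
      rw [← hP1, lintegral_map hm measurable_fst]
    have e2 : ∫⁻ x, ENNReal.ofReal (w x) ∂ρ = ∫⁻ p, ENNReal.ofReal (w p.2) ∂P := by
      rw [← hP2, lintegral_map hm measurable_snd]
    rw [two_mul]
    nth_rewrite 1 [e1]
    rw [e2, ← lintegral_add_left hm1, withDensity_apply _ MeasurableSet.univ,
      Measure.restrict_univ]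
    calc _ ≤ ∫⁻ p, (ENNReal.ofReal (w p.1) * ENNReal.ofReal (w p.2) + 1) ∂P := by
          refine lintegral_mono fun p => ?_
          have h1 := hw0 p.1
          have h2 := hw0 p.2
          rw [← ENNReal.ofReal_mul h1, ← ENNReal.ofReal_add h1 h2, ← ENNReal.ofReal_one,
            ← ENNReal.ofReal_add (by positivity) zero_le_one]
          -- This is (1 - w(x))(1 - w(y)) ≥ 0. Integrated against P, it says that the charge left
          -- unpaired is at most the charge outside.
          exact ENNReal.ofReal_le_ofReal (by nlinarith [hw1 p.1, hw1 p.2])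
      _ = _ := by rw [lintegral_add_right _ measurable_const]; simp [hPu]

/-- The fragments are √(t i) η_i √ρ', at scale ε. The three groups of error terms come from the
gradients of the cutoffs, from the attraction beyond distance r of each nucleus, and from thinning
by t i. The estimate is written without subtraction. -/
theorem exists_fragments_le {M : ℕ} {X : Fin M → E3} {r r₀ B : ℝ} {η : Fin M → E3 → ℝ}
    (h : IsCutoffFamily X r B η) (hr : 0 < r) (hrr : 2 * r < r₀)
    (hX : ∀ i j, i ≠ j → 4 * r₀ ≤ dist (X i) (X j)) {Z : Fin M → ℝ} (hZ : ∀ k, 0 < Z k) (b : ℝ)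
    {ρ : SubProb} {ρ' : Measure E3} [IsProbabilityMeasure ρ'] {u : E3 → ℝ} {g : E3 → E3}
    (hu : IsSqrtDensityGradient ρ' u g) (hkin : ∫⁻ x, ‖g x‖ₑ ^ 2 < ⊤) {P : Measure (E3 × E3)}
    (hP1 : P.map Prod.fst = ρ') (hP2 : P.map Prod.snd = ρ') {ε : ℝ} (hε : 0 < ε) {t : Fin M → ℝ}
    (ht0 : ∀ i, 0 ≤ t i) (ht1 : ∀ i, t i ≤ 1)
    (hfit : ∀ i, ENNReal.ofReal (t i) * ∫⁻ x, ENNReal.ofReal (η i x ^ 2) ∂ρ'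
      ≤ ρ.toMeasure {X i}) :
    ∃ κ : Fragments X r₀, κ.Fits ρ ∧
      κ.repulsion b + ENNReal.ofReal ε * potential X Z ρ' ≤
        ENNReal.ofReal (ε ^ 2) * (∫⁻ x, ‖g x‖ₑ ^ 2)
          + ENNReal.ofReal (ε * b) * ∫⁻ p, (edist p.1 p.2)⁻¹ ∂P + κ.attraction Z
          + (ENNReal.ofReal (ε ^ 2) * ENNReal.ofReal B
            + ENNReal.ofReal ε * ∑ i, ENNReal.ofReal (Z i) * ENNReal.ofReal r⁻¹
            + ∑ i, ENNReal.ofReal (1 - t i) *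
              (ENNReal.ofReal (Z i ^ 2) * ∫⁻ x, ENNReal.ofReal (η i x ^ 2) ∂ρ')) := by
  obtain ⟨hu0, hρ, hw⟩ := hu
  have hρ' : ρ' = sqDensity u := hρ
  have hr₀ : 0 < r₀ := by linarith
  have hmass : ∫⁻ x, ENNReal.ofReal (u x ^ 2) = 1 := by
    rw [← sqDensity_univ, ← hρ', measure_univ]
  let v : Fin M → E3 → ℝ := fun i x => η i x * u x
  let γ : Fin M → E3 → E3 := fun i x => η i x • g x + u x • gradient (η i) x
  have hv : ∀ i, HasWeakGradient (v i) (γ i) := fun i => hw.mul_smooth (h.contDiff i)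
  have hsub : ∀ i, ∀ x ∉ Metric.ball (X i) r₀, x ∉ Metric.closedBall (X i) (2 * r) :=
    fun i x hx hx' => hx (Metric.closedBall_subset_ball hrr hx')
  have hvsq : ∀ i x, ENNReal.ofReal (v i x ^ 2)
      = ENNReal.ofReal (u x ^ 2) * ENNReal.ofReal (η i x ^ 2) := fun i x => by
    rw [← ENNReal.ofReal_mul (sq_nonneg _), mul_comm, ← mul_pow]
  have hηm : ∀ i, Measurable fun x => ENNReal.ofReal (η i x ^ 2) := fun i =>
    ((h.measurable i).pow_const 2).ennreal_ofReal
  have hvmass : ∀ i, ∫⁻ x, ENNReal.ofReal (v i x ^ 2) = ∫⁻ x, ENNReal.ofReal (η i x ^ 2) ∂ρ' :=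
    fun i => by rw [hρ', hw.lintegral_sqDensity (hηm i)]; simp_rw [hvsq]
  have htsq : ∀ i x, ENNReal.ofReal ((√(t i) * v i x) ^ 2)
      = ENNReal.ofReal (t i) * ENNReal.ofReal (v i x ^ 2) := fun i x => by
    rw [mul_pow, Real.sq_sqrt (ht0 i), ENNReal.ofReal_mul (ht0 i)]
  have htγ : ∀ i x, ‖√(t i) • γ i x‖ₑ ^ 2 = ENNReal.ofReal (t i) * ‖γ i x‖ₑ ^ 2 := fun i x => by
    rw [enorm_smul, mul_pow, enorm_sq_eq_ofReal, Real.sq_sqrt (ht0 i)]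
  -- The density of the fragments relative to ρ', which also weights the plan in both variables;
  -- hence the marginals of the cut plan lie below the fragments.
  let w : E3 → ℝ := fun x => ∑ i, t i * η i x ^ 2
  have hwm : Measurable w := Finset.measurable_sum _ fun i _ =>
    ((h.measurable i).pow_const 2).const_mul _
  have hμ : ∑ i, sqDensity (fun x => √(t i) * v i x)
      = ρ'.withDensity fun x => ENNReal.ofReal (w x) := by
    ext s hs
    rw [hρ', sqDensity, ← withDensity_mul₀ hw.aemeasurable_sq hwm.ennreal_ofReal.aemeasurable,
      withDensity_apply _ hs, Measure.finsetSum_apply]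
    simp_rw [sqDensity, withDensity_apply _ hs]
    rw [← lintegral_finsetSum' _ fun i _ => ((hv i).const_mul _).aemeasurable_sq.restrict]
    refine lintegral_congr fun x => ?_
    simp only [Pi.mul_apply, w, htsq, hvsq]
    rw [ENNReal.ofReal_sum_of_nonneg fun i _ => mul_nonneg (ht0 i) (sq_nonneg _), Finset.mul_sum]
    refine Finset.sum_congr rfl fun i _ => ?_
    rw [ENNReal.ofReal_mul (ht0 i)]
    ring
  have hγsum : ∑ i, ∫⁻ x, ‖γ i x‖ₑ ^ 2 ≤ (∫⁻ x, ‖g x‖ₑ ^ 2) + ENNReal.ofReal B := by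
    rw [← lintegral_finsetSum' _ fun i _ => (hv i).2.1.aestronglyMeasurable.enorm.pow_const 2]
    refine (lintegral_mono fun x => h.sum_gradient_le hrr hX hr₀ x (g x) (u x)).trans ?_
    rw [lintegral_add_left' (hw.2.1.aestronglyMeasurable.enorm.pow_const 2),
      lintegral_const_mul'' _ hw.aemeasurable_sq, hmass, mul_one]
  obtain ⟨Q, hQP, hQ1, hQ2, hQm⟩ := weighted_plan hP1 hP2 hwm
    (fun x => Finset.sum_nonneg fun i _ => mul_nonneg (ht0 i) (sq_nonneg _))
    (h.sum_sq_le_one hrr hX hr₀ ht1)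
  let κ : Fragments X r₀ :=
    { scale := ε
      scale_pos := hε
      u := fun i x => √(t i) * v i x
      g := fun i x => √(t i) • γ i x
      u_nonneg := fun i x => mul_nonneg (Real.sqrt_nonneg _) (mul_nonneg (h.nonneg i x) (hu0 x))
      weak := fun i => (hv i).const_mul _
      u_eq_zero := fun i x hx => by simp [v, h.eq_zero i x (hsub i x hx)]
      g_eq_zero := fun i x hx => by
        simp [γ, h.eq_zero i x (hsub i x hx), h.gradient_eq_zero i x (hsub i x hx)]
      kinetic_lt_top := fun i => by
        simp_rw [htγ]
        rw [lintegral_const_mul' _ _ ENNReal.ofReal_ne_top]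
        refine ENNReal.mul_lt_top ENNReal.ofReal_lt_top (lt_of_le_of_lt
          ((Finset.single_le_sum (f := fun i => ∫⁻ x, ‖γ i x‖ₑ ^ 2) (fun _ _ => zero_le)
            (Finset.mem_univ i)).trans hγsum) ?_)
        exact ENNReal.add_lt_top.2 ⟨hkin, ENNReal.ofReal_lt_top⟩
      plan := Q
      plan_fst := hμ ▸ hQ1
      plan_snd := hμ ▸ hQ2
      mass := by
        rw [hμ, withDensity_apply _ MeasurableSet.univ, Measure.restrict_univ]
        exact hQm }
  refine ⟨κ, fun i => ?_, ?_⟩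
  · rw [sqDensity_univ]
    simp only [κ, htsq]
    rw [lintegral_const_mul' _ _ ENNReal.ofReal_ne_top, hvmass]
    exact hfit i
  let a : Fin M → ℝ≥0∞ := fun i => ENNReal.ofReal (ε ^ 2) * ∫⁻ x, ‖γ i x‖ₑ ^ 2
  let β : Fin M → ℝ≥0∞ := fun i => ENNReal.ofReal ε * (ENNReal.ofReal (Z i) *
    ∫⁻ x, ENNReal.ofReal (v i x ^ 2) * (edist x (X i))⁻¹)
  let m : Fin M → ℝ≥0∞ := fun i => ∫⁻ x, ENNReal.ofReal (η i x ^ 2) ∂ρ'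
  have hβ : ∀ i, β i ≤ a i + ENNReal.ofReal (Z i ^ 2) * m i := fun i => by
    have := (hv i).coulomb_le (hasCompactSupport_of_ball (p := X i) (r := r₀) fun x hx => by
      simp [v, h.eq_zero i x (hsub i x hx)]) (X i) hε (hZ i)
    rwa [hvmass i] at this
  have hrep : κ.repulsion b ≤ ∑ i, ENNReal.ofReal (t i) * a i
      + ENNReal.ofReal (ε * b) * ∫⁻ p, (edist p.1 p.2)⁻¹ ∂P := by
    unfold Fragments.repulsion
    simp only [κ, htγ]
    gcongr
    · rw [Finset.mul_sum]
      refine Finset.sum_le_sum fun i _ => ?_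
      rw [lintegral_const_mul' _ _ ENNReal.ofReal_ne_top, mul_left_comm]
  have hatt : κ.attraction Z = ∑ i, ENNReal.ofReal (t i) * β i := by
    unfold Fragments.attraction
    simp only [κ, htsq, mul_assoc]
    rw [Finset.mul_sum]
    refine Finset.sum_congr rfl fun i _ => ?_
    rw [lintegral_const_mul' _ _ ENNReal.ofReal_ne_top]
    simp only [β]
    ring
  have hpot : ENNReal.ofReal ε * potential X Z ρ' ≤ ∑ i, β i
      + ENNReal.ofReal ε * ∑ i, ENNReal.ofReal (Z i) * ENNReal.ofReal r⁻¹ := by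
    unfold potential
    rw [Finset.mul_sum, Finset.mul_sum, ← Finset.sum_add_distrib]
    refine Finset.sum_le_sum fun i _ => ?_
    simp only [β]
    rw [← mul_add, ← mul_add]
    gcongr
    have hed : Measurable fun x : E3 => (edist x (X i))⁻¹ := by fun_prop
    rw [hρ', hw.lintegral_sqDensity hed]
    refine (lintegral_mono fun x => h.coulomb_le hr i x (u x)).trans ?_
    have hm : AEMeasurable fun x => ENNReal.ofReal ((η i x * u x) ^ 2) * (edist x (X i))⁻¹ :=
      (hv i).aemeasurable_sq.mul hed.aemeasurable
    rw [lintegral_add_left' hm,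
      lintegral_const_mul' _ _ ENNReal.ofReal_ne_top, hmass, mul_one]
  have hasum : ∑ i, a i ≤ ENNReal.ofReal (ε ^ 2) * (∫⁻ x, ‖g x‖ₑ ^ 2)
      + ENNReal.ofReal (ε ^ 2) * ENNReal.ofReal B := by
    simp only [a]
    rw [← Finset.mul_sum, ← mul_add]
    gcongr
  -- Thinning replaces a - β by t(a - β). Since a - β ≥ -Z²m by `hβ`, the energy rises by at most (1
  -- - t)Z²m.
  have hmix : ∑ i, ENNReal.ofReal (t i) * a i + ∑ i, β i ≤ ∑ i, a i
      + ∑ i, ENNReal.ofReal (t i) * β i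
      + ∑ i, ENNReal.ofReal (1 - t i) * (ENNReal.ofReal (Z i ^ 2) * m i) := by
    rw [← Finset.sum_add_distrib, ← Finset.sum_add_distrib, ← Finset.sum_add_distrib]
    refine Finset.sum_le_sum fun i _ => ?_
    have ht : ENNReal.ofReal (t i) + ENNReal.ofReal (1 - t i) = 1 := by
      rw [← ENNReal.ofReal_add (ht0 i) (by linarith [ht1 i])]
      simp
    calc ENNReal.ofReal (t i) * a i + β i
        = ENNReal.ofReal (t i) * a i + (ENNReal.ofReal (t i) + ENNReal.ofReal (1 - t i)) * β i := by
          rw [ht, one_mul]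
      _ = ENNReal.ofReal (t i) * a i + ENNReal.ofReal (t i) * β i
          + ENNReal.ofReal (1 - t i) * β i := by ring
      _ ≤ ENNReal.ofReal (t i) * a i + ENNReal.ofReal (t i) * β i
          + ENNReal.ofReal (1 - t i) * (a i + ENNReal.ofReal (Z i ^ 2) * m i) := by
          gcongr
          exact hβ i
      _ = (ENNReal.ofReal (t i) + ENNReal.ofReal (1 - t i)) * a i + ENNReal.ofReal (t i) * β i
          + ENNReal.ofReal (1 - t i) * (ENNReal.ofReal (Z i ^ 2) * m i) := by ring
      _ = _ := by rw [ht, one_mul]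
  rw [hatt]
  set C := ENNReal.ofReal (ε * b) * ∫⁻ p, (edist p.1 p.2)⁻¹ ∂P
  set D := ENNReal.ofReal ε * ∑ i, ENNReal.ofReal (Z i) * ENNReal.ofReal r⁻¹
  calc _ ≤ (∑ i, ENNReal.ofReal (t i) * a i + C) + (∑ i, β i + D) := add_le_add hrep hpot
    _ = (∑ i, ENNReal.ofReal (t i) * a i + ∑ i, β i) + (C + D) := by ring
    _ ≤ (ENNReal.ofReal (ε ^ 2) * (∫⁻ x, ‖g x‖ₑ ^ 2) + ENNReal.ofReal (ε ^ 2) * ENNReal.ofReal B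
      + ∑ i, ENNReal.ofReal (t i) * β i
      + ∑ i, ENNReal.ofReal (1 - t i) * (ENNReal.ofReal (Z i ^ 2) * m i)) + (C + D) := by
        refine add_le_add (hmix.trans ?_) le_rfl
        gcongr
    _ = _ := by ring

/-! ### The lower bound -/

/-- Cutting off at radius one provides the compact support needed by `HasWeakGradient.hardy`; away
from the nucleus the potential is bounded. -/
theorem potential_ne_top {M : ℕ} (X : Fin M → E3) (Z : Fin M → ℝ) {ρ : Measure E3}
    [IsProbabilityMeasure ρ] (hkin : kinetic ρ < ⊤) : potential X Z ρ ≠ ⊤ := by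
  simp only [kinetic, iInf_lt_iff] at hkin
  obtain ⟨u, g, ⟨_, hρ, hw⟩, hg⟩ := hkin
  have hρ' : ρ = sqDensity u := hρ
  have hmass : ∫⁻ x, ENNReal.ofReal (u x ^ 2) = 1 := by
    rw [← sqDensity_univ, ← hρ', measure_univ]
  obtain ⟨B, η, h⟩ := exists_isCutoffFamily X one_pos
  refine ENNReal.sum_ne_top.2 fun i _ => ENNReal.mul_ne_top ENNReal.ofReal_ne_top ?_
  have hed : Measurable fun x : E3 => (edist x (X i))⁻¹ := by fun_prop
  have hv := hw.mul_smooth (h.contDiff i)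
  have hm : AEMeasurable fun x => ENNReal.ofReal ((η i x * u x) ^ 2) * (edist x (X i))⁻¹ :=
    hv.aemeasurable_sq.mul hed.aemeasurable
  rw [hρ', hw.lintegral_sqDensity hed]
  refine ne_top_of_le_ne_top ?_ (lintegral_mono fun x => h.coulomb_le one_pos i x (u x))
  rw [lintegral_add_left' hm, lintegral_const_mul' _ _ ENNReal.ofReal_ne_top, hmass]
  have hc : HasCompactSupport fun x => η i x * u x :=
    (h.hasCompactSupport i).mono fun x hx => left_ne_zero_of_mul hx
  have hγ : ∫⁻ x, ‖η i x • g x + u x • gradient (η i) x‖ₑ ^ 2 ≠ ⊤ := by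
    have hle : ∀ x, ‖η i x • g x + u x • gradient (η i) x‖ₑ ^ 2
        ≤ ‖g x‖ₑ ^ 2 + ENNReal.ofReal B * ENNReal.ofReal (u x ^ 2) := fun x => by
      rw [enorm_sq_eq_ofReal_norm_sq, enorm_sq_eq_ofReal_norm_sq,
        ← ENNReal.ofReal_mul h.bound_nonneg,
        ← ENNReal.ofReal_add (by positivity) (mul_nonneg h.bound_nonneg (sq_nonneg _))]
      exact ENNReal.ofReal_le_ofReal (h.bound i x (g x) (u x))
    refine ne_top_of_le_ne_top ?_ (lintegral_mono hle)
    rw [lintegral_add_left' (hw.2.1.aestronglyMeasurable.enorm.pow_const 2),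
      lintegral_const_mul'' _ hw.aemeasurable_sq, hmass]
    exact ENNReal.add_ne_top.2 ⟨hg.ne, by finiteness⟩
  have hvm : ∫⁻ x, ENNReal.ofReal ((η i x * u x) ^ 2) ≠ ⊤ := by
    refine ne_top_of_le_ne_top (hmass ▸ ENNReal.one_ne_top)
      (lintegral_mono fun x => ENNReal.ofReal_le_ofReal ?_)
    rw [mul_pow]
    exact mul_le_of_le_one_left (sq_nonneg _) (pow_le_one₀ (h.nonneg i x) (h.le_one i x))
  refine ENNReal.add_ne_top.2 ⟨ne_top_of_le_ne_top ?_ (hv.hardy hc (X i) one_pos), by finiteness⟩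
  exact ENNReal.add_ne_top.2 ⟨ENNReal.mul_ne_top ENNReal.ofReal_ne_top hγ,
    ENNReal.mul_ne_top ENNReal.ofReal_ne_top hvm⟩

theorem limitEnergy_le_rescaledEnergy_add {M : ℕ} {X : Fin M → E3} {r r₀ B : ℝ}
    {η : Fin M → E3 → ℝ} (h : IsCutoffFamily X r B η) (hr : 0 < r) (hrr : 2 * r < r₀)
    (hX : ∀ i j, i ≠ j → 4 * r₀ ≤ dist (X i) (X j)) {Z : Fin M → ℝ} (hZ : ∀ k, 0 < Z k)
    {b : ℝ} (hb : 0 < b) {ρ ρ' : SubProb} {ε : ℝ} (hε : 0 < ε) {t : Fin M → ℝ}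
    (ht0 : ∀ i, 0 ≤ t i) (ht1 : ∀ i, t i ≤ 1)
    (hfit : ∀ i, ENNReal.ofReal (t i) * ∫⁻ x, ENNReal.ofReal (η i x ^ 2) ∂ρ'.toMeasure
      ≤ ρ.toMeasure {X i}) {d : NNReal}
    (hd : ENNReal.ofReal (ε ^ 2) * ENNReal.ofReal B
            + ENNReal.ofReal ε * ∑ i, ENNReal.ofReal (Z i) * ENNReal.ofReal r⁻¹
            + ∑ i, ENNReal.ofReal (1 - t i) *
              (ENNReal.ofReal (Z i ^ 2) * ∫⁻ x, ENNReal.ofReal (η i x ^ 2) ∂ρ'.toMeasure)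
            + (ENNReal.ofReal (ε ^ 2) + ENNReal.ofReal (ε * b)) ≤ d) :
    limitEnergy X r₀ Z b ρ ≤ rescaledEnergy X Z b ε ρ' + (d : ℝ) := by
  unfold rescaledEnergy
  split_ifs with hcase
  swap
  · simp
  obtain ⟨hprob, hkin⟩ := hcase
  have hpot : ENNReal.ofReal ε * potential X Z ρ'.toMeasure ≠ ⊤ :=
    ENNReal.mul_ne_top ENNReal.ofReal_ne_top (potential_ne_top X Z hkin)
  by_cases hcorr : correlation ρ'.toMeasure = ⊤
  · have : ENNReal.ofReal (ε * b) ≠ 0 := (ENNReal.ofReal_pos.2 (by positivity)).ne'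
    rw [hcorr, ENNReal.mul_top this, add_top]
    lift ENNReal.ofReal ε * potential X Z ρ'.toMeasure to NNReal using hpot with q
    simp [EReal.coe_nnreal_eq_coe_real]
  -- Both infima may be missed by 1, because these errors are multiplied by ε² and εb; this is the
  -- last summand in `hd`.
  have hk1 : kinetic ρ'.toMeasure < kinetic ρ'.toMeasure + 1 :=
    ENNReal.lt_add_right hkin.ne one_ne_zero
  have hc1 : correlation ρ'.toMeasure < correlation ρ'.toMeasure + 1 :=
    ENNReal.lt_add_right hcorr one_ne_zero
  conv_lhs at hk1 => unfold kinetic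
  conv_lhs at hc1 => unfold correlation
  simp only [iInf_lt_iff] at hk1 hc1
  obtain ⟨u, g, hu, hg⟩ := hk1
  obtain ⟨P, ⟨hP1, hP2⟩, hP⟩ := hc1
  obtain ⟨κ, hκ, hle⟩ := exists_fragments_le h hr hrr hX hZ b (ρ := ρ) hu
    (hg.trans (ENNReal.add_lt_top.2 ⟨hkin, ENNReal.one_lt_top⟩)) hP1 hP2 hε ht0 ht1 hfit
  refine (iInf₂_le κ hκ).trans
    (ereal_sub_le_sub_add (κ.attraction_ne_top Z hκ) hpot d (hle.trans ?_))
  set E := ENNReal.ofReal (ε ^ 2) * ENNReal.ofReal B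
            + ENNReal.ofReal ε * ∑ i, ENNReal.ofReal (Z i) * ENNReal.ofReal r⁻¹
            + ∑ i, ENNReal.ofReal (1 - t i) *
              (ENNReal.ofReal (Z i ^ 2) * ∫⁻ x, ENNReal.ofReal (η i x ^ 2) ∂ρ'.toMeasure)
  calc _ ≤ ENNReal.ofReal (ε ^ 2) * (kinetic ρ'.toMeasure + 1)
          + ENNReal.ofReal (ε * b) * (correlation ρ'.toMeasure + 1) + κ.attraction Z + E := by
        gcongr
    _ = ENNReal.ofReal (ε ^ 2) * kinetic ρ'.toMeasure
          + ENNReal.ofReal (ε * b) * correlation ρ'.toMeasure + κ.attraction Z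
          + (E + (ENNReal.ofReal (ε ^ 2) + ENNReal.ofReal (ε * b))) := by ring
    _ ≤ _ := by gcongr

/-- Weak* convergence only keeps the mass m near a nucleus below the atom a up to an error d,
whereas `Fits` tolerates no excess. The factor is t = min(1, a/m), read as 1 when m ≤ a. -/
theorem exists_thinning {m a d : ℝ} (ha : 0 ≤ a) (hd : 0 ≤ d) (h : m ≤ a + d) :
    ∃ t : ℝ, 0 ≤ t ∧ t ≤ 1 ∧ t * m ≤ a ∧ (1 - t) * m ≤ d := by
  rcases le_or_gt m a with hma | hma
  · exact ⟨1, zero_le_one, le_rfl, by linarith, by linarith⟩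
  · have hm : 0 < m := ha.trans_lt hma
    refine ⟨a / m, by positivity, (div_le_one hm).2 hma.le, ?_, ?_⟩
    · rw [div_mul_cancel₀ _ hm.ne']
    · rw [sub_mul, div_mul_cancel₀ _ hm.ne']; linarith

/-! ### Weak* convergence, masses near the nuclei and the Γ-liminf inequality -/

theorem tendsto_subProb_iff {ι : Type*} {l : Filter ι} {y : ι → SubProb} {ρ : SubProb} :
    Tendsto y l (𝓝 ρ) ↔ ∀ f : C₀(E3, ℝ),
      Tendsto (fun k => ∫ x, f x ∂(y k).toMeasure) l (𝓝 (∫ x, f x ∂ρ.toMeasure)) := by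
  rw [nhds_induced, tendsto_comap_iff, tendsto_pi_nhds]
  rfl

instance SubProb.isFiniteMeasure (ρ : SubProb) : IsFiniteMeasure ρ.toMeasure :=
  ⟨ρ.mass_le_one.trans_lt ENNReal.one_lt_top⟩

theorem eventually_measure_closedBall_le (ρ : SubProb) (p : E3) {d : ℝ} (hd : 0 < d) :
    ∀ᶠ r in 𝓝[>] (0 : ℝ), ρ.toMeasure.real (Metric.closedBall p (2 * r))
      ≤ ρ.toMeasure.real {p} + d := by
  have h1 := tendsto_measure_cthickening_of_isClosed (μ := ρ.toMeasure) (s := {p})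
    ⟨1, one_pos, measure_ne_top _ _⟩ isClosed_singleton
  have h2 : Tendsto (fun r : ℝ => 2 * r) (𝓝[>] 0) (𝓝 0) := by
    have : Tendsto (fun r : ℝ => 2 * r) (𝓝 0) (𝓝 (2 * 0)) := tendsto_id.const_mul 2
    rw [mul_zero] at this
    exact this.mono_left nhdsWithin_le_nhds
  have h3 := (ENNReal.tendsto_toReal (measure_ne_top ρ.toMeasure {p})).comp (h1.comp h2)
  filter_upwards [h3.eventually (eventually_le_nhds (b := ρ.toMeasure.real {p} + d)
    (lt_add_of_pos_right _ hd)), self_mem_nhdsWithin] with r hr hr0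
  simp only [Function.comp] at hr
  rwa [Metric.cthickening_singleton _ (by have : (0 : ℝ) < r := hr0; positivity)] at hr

/-- The squared cutoff is an admissible test function and lies below the indicator of the closed
ball of radius 2r. -/
theorem IsCutoffFamily.eventually_mass_le {M : ℕ} {X : Fin M → E3} {r B : ℝ}
    {η : Fin M → E3 → ℝ} (h : IsCutoffFamily X r B η) {y : ℝ → SubProb} {ρ : SubProb}
    (hy : Tendsto y (𝓝[>] 0) (𝓝 ρ)) {d : ℝ} (hd : 0 < d) (i : Fin M)
    (hρ : ρ.toMeasure.real (Metric.closedBall (X i) (2 * r)) ≤ ρ.toMeasure.real {X i} + d) :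
    ∀ᶠ ε in 𝓝[>] (0 : ℝ),
      ∫ x, η i x ^ 2 ∂(y ε).toMeasure ≤ ρ.toMeasure.real {X i} + 2 * d := by
  have hc : HasCompactSupport fun x => η i x ^ 2 :=
    (h.hasCompactSupport i).mono fun x hx h0 => hx (by simp [h0])
  let f : C₀(E3, ℝ) := ⟨⟨fun x => η i x ^ 2, (h.contDiff i).continuous.pow 2⟩,
    hc.is_zero_at_infty⟩
  have h1 := tendsto_subProb_iff.1 hy f
  have h2 : ∫ x, f x ∂ρ.toMeasure ≤ ρ.toMeasure.real {X i} + d := by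
    refine le_trans ?_ hρ
    rw [← integral_indicator_one Metric.isClosed_closedBall.measurableSet]
    refine integral_mono_of_nonneg (Eventually.of_forall fun x => sq_nonneg _)
      ((integrable_const (1 : ℝ)).indicator Metric.isClosed_closedBall.measurableSet)
      (Eventually.of_forall fun x => ?_)
    by_cases hx : x ∈ Metric.closedBall (X i) (2 * r)
    · rw [Set.indicator_of_mem hx]
      exact pow_le_one₀ (h.nonneg i x) (h.le_one i x)
    · rw [Set.indicator_of_notMem hx]
      simp [f, h.eq_zero i x hx]
  exact h1.eventually (eventually_le_nhds (by linarith))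

theorem limitEnergy_le_liminf {M : ℕ} {X : Fin M → E3} {r₀ : ℝ} (hr₀ : 0 < r₀)
    (hX : ∀ i j, i ≠ j → 4 * r₀ ≤ dist (X i) (X j)) {Z : Fin M → ℝ} (hZ : ∀ k, 0 < Z k)
    {b : ℝ} (hb : 0 < b) {ρ : SubProb} {y : ℝ → SubProb} (hy : Tendsto y (𝓝[>] 0) (𝓝 ρ)) :
    limitEnergy X r₀ Z b ρ ≤ liminf (fun ε => rescaledEnergy X Z b ε (y ε)) (𝓝[>] 0) := by
  have key : ∀ d : NNReal, 0 < d → ∀ᶠ ε in 𝓝[>] (0 : ℝ),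
      limitEnergy X r₀ Z b ρ ≤ rescaledEnergy X Z b ε (y ε) + (d : ℝ) := by
    intro d hd
    set S := ∑ i, Z i ^ 2 with hS
    have hS0 : 0 ≤ S := Finset.sum_nonneg fun i _ => sq_nonneg _
    -- The mass tolerance comes first: it makes the thinning error, at most S · 2d', no larger than
    -- d/2. Then r is chosen from d', and finally ε is taken small depending on r, through B and W.
    set d' : ℝ := d / (4 * (S + 1)) with hd'
    have hd'0 : 0 < d' := by have : (0 : ℝ) < d := hd; positivity
    obtain ⟨r, hr, hr1, hr2⟩ : ∃ r : ℝ, 0 < r ∧ 2 * r < r₀ ∧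
        ∀ i, ρ.toMeasure.real (Metric.closedBall (X i) (2 * r))
          ≤ ρ.toMeasure.real {X i} + d' := by
      have h1 := eventually_all.2 fun i => eventually_measure_closedBall_le ρ (X i) hd'0
      have h2 : ∀ᶠ r in 𝓝[>] (0 : ℝ), r < r₀ / 2 :=
        eventually_nhdsWithin_of_eventually_nhds (eventually_lt_nhds (by positivity))
      obtain ⟨r, h1, h2, h3⟩ := (h1.and (h2.and self_mem_nhdsWithin)).exists
      exact ⟨r, h3, by linarith, h1⟩
    obtain ⟨B, η, h⟩ := exists_isCutoffFamily X hr
    have hmass := eventually_all.2 fun i => h.eventually_mass_le hy hd'0 i (hr2 i)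
    set W := ∑ i, Z i * r⁻¹ with hW
    have hsmall : ∀ᶠ ε in 𝓝[>] (0 : ℝ), ε ^ 2 * B + ε * W + (ε ^ 2 + ε * b) ≤ d / 2 := by
      have hc : Continuous fun ε : ℝ => ε ^ 2 * B + ε * W + (ε ^ 2 + ε * b) := by fun_prop
      have ht := hc.tendsto 0
      simp only [ne_eq, OfNat.ofNat_ne_zero, not_false_eq_true, zero_pow, zero_mul, add_zero] at ht
      have : (0 : ℝ) < d := hd
      exact eventually_nhdsWithin_of_eventually_nhds (ht.eventually (eventually_le_nhds
        (by positivity)))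
    filter_upwards [hmass, hsmall, self_mem_nhdsWithin] with ε hm hsm hε
    have hε' : 0 < ε := hε
    choose t ht0 ht1 ht2 ht3 using fun i => exists_thinning (m := ∫ x, η i x ^ 2 ∂(y ε).toMeasure)
      (measureReal_nonneg (μ := ρ.toMeasure) (s := {X i})) (by positivity : 0 ≤ 2 * d') (hm i)
    have hint : ∀ i, ∫⁻ x, ENNReal.ofReal (η i x ^ 2) ∂(y ε).toMeasure
        = ENNReal.ofReal (∫ x, η i x ^ 2 ∂(y ε).toMeasure) := fun i => by
      rw [ofReal_integral_eq_lintegral_ofReal _ (Eventually.of_forall fun x => sq_nonneg _)]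
      refine Integrable.mono' (integrable_const (1 : ℝ))
        ((h.measurable i).pow_const 2).aestronglyMeasurable (Eventually.of_forall fun x => ?_)
      rw [Real.norm_of_nonneg (sq_nonneg _)]
      exact pow_le_one₀ (h.nonneg i x) (h.le_one i x)
    have hint0 : ∀ i, 0 ≤ ∫ x, η i x ^ 2 ∂(y ε).toMeasure := fun i =>
      integral_nonneg fun x => sq_nonneg _
    refine limitEnergy_le_rescaledEnergy_add h hr hr1 hX hZ hb hε' ht0 ht1 (fun i => ?_) ?_
    · rw [hint i, ← ENNReal.ofReal_mul (ht0 i)]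
      exact (ENNReal.ofReal_le_ofReal (ht2 i)).trans ENNReal.ofReal_toReal_le
    · have e1 : ∑ i, ENNReal.ofReal (Z i) * ENNReal.ofReal r⁻¹ = ENNReal.ofReal W := by
        rw [hW, ENNReal.ofReal_sum_of_nonneg fun i _ => mul_nonneg (hZ i).le (by positivity)]
        exact Finset.sum_congr rfl fun i _ => (ENNReal.ofReal_mul (hZ i).le).symm
      have e2 : ∑ i, ENNReal.ofReal (1 - t i) *
          (ENNReal.ofReal (Z i ^ 2) * ∫⁻ x, ENNReal.ofReal (η i x ^ 2) ∂(y ε).toMeasure)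
          ≤ ENNReal.ofReal (d / 2) := by
        calc _ ≤ ∑ i, ENNReal.ofReal (Z i ^ 2 * (2 * d')) := by
              refine Finset.sum_le_sum fun i _ => ?_
              rw [hint i, ← ENNReal.ofReal_mul (sq_nonneg _),
                ← ENNReal.ofReal_mul (by linarith [ht1 i])]
              refine ENNReal.ofReal_le_ofReal ?_
              rw [mul_left_comm]
              exact mul_le_mul_of_nonneg_left (ht3 i) (sq_nonneg _)
          _ = ENNReal.ofReal (S * (2 * d')) := by
              rw [hS, Finset.sum_mul, ENNReal.ofReal_sum_of_nonneg fun i _ => by positivity]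
          _ ≤ ENNReal.ofReal (d / 2) := by
              refine ENNReal.ofReal_le_ofReal ?_
              rw [hd', show S * (2 * (d / (4 * (S + 1)))) = (d : ℝ) / 2 * (S / (S + 1)) by
                field_simp; norm_num]
              exact mul_le_of_le_one_right (by positivity)
                ((div_le_one (by positivity)).2 (by linarith))
      have hW0 : 0 ≤ W := Finset.sum_nonneg fun i _ => mul_nonneg (hZ i).le (by positivity)
      have hB0 := h.bound_nonneg
      rw [e1]
      calc _ ≤ ENNReal.ofReal (ε ^ 2) * ENNReal.ofReal B + ENNReal.ofReal ε * ENNReal.ofReal W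
            + ENNReal.ofReal (d / 2) + (ENNReal.ofReal (ε ^ 2) + ENNReal.ofReal (ε * b)) := by
            gcongr
        _ = ENNReal.ofReal (ε ^ 2 * B + ε * W + d / 2 + (ε ^ 2 + ε * b)) := by
            rw [← ENNReal.ofReal_mul (by positivity), ← ENNReal.ofReal_mul hε'.le,
              ← ENNReal.ofReal_add (by positivity) (by positivity),
              ← ENNReal.ofReal_add (by positivity) (by positivity),
              ← ENNReal.ofReal_add (by positivity) (by positivity),
              ← ENNReal.ofReal_add (by positivity) (by positivity)]
        _ ≤ ENNReal.ofReal d := ENNReal.ofReal_le_ofReal (by linarith)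
        _ = d := ENNReal.ofReal_coe_nnreal
  -- The values lie in `EReal`, so d is taken as the gap c' - c between two reals separating the
  -- liminf from the limit energy.
  by_contra hlt
  rw [not_le] at hlt
  obtain ⟨c, hc1, hc2⟩ := EReal.lt_iff_exists_real_btwn.1 hlt
  obtain ⟨c', hc3, hc4⟩ := EReal.lt_iff_exists_real_btwn.1 hc2
  have hcc : c < c' := EReal.coe_lt_coe_iff.1 hc3
  have hev := key (c' - c).toNNReal (Real.toNNReal_pos.2 (by linarith))
  rw [Real.coe_toNNReal _ (by linarith)] at hev
  refine absurd (le_liminf_of_le (by isBoundedDefault) (hev.mono fun ε hε => ?_))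
    (not_le.2 hc1)
  have h1 : (c' : EReal) ≤ rescaledEnergy X Z b ε (y ε) + ((c' - c : ℝ) : EReal) :=
    hc4.le.trans hε
  have h2 : (c' : EReal) = (c : EReal) + ((c' - c : ℝ) : EReal) := by
    rw [← EReal.coe_add]; congr 1; ring
  rw [h2] at h1
  by_contra h3
  rw [not_le] at h3
  exact absurd h1 (not_le.2 (EReal.add_lt_add_right_coe h3 (c' - c)))

/-! ### Quantization of measures on a lattice that avoids the nuclei -/

/-- The point of the lattice `h ℤ³` with the given index. -/
def latticePoint (h : ℝ) (z : Fin 3 → ℤ) : E3 := WithLp.toLp 2 fun i => h * z i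

/-- The index of a point of the lattice `h ℤ³` near `x`. -/
def latticeIndex (h : ℝ) (x : E3) : Fin 3 → ℤ := fun i => round (x i / h)

theorem measurable_latticeIndex (h : ℝ) : Measurable (latticeIndex h) := by
  refine measurable_pi_iff.2 fun i => ?_
  unfold latticeIndex
  simp_rw [round_eq]
  have : Measurable fun x : E3 => x i / h + 1 / 2 := by fun_prop
  exact this.floor

theorem abs_coord_le_norm (x : E3) (i : Fin 3) : |x i| ≤ ‖x‖ := by
  simpa using PiLp.norm_apply_le x i

theorem dist_latticePoint_latticeIndex_le {h : ℝ} (hh : 0 < h) (x : E3) :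
    dist (latticePoint h (latticeIndex h x)) x ≤ h := by
  have hc : ∀ i, (latticePoint h (latticeIndex h x) i - x i) ^ 2 ≤ h ^ 2 / 4 := fun i => by
    have h1 : |x i / h - round (x i / h)| ≤ 1 / 2 := abs_sub_round _
    have h2 : latticePoint h (latticeIndex h x) i - x i
        = -h * (x i / h - round (x i / h)) := by
      simp only [latticePoint, latticeIndex]
      field_simp
      ring
    rw [h2, mul_pow, neg_sq]
    have h3 : (x i / h - round (x i / h)) ^ 2 ≤ (1 / 2) ^ 2 := by
      rw [← sq_abs]; gcongr
    nlinarith [sq_nonneg h]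
  rw [EuclideanSpace.dist_eq]
  refine Real.sqrt_le_iff.2 ⟨hh.le, ?_⟩
  simp_rw [Real.dist_eq, sq_abs]
  rw [Fin.sum_univ_three]
  nlinarith [hc 0, hc 1, hc 2, sq_nonneg h]

theorem le_dist_latticePoint {h : ℝ} (hh : 0 < h) {z z' : Fin 3 → ℤ} (hz : z ≠ z') :
    h ≤ dist (latticePoint h z) (latticePoint h z') := by
  obtain ⟨i, hi⟩ := Function.ne_iff.1 hz
  have h1 : (1 : ℝ) ≤ |(z i : ℝ) - z' i| := by
    exact_mod_cast Int.one_le_abs (sub_ne_zero.2 hi)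
  have h2 := abs_coord_le_norm (latticePoint h z - latticePoint h z') i
  rw [dist_eq_norm]
  refine le_trans ?_ h2
  simp only [latticePoint, PiLp.sub_apply]
  rw [← mul_sub, abs_mul, abs_of_pos hh]
  nlinarith

theorem latticePoint_add (h : ℝ) (z w : Fin 3 → ℤ) :
    latticePoint h (z + w) = latticePoint h z + latticePoint h w := by
  ext i
  simp [latticePoint, mul_add]

theorem norm_latticePoint_single {h : ℝ} (hh : 0 < h) (n : ℕ) :
    ‖latticePoint h (Pi.single 0 (n : ℤ))‖ = h * n := by
  rw [EuclideanSpace.norm_eq, Fin.sum_univ_three]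
  simp only [latticePoint, Real.norm_eq_abs, sq_abs]
  simp
  rw [Real.sqrt_sq (by positivity)]

/-- Round to the lattice h ℤ³; if the result is too close to a nucleus, shift it by 8h along the
first axis; if neither point is usable, go to a fixed remote point, which happens only for |x| ≥
1/h. The bound 9h is h for rounding plus 8h for the shift. -/
theorem exists_quantization {M : ℕ} {X : Fin M → E3} {r₀ : ℝ} (hr₀ : 0 < r₀)
    (hX : ∀ i j, i ≠ j → 4 * r₀ ≤ dist (X i) (X j)) :
    ∀ᶠ h in 𝓝[>] (0 : ℝ), ∃ (J : Finset E3) (q : E3 → E3) (c₀ : E3), Measurable q ∧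
      (∀ x, q x ∈ J) ∧ c₀ ∈ J ∧ h⁻¹ ≤ ‖c₀‖ ∧
      (∀ c ∈ J, ∀ c' ∈ J, c ≠ c' → h ≤ dist c c') ∧ (∀ c ∈ J, ∀ i, 3 * h ≤ dist c (X i)) ∧
      ∀ x, dist (q x) x ≤ 9 * h ∨ (h⁻¹ ≤ ‖x‖ ∧ h⁻¹ ≤ ‖q x‖) := by
  classical
  -- Here 14 = 3 + 8 + 3: a point within 3h of one nucleus, shifted by 8h, is still 3h away from
  -- every other nucleus.
  have ev1 : ∀ᶠ h in 𝓝[>] (0 : ℝ), 14 * h ≤ 4 * r₀ := by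
    have : ∀ᶠ h in 𝓝 (0 : ℝ), h ≤ 4 * r₀ / 14 := eventually_le_nhds (by positivity)
    filter_upwards [eventually_nhdsWithin_of_eventually_nhds this] with h hh
    linarith
  have ev2 : ∀ᶠ h in 𝓝[>] (0 : ℝ), ∀ i, ‖X i‖ + 3 * r₀ ≤ h⁻¹ :=
    eventually_all.2 fun i => tendsto_inv_nhdsGT_zero.eventually (eventually_ge_atTop _)
  filter_upwards [ev1, ev2, self_mem_nhdsWithin] with h h1 h2 hh
  have hh : 0 < h := hh
  -- The box must reach distance 1/h, hence h⁻² indices; 10 leaves room for rounding and for the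
  -- shift by 8 indices.
  obtain ⟨N, hN⟩ := exists_nat_ge (h⁻¹ * h⁻¹ + 10)
  have hN10 : (10 : ℝ) ≤ N := le_trans (by have := mul_self_nonneg h⁻¹; linarith) hN
  let good : (Fin 3 → ℤ) → Prop := fun z =>
    (∀ i, |z i| ≤ (N : ℤ)) ∧ ∀ i, 3 * h ≤ dist (latticePoint h z) (X i)
  let far : Fin 3 → ℤ := Pi.single 0 (N : ℤ)
  let e : Fin 3 → ℤ := Pi.single 0 ((8 : ℕ) : ℤ)
  let J : Finset E3 := ((Fintype.piFinset fun _ : Fin 3 => Finset.Icc (-(N : ℤ)) N).filter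
    good).image (latticePoint h)
  have hJ : ∀ z, good z → latticePoint h z ∈ J := fun z hz =>
    Finset.mem_image_of_mem _ (Finset.mem_filter.2
      ⟨Fintype.mem_piFinset.2 fun i => Finset.mem_Icc.2 (abs_le.1 (hz.1 i)), hz⟩)
  have hfarn : h⁻¹ ≤ ‖latticePoint h far‖ := by
    rw [norm_latticePoint_single hh]
    calc h⁻¹ = h * (h⁻¹ * h⁻¹) := by field_simp
      _ ≤ h * N := by gcongr; linarith
  have hfar : good far := by
    refine ⟨fun i => ?_, fun i => ?_⟩
    · by_cases hi : i = 0
      · subst hi; simp [far]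
      · simp [far, hi]
    · have h3 := h2 i
      have h4 := norm_sub_norm_le (latticePoint h far) (X i)
      rw [← dist_eq_norm] at h4
      linarith
  let F : (Fin 3 → ℤ) → (Fin 3 → ℤ) := fun z =>
    if good z then z else if good (z + e) then z + e else far
  have hF : ∀ z, good (F z) := fun z => by
    simp only [F]
    split_ifs with hz hz'
    · exact hz
    · exact hz'
    · exact hfar
  refine ⟨J, fun x => latticePoint h (F (latticeIndex h x)), latticePoint h far,
    (measurable_of_countable fun z => latticePoint h (F z)).comp (measurable_latticeIndex h),
    fun x => hJ _ (hF _), hJ _ hfar, hfarn, ?_, ?_, ?_⟩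
  · intro c hc c' hc' hne
    obtain ⟨z, _, rfl⟩ := Finset.mem_image.1 hc
    obtain ⟨z', _, rfl⟩ := Finset.mem_image.1 hc'
    exact le_dist_latticePoint hh fun hz => hne (by rw [hz])
  · intro c hc i
    obtain ⟨z, hz, rfl⟩ := Finset.mem_image.1 hc
    exact (Finset.mem_filter.1 hz).2.2 i
  · intro x
    set z := latticeIndex h x with hz
    have hzx := dist_latticePoint_latticeIndex_le hh x
    have hen : ‖latticePoint h e‖ = 8 * h := by
      rw [norm_latticePoint_single hh]; push_cast; ring
    simp only [F]
    split_ifs with hg hg'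
    · exact Or.inl (hzx.trans (by linarith))
    · refine Or.inl ?_
      rw [latticePoint_add, dist_eq_norm, add_sub_right_comm]
      refine (norm_add_le _ _).trans ?_
      rw [hen, ← dist_eq_norm]
      linarith
    · refine Or.inr ⟨?_, hfarn⟩
      by_contra hx
      rw [not_le] at hx
      have hbox : ∀ i, |(z i : ℝ)| ≤ h⁻¹ * h⁻¹ + 1 := fun i => by
        have e1 : |x i / h - round (x i / h)| ≤ 1 / 2 := abs_sub_round _
        have e2 : |x i / h| ≤ h⁻¹ * h⁻¹ := by
          rw [abs_div, abs_of_pos hh, div_eq_mul_inv]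
          gcongr
          exact (abs_coord_le_norm x i).trans hx.le
        have e3 : |(z i : ℝ)| ≤ |x i / h| + |x i / h - round (x i / h)| := by
          have := abs_sub (x i / h) (x i / h - round (x i / h))
          simpa [hz, latticeIndex] using this
        linarith
      have hbig : ∀ i, |z i| ≤ (N : ℤ) := fun i => by
        have := hbox i
        have : |(z i : ℝ)| ≤ N := by linarith
        exact_mod_cast this
      have hbig' : ∀ i, |(z + e) i| ≤ (N : ℤ) := fun i => by
        have e1 := hbox i
        have e2 : |((z + e) i : ℝ)| ≤ N := by
          have e3 : |(e i : ℝ)| ≤ 8 := by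
            by_cases hi : i = 0
            · subst hi; simp [e]
            · simp [e, hi]
          have e4 := abs_add_le (z i : ℝ) (e i)
          push_cast [Pi.add_apply]
          linarith
        exact_mod_cast e2
      obtain ⟨i, hi⟩ : ∃ i, dist (latticePoint h z) (X i) < 3 * h := by
        by_contra hcon
        push Not at hcon
        exact hg ⟨hbig, hcon⟩
      refine hg' ⟨hbig', fun j => ?_⟩
      have hshift : dist (latticePoint h (z + e)) (latticePoint h z) = 8 * h := by
        rw [latticePoint_add, dist_eq_norm, add_sub_cancel_left, hen]
      by_cases hij : i = j
      · subst hij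
        have := dist_triangle_right (latticePoint h (z + e)) (latticePoint h z) (X i)
        linarith
      · have t1 := hX i j hij
        have t2 := dist_triangle4 (X i) (latticePoint h z) (latticePoint h (z + e)) (X j)
        rw [dist_comm (X i) (latticePoint h z),
          dist_comm (latticePoint h z) (latticePoint h (z + e))] at t2
        linarith

/-! ### Localized bumps of unit mass -/

theorem exists_unit_bump : ∃ ψ : E3 → ℝ, ContDiff ℝ ∞ ψ ∧ (∀ x, 0 ≤ ψ x) ∧
    (∀ x ∉ Metric.ball (0 : E3) (1 / 2), ψ x = 0 ∧ gradient ψ x = 0) ∧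
    ∫⁻ x, ENNReal.ofReal (ψ x ^ 2) = 1 ∧ ∫⁻ x, ‖gradient ψ x‖ₑ ^ 2 ≠ ⊤ := by
  let χ : ContDiffBump (0 : E3) := ⟨1 / 4, 1 / 3, by norm_num, by norm_num⟩
  have hχ : ContDiff ℝ ∞ χ := χ.contDiff
  have hc2 : HasCompactSupport fun x => χ x ^ 2 :=
    χ.hasCompactSupport.mono fun x hx h => hx (by simp [h])
  have hI : 0 < ∫ x, χ x ^ 2 := by
    refine (hχ.continuous.pow 2).integral_pos_of_hasCompactSupport_nonneg_nonzero hc2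
      (fun x => sq_nonneg _) (x := 0) ?_
    have : χ 0 = 1 := χ.one_of_mem_closedBall (by simp [χ])
    simp [this]
  set k := (√(∫ x, χ x ^ 2))⁻¹ with hk
  have hψ : ContDiff ℝ ∞ fun x => k * χ x := contDiff_const.mul hχ
  have hψc : HasCompactSupport fun x => k * χ x :=
    χ.hasCompactSupport.mono fun x hx => right_ne_zero_of_mul hx
  have hzero : ∀ x ∉ Metric.closedBall (0 : E3) (1 / 3), (fun x => k * χ x) x = 0 := by
    intro x hx
    have : χ x = 0 := χ.zero_of_le_dist (not_le.1 hx).le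
    simp [this]
  have hsub : Metric.closedBall (0 : E3) (1 / 3) ⊆ Metric.ball 0 (1 / 2) :=
    Metric.closedBall_subset_ball (by norm_num)
  refine ⟨fun x => k * χ x, hψ, fun x => mul_nonneg (by positivity) χ.nonneg,
    fun x hx => ⟨hzero x fun hx' => hx (hsub hx'), ?_⟩, ?_, ?_⟩
  · have hev : (fun x => k * χ x) =ᶠ[𝓝 x] fun _ => (0 : ℝ) :=
      Filter.eventually_of_mem (Metric.isClosed_closedBall.isOpen_compl.mem_nhds
        fun hx' => hx (hsub hx')) hzero
    rw [gradient, hev.fderiv_eq]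
    simp
  · have e : ∀ x, ENNReal.ofReal ((k * χ x) ^ 2)
        = ENNReal.ofReal (k ^ 2) * ENNReal.ofReal (χ x ^ 2) := fun x => by
      rw [mul_pow, ENNReal.ofReal_mul (sq_nonneg _)]
    have hi : Integrable fun x => χ x ^ 2 :=
      (hχ.continuous.pow 2).integrable_of_hasCompactSupport hc2
    simp_rw [e]
    rw [lintegral_const_mul' _ _ ENNReal.ofReal_ne_top,
      ← ofReal_integral_eq_lintegral_ofReal hi (Eventually.of_forall fun x => sq_nonneg _),
      ← ENNReal.ofReal_mul (sq_nonneg _), hk, inv_pow, Real.sq_sqrt hI.le,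
      inv_mul_cancel₀ hI.ne', ENNReal.ofReal_one]
  · have hcg : HasCompactSupport fun x => ‖gradient (fun x => k * χ x) x‖ ^ 2 :=
      (hasCompactSupport_gradient hψc).mono fun x hx h => hx (by simp [h])
    have hcc : Continuous fun x => ‖gradient (fun x => k * χ x) x‖ ^ 2 :=
      (continuous_gradient hψ).norm.pow 2
    have hi := hcc.integrable_of_hasCompactSupport (μ := volume) hcg
    simp_rw [enorm_sq_eq_ofReal_norm_sq]
    exact hi.lintegral_lt_top.ne

/-! ### Contracting the fragments -/

theorem edist_affine {l : ℝ} (hl : 0 < l) (p x y : E3) :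
    edist (p + l • x) (p + l • y) = ENNReal.ofReal l * edist x y := by
  rw [edist_add_left, edist_smul₀, Real.nnnorm_of_nonneg hl.le, ENNReal.smul_def, smul_eq_mul]
  congr 1
  exact (ENNReal.ofReal_eq_coe_nnreal hl.le).symm

theorem inv_ofReal_mul {l : ℝ} (hl : 0 < l) (e : ℝ≥0∞) :
    (ENNReal.ofReal l * e)⁻¹ = ENNReal.ofReal l⁻¹ * e⁻¹ := by
  rw [ENNReal.mul_inv (Or.inl (ENNReal.ofReal_pos.2 hl).ne') (Or.inl ENNReal.ofReal_ne_top),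
    ENNReal.ofReal_inv_of_pos hl]

theorem sub_smul_add_smul (l : ℝ) (p : E3) : p - l • p + l • p = p := by simp

/-- The translation p - l • p makes p the fixed point of the dilation, so distances to p scale
exactly by l. -/
theorem lintegral_dilate_coulomb {l : ℝ} (hl : 0 < l) (p : E3) (u : E3 → ℝ) :
    ∫⁻ x, ENNReal.ofReal (dilate l (p - l • p) u x ^ 2) * (edist x p)⁻¹
      = ENNReal.ofReal l⁻¹ * ∫⁻ x, ENNReal.ofReal (u x ^ 2) * (edist x p)⁻¹ := by
  rw [lintegral_dilate hl _ u fun x => (edist x p)⁻¹,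
    ← lintegral_const_mul' _ _ ENNReal.ofReal_ne_top]
  refine lintegral_congr fun x => ?_
  have h := edist_affine hl (p - l • p) x p
  rw [sub_smul_add_smul] at h
  rw [h, inv_ofReal_mul hl]
  ring

theorem inv_smul_sub_notMem_ball {l r h : ℝ} (hl : 0 < l) (hlr : l * r ≤ h) {p x : E3}
    (hx : x ∉ Metric.ball p h) : l⁻¹ • (x - (p - l • p)) ∉ Metric.ball p r := by
  intro hx'
  apply hx
  rw [Metric.mem_ball, dist_eq_norm] at hx' ⊢
  have e : l⁻¹ • (x - (p - l • p)) - p = l⁻¹ • (x - p) := by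
    rw [← sub_add, smul_add, smul_smul, inv_mul_cancel₀ hl.ne', one_smul, add_sub_cancel_right]
  rw [e, norm_smul, Real.norm_of_nonneg (by positivity), inv_mul_lt_iff₀ hl] at hx'
  exact hx'.trans_le hlr

/-- The map that contracts each ball around a nucleus by the factor `l`. -/
def contract {M : ℕ} (X : Fin M → E3) (r l : ℝ) (x : E3) : E3 :=
  x + ∑ i, (Metric.ball (X i) r).indicator (fun x => (l - 1) • (x - X i)) x

theorem measurable_contract {M : ℕ} (X : Fin M → E3) (r l : ℝ) : Measurable (contract X r l) := by
  refine measurable_id.add (Finset.measurable_sum _ fun i _ => ?_)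
  exact Measurable.indicator (by fun_prop) Metric.isOpen_ball.measurableSet

section contract

variable {M : ℕ} {X : Fin M → E3} {r l : ℝ}

theorem contract_eq (hr : 0 < r) (hX : ∀ i j, i ≠ j → 4 * r ≤ dist (X i) (X j)) {i : Fin M}
    {x : E3} (hx : x ∈ Metric.ball (X i) r) : contract X r l x = X i - l • X i + l • x := by
  rw [contract, Finset.sum_eq_single i, Set.indicator_of_mem hx]
  · rw [sub_smul, smul_sub, one_smul]
    abel
  · intro j _ hj
    refine Set.indicator_of_notMem (fun hx' => ?_) _
    have h1 := hX i j hj.symm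
    have h2 := dist_triangle_left (X i) (X j) x
    rw [Metric.mem_ball] at hx hx'
    linarith
  · simp

/-- Points of the same ball have their distance scaled by l. Points of different balls stay within r
of their centres, which are 4r apart, so they remain at distance at least 2r. -/
theorem edist_contract_inv_le (hr : 0 < r) (hl : 0 < l) (hl1 : l ≤ 1)
    (hX : ∀ i j, i ≠ j → 4 * r ≤ dist (X i) (X j))
    {x y : E3} (hx : ∃ i, x ∈ Metric.ball (X i) r) (hy : ∃ i, y ∈ Metric.ball (X i) r) :
    (edist (contract X r l x) (contract X r l y))⁻¹
      ≤ ENNReal.ofReal l⁻¹ * (edist x y)⁻¹ + ENNReal.ofReal (2 * r)⁻¹ := by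
  obtain ⟨i, hi⟩ := hx
  obtain ⟨j, hj⟩ := hy
  rw [contract_eq hr hX hi, contract_eq hr hX hj]
  by_cases hij : i = j
  · subst hij
    rw [edist_affine hl, inv_ofReal_mul hl]
    exact le_self_add
  · refine le_add_left ?_
    rw [ENNReal.ofReal_inv_of_pos (by positivity), ENNReal.inv_le_inv, edist_dist]
    refine ENNReal.ofReal_le_ofReal ?_
    have near : ∀ (k : Fin M) (z : E3), z ∈ Metric.ball (X k) r →
        dist (X k) (X k - l • X k + l • z) ≤ r := fun k z hz => by
      rw [dist_comm, dist_eq_norm,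
        show X k - l • X k + l • z - X k = l • (z - X k) by rw [smul_sub]; abel, norm_smul,
        Real.norm_of_nonneg hl.le, ← dist_eq_norm]
      have := (Metric.mem_ball.1 hz).le
      nlinarith [dist_nonneg (x := z) (y := X k)]
    have h1 := near i x hi
    have h2 := near j y hj
    have h3 := hX i j hij
    have h4 := dist_triangle4_right (X i) (X j) (X i - l • X i + l • x) (X j - l • X j + l • y)
    linarith

theorem map_contract_sqDensity (hr : 0 < r) (hl : 0 < l)
    (hX : ∀ i j, i ≠ j → 4 * r ≤ dist (X i) (X j)) {i : Fin M} {u : E3 → ℝ}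
    (hu : ∀ x ∉ Metric.ball (X i) r, u x = 0) :
    (sqDensity u).map (contract X r l) = sqDensity (dilate l (X i - l • X i) u) := by
  rw [sqDensity_dilate hl]
  refine Measure.map_congr ?_
  have h0 : sqDensity u (Metric.ball (X i) r)ᶜ = 0 :=
    sqDensity_eq_zero Metric.isOpen_ball.measurableSet.compl hu
  filter_upwards [mem_ae_iff.2 h0] with x hx
  exact contract_eq hr hX hx

/-- Push the plan forward by `contract` in both variables. Both marginals are carried by the balls,
where `edist_contract_inv_le` applies; cross-ball pairs account for the additive error. -/
theorem Fragments.exists_contracted_plan (κ : Fragments X r) (hr : 0 < r) (hl : 0 < l)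
    (hl1 : l ≤ 1) (hX : ∀ i j, i ≠ j → 4 * r ≤ dist (X i) (X j)) :
    ∃ Q : Measure (E3 × E3),
      Q.map Prod.fst ≤ ∑ i, sqDensity (dilate l (X i - l • X i) (κ.u i)) ∧
      Q.map Prod.snd ≤ ∑ i, sqDensity (dilate l (X i - l • X i) (κ.u i)) ∧
      Q Set.univ = κ.plan Set.univ ∧
      ∫⁻ p, (edist p.1 p.2)⁻¹ ∂Q ≤ ENNReal.ofReal l⁻¹ * ∫⁻ p, (edist p.1 p.2)⁻¹ ∂κ.plan
        + ENNReal.ofReal (2 * r)⁻¹ * κ.plan Set.univ := by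
  have hΦ := measurable_contract X r l
  have hΦΦ : Measurable (Prod.map (contract X r l) (contract X r l)) := hΦ.prodMap hΦ
  have hμ : (∑ i, sqDensity (κ.u i)).map (contract X r l)
      = ∑ i, sqDensity (dilate l (X i - l • X i) (κ.u i)) := by
    ext s hs
    rw [Measure.map_apply hΦ hs]
    simp_rw [Measure.finsetSum_apply, ← map_contract_sqDensity hr hl hX (κ.u_eq_zero _),
      Measure.map_apply hΦ hs]
  let S : Set E3 := ⋃ i, Metric.ball (X i) r
  have hSm : MeasurableSet S := MeasurableSet.iUnion fun i => Metric.isOpen_ball.measurableSet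
  have hS0 : (∑ i, sqDensity (κ.u i)) Sᶜ = 0 := by
    rw [Measure.finsetSum_apply]
    refine Finset.sum_eq_zero fun i _ => sqDensity_eq_zero hSm.compl fun x hx =>
      κ.u_eq_zero i x fun hx' => hx (Set.mem_iUnion_of_mem i hx')
  have ae1 : ∀ᵐ p ∂κ.plan, p.1 ∈ S := by
    refine mem_ae_iff.2 ?_
    have h1 := le_antisymm ((κ.plan_fst Sᶜ).trans hS0.le) zero_le
    rwa [Measure.map_apply measurable_fst hSm.compl] at h1
  have ae2 : ∀ᵐ p ∂κ.plan, p.2 ∈ S := by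
    refine mem_ae_iff.2 ?_
    have h1 := le_antisymm ((κ.plan_snd Sᶜ).trans hS0.le) zero_le
    rwa [Measure.map_apply measurable_snd hSm.compl] at h1
  have hedist : Measurable fun p : E3 × E3 => (edist p.1 p.2)⁻¹ :=
    (measurable_fst.edist measurable_snd).inv
  refine ⟨κ.plan.map (Prod.map (contract X r l) (contract X r l)), ?_, ?_, ?_, ?_⟩
  · rw [Measure.map_map measurable_fst hΦΦ, ← hμ]
    have : Prod.fst ∘ Prod.map (contract X r l) (contract X r l)
      = contract X r l ∘ (Prod.fst : E3 × E3 → E3) := rfl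
    rw [this, ← Measure.map_map hΦ measurable_fst]
    exact Measure.map_mono κ.plan_fst hΦ
  · rw [Measure.map_map measurable_snd hΦΦ, ← hμ]
    have : Prod.snd ∘ Prod.map (contract X r l) (contract X r l)
      = contract X r l ∘ (Prod.snd : E3 × E3 → E3) := rfl
    rw [this, ← Measure.map_map hΦ measurable_snd]
    exact Measure.map_mono κ.plan_snd hΦ
  · rw [Measure.map_apply hΦΦ MeasurableSet.univ, Set.preimage_univ]
  · rw [lintegral_map hedist hΦΦ, ← lintegral_const_mul _ hedist, ← lintegral_const,
      ← lintegral_add_right _ measurable_const]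
    refine lintegral_mono_ae ?_
    filter_upwards [ae1, ae2] with p hp1 hp2
    exact edist_contract_inv_le hr hl hl1 hX (Set.mem_iUnion.1 hp1) (Set.mem_iUnion.1 hp2)

end contract

/-! ### Weak convergence of the recovery family -/

theorem sqDensity_sqrt_mul {w : ℝ} (hw : 0 ≤ w) (f : E3 → ℝ) :
    sqDensity (fun x => √w * f x) = ENNReal.ofReal w • sqDensity f := by
  have e : (fun x => ENNReal.ofReal ((√w * f x) ^ 2))
      = ENNReal.ofReal w • fun x => ENNReal.ofReal (f x ^ 2) := by
    ext x
    rw [mul_pow, Real.sq_sqrt hw, ENNReal.ofReal_mul hw]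
    rfl
  rw [sqDensity, e, withDensity_smul' _ _ ENNReal.ofReal_ne_top]
  rfl

theorem abs_integral_sub_le_of_ball {μ : Measure E3} [IsFiniteMeasure μ] {p : E3} {h D : ℝ}
    (hμ : μ (Metric.ball p h)ᶜ = 0) {f : E3 → ℝ} (hf : Integrable f μ)
    (hD : ∀ x ∈ Metric.ball p h, |f x - f p| ≤ D) :
    |∫ x, f x ∂μ - μ.real Set.univ * f p| ≤ D * μ.real Set.univ := by
  have e : ∫ x, f x ∂μ - μ.real Set.univ * f p = ∫ x, (f x - f p) ∂μ := by
    rw [integral_sub hf (integrable_const _)]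
    simp
  rw [e, ← Real.norm_eq_abs]
  refine norm_integral_le_of_norm_le_const ?_
  filter_upwards [mem_ae_iff.2 hμ] with x hx
  exact hD x hx

/-- The part of `ρ` that remains when atoms at the nuclei are removed. -/
theorem exists_remainder {M : ℕ} {X : Fin M → E3} (hX : Function.Injective X) (ρ : SubProb)
    {m : Fin M → ℝ≥0∞} (hm : ∀ i, m i ≤ ρ.toMeasure {X i}) :
    ∃ ν : Measure E3, ν + ∑ i, m i • Measure.dirac (X i) = ρ.toMeasure := by
  have hle : ∑ i, m i • Measure.dirac (X i) ≤ ρ.toMeasure := by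
    classical
    refine Measure.le_iff.2 fun s hs => ?_
    have h : ∑ i with X i ∈ s, ρ.toMeasure {X i}
        = ρ.toMeasure (⋃ i ∈ (Finset.univ.filter fun i => X i ∈ s), {X i}) :=
      (measure_biUnion_finset (fun i _ j _ hij => Set.disjoint_singleton.2 fun h => hij (hX h))
        (fun i _ => measurableSet_singleton _)).symm
    calc (∑ i, m i • Measure.dirac (X i)) s = ∑ i with X i ∈ s, m i := by
          rw [Measure.finsetSum_apply, Finset.sum_filter]
          refine Finset.sum_congr rfl fun i _ => ?_
          rw [Measure.smul_apply, Measure.dirac_apply' _ hs]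
          by_cases hi : X i ∈ s <;> simp [hi]
      _ ≤ ∑ i with X i ∈ s, ρ.toMeasure {X i} := Finset.sum_le_sum fun i _ => hm i
      _ = _ := h
      _ ≤ ρ.toMeasure s := measure_mono (Set.iUnion₂_subset fun i hi =>
          Set.singleton_subset_iff.2 (Finset.mem_filter.1 hi).2)
  have : IsFiniteMeasure (∑ i, m i • Measure.dirac (X i)) := isFiniteMeasure_of_le _ hle
  exact ⟨_, Measure.sub_add_cancel_of_le hle⟩

/-! ### The upper bound -/

/-- A finite lattice of mesh `h` that stays away from the nuclei, together with a measurable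
rounding map; points far away may be moved to other points far away. -/
structure IsQuantization {M : ℕ} (X : Fin M → E3) (h : ℝ) (J : Finset E3) (q : E3 → E3)
    (c₀ : E3) : Prop where
  measurable : Measurable q
  mem : ∀ x, q x ∈ J
  far_mem : c₀ ∈ J
  far : h⁻¹ ≤ ‖c₀‖
  separated : ∀ c ∈ J, ∀ c' ∈ J, c ≠ c' → h ≤ dist c c'
  away : ∀ c ∈ J, ∀ i, 3 * h ≤ dist c (X i)
  close : ∀ x, dist (q x) x ≤ 9 * h ∨ (h⁻¹ ≤ ‖x‖ ∧ h⁻¹ ≤ ‖q x‖)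

/-- `f` oscillates by at most `D` at the scale `h`, and it is at most `D` far away. -/
def OscillationBound (f : E3 → ℝ) (h D : ℝ) : Prop :=
  (∀ x y, dist x y ≤ 9 * h → |f x - f y| ≤ D) ∧ ∀ x, h⁻¹ ≤ ‖x‖ → |f x| ≤ D / 2

theorem OscillationBound.nonneg {f : E3 → ℝ} {h D : ℝ} (hf : OscillationBound f h D)
    (hh : 0 < h) : 0 ≤ D :=
  (abs_nonneg _).trans (hf.1 0 0 (by simp; positivity))

theorem IsQuantization.oscillation {M : ℕ} {X : Fin M → E3} {h : ℝ} {J : Finset E3} {q : E3 → E3}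
    {c₀ : E3} (hJ : IsQuantization X h J q c₀) {f : E3 → ℝ} {D : ℝ} (hf : OscillationBound f h D)
    (x : E3) : |f (q x) - f x| ≤ D := by
  rcases hJ.close x with hx | ⟨h1, h2⟩
  · exact hf.1 _ _ hx
  · have e1 := hf.2 _ h1
    have e2 := hf.2 _ h2
    have e3 := abs_sub (f (q x)) (f x)
    linarith

/-- The quantization of a measure `ν`, with the missing mass added at a remote point. -/
theorem IsQuantization.exists_weights {M : ℕ} {X : Fin M → E3} {h : ℝ} {J : Finset E3}
    {q : E3 → E3} {c₀ : E3} (hJ : IsQuantization X h J q c₀) (ν : Measure E3)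
    [IsFiniteMeasure ν] {k : ℝ} (hk : 0 ≤ k) :
    ∃ w : J → ℝ, (∀ c, 0 ≤ w c) ∧ ∑ c, w c = ν.real Set.univ + k ∧
      ∀ (f : C₀(E3, ℝ)) (D : ℝ), OscillationBound f h D →
        |∑ c, w c * f c - ∫ x, f x ∂ν| ≤ D * (ν.real Set.univ + k) := by
  -- The missing mass has to be put somewhere, and at c₀ it is almost invisible to functions
  -- vanishing at infinity.
  let ν' : Measure E3 := ν.map q + ENNReal.ofReal k • Measure.dirac c₀
  have : IsFiniteMeasure (ENNReal.ofReal k • Measure.dirac c₀) :=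
    Measure.smul_finite _ ENNReal.ofReal_ne_top
  have hν'0 : ν' (J : Set E3)ᶜ = 0 := by
    have hm : MeasurableSet ((J : Set E3)ᶜ) := J.measurableSet.compl
    have h1 : q ⁻¹' (J : Set E3)ᶜ = ∅ := by
      ext x; simp [hJ.mem x]
    simp [ν', Measure.map_apply hJ.measurable hm, h1, Measure.dirac_apply' _ hm, hJ.far_mem]
  have hrestrict : ν'.restrict (J : Set E3) = ν' :=
    Measure.restrict_eq_self_of_ae_mem (mem_ae_iff.2 hν'0)
  have hsum : ∀ f : E3 → ℝ, ∑ c : J, ν'.real {(c : E3)} * f c = ∫ x, f x ∂ν' := fun f => by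
    conv_rhs => rw [← hrestrict, setIntegral_finset _ IntegrableOn.finset, ← Finset.sum_coe_sort J]
    rfl
  have huniv : ν'.real Set.univ = ν.real Set.univ + k := by
    simp only [ν']
    rw [measureReal_add_apply, measureReal_ennreal_smul_apply, ENNReal.toReal_ofReal hk,
      map_measureReal_apply hJ.measurable MeasurableSet.univ]
    simp
  refine ⟨fun c => ν'.real {(c : E3)}, fun c => measureReal_nonneg, ?_, fun f D hf => ?_⟩
  · rw [← huniv]
    have := hsum fun _ => 1
    simpa using this
  · have hfc : Continuous f := f.continuous
    have hfi : ∀ μ : Measure E3, IsFiniteMeasure μ → Integrable f μ := fun μ _ =>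
      f.toBCF.integrable μ
    have hq : Integrable (fun x => f (q x)) ν := by
      have := hfi (ν.map q) inferInstance
      exact this.comp_measurable hJ.measurable
    rw [hsum f, integral_add_measure (hfi _ inferInstance) (hfi _ inferInstance),
      integral_map hJ.measurable.aemeasurable hfc.aestronglyMeasurable, integral_smul_measure,
      integral_dirac, ENNReal.toReal_ofReal hk, smul_eq_mul, add_sub_right_comm,
      ← integral_sub hq (hfi ν inferInstance), mul_add]
    refine (abs_add_le _ _).trans (add_le_add ?_ ?_)
    · rw [← Real.norm_eq_abs]
      exact norm_integral_le_of_norm_le_const (Eventually.of_forall fun x => hJ.oscillation hf x)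
    · rw [abs_mul, abs_of_nonneg hk, mul_comm]
      have h1 := hf.2 c₀ hJ.far
      have h2 : (0 : ℝ) ≤ D / 2 := (abs_nonneg _).trans h1
      exact mul_le_mul_of_nonneg_right (by linarith) hk

/-- A profile for the localized bumps. -/
structure IsUnitBump (ψ : E3 → ℝ) (K : ℝ≥0∞) : Prop where
  contDiff : ContDiff ℝ ∞ ψ
  nonneg : ∀ x, 0 ≤ ψ x
  eq_zero : ∀ x ∉ Metric.ball (0 : E3) (1 / 2), ψ x = 0
  gradient_eq_zero : ∀ x ∉ Metric.ball (0 : E3) (1 / 2), gradient ψ x = 0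
  mass : ∫⁻ x, ENNReal.ofReal (ψ x ^ 2) = 1
  kinetic : ∫⁻ x, ‖gradient ψ x‖ₑ ^ 2 = K

namespace IsUnitBump

variable {ψ : E3 → ℝ} {K : ℝ≥0∞} {h : ℝ}

theorem notMem_ball (hh : 0 < h) {c x : E3} (hx : x ∉ Metric.ball c (h / 2)) :
    h⁻¹ • (x - c) ∉ Metric.ball (0 : E3) (1 / 2) := by
  intro hx'
  apply hx
  rw [mem_ball_zero_iff, norm_smul, Real.norm_of_nonneg (by positivity),
    inv_mul_lt_iff₀ hh] at hx'
  rw [Metric.mem_ball, dist_eq_norm]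
  linarith

theorem dilate_eq_zero (hψ : IsUnitBump ψ K) (hh : 0 < h) {c x : E3}
    (hx : x ∉ Metric.ball c (h / 2)) : dilate h c ψ x = 0 := by
  simp [dilate, hψ.eq_zero _ (notMem_ball hh hx)]

theorem dilateGradient_eq_zero (hψ : IsUnitBump ψ K) (hh : 0 < h) {c x : E3}
    (hx : x ∉ Metric.ball c (h / 2)) : dilateGradient h c (gradient ψ) x = 0 := by
  simp [dilateGradient, hψ.gradient_eq_zero _ (notMem_ball hh hx)]

theorem mass_dilate (hψ : IsUnitBump ψ K) (hh : 0 < h) (c : E3) :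
    ∫⁻ x, ENNReal.ofReal (dilate h c ψ x ^ 2) = 1 := by
  simpa [hψ.mass] using lintegral_dilate hh c ψ fun _ => 1

/-- The Hardy bound with weight a = h balances the kinetic energy h⁻²K against the unit mass. It is
uniform in p, as the completion of the plan requires. -/
theorem coulomb_dilate_le (hψ : IsUnitBump ψ K) (hh : 0 < h) (c p : E3) :
    ∫⁻ y, (edist p y)⁻¹ ∂sqDensity (dilate h c ψ) ≤ ENNReal.ofReal h⁻¹ * (K + 1) := by
  have hw := hψ.contDiff.hasWeakGradient.dilate hh.ne' c
  have hc : HasCompactSupport (dilate h c ψ) :=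
    hasCompactSupport_of_ball (p := c) (r := h / 2) fun x hx => hψ.dilate_eq_zero hh hx
  have hed : Measurable fun x : E3 => (edist x p)⁻¹ := by fun_prop
  simp_rw [edist_comm p]
  rw [hw.lintegral_sqDensity hed]
  refine (hw.hardy hc p hh).trans ?_
  rw [lintegral_dilateGradient hh, hψ.mass_dilate hh, hψ.kinetic, mul_add, ← mul_assoc,
    ← ENNReal.ofReal_mul hh.le]
  have : h * h⁻¹ ^ 2 = h⁻¹ := by field_simp
  rw [this]

end IsUnitBump

/-- Contraction by l = ε / `κ.scale` reproduces the kinetic energy and the attraction of κ at scale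
ε, and its repulsion up to cross-ball terms. The bumps, which carry everything else, enter only
through the explicit error. -/
theorem exists_recovery {M : ℕ} {X : Fin M → E3} (hXi : Function.Injective X) {r : ℝ} (hr : 0 < r)
    (hX : ∀ i j, i ≠ j → 4 * r ≤ dist (X i) (X j)) (Z : Fin M → ℝ) {b : ℝ} (hb : 0 < b)
    {ρ : SubProb} (κ : Fragments X r) (hκ : κ.Fits ρ) {ε h : ℝ} (hε : 0 < ε) (hh : 0 < h)
    (hhr : h ≤ r) (hl : ε / κ.scale * r ≤ h) {J : Finset E3} {q : E3 → E3} {c₀ : E3}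
    (hJ : IsQuantization X h J q c₀) {ψ : E3 → ℝ} {K : ℝ≥0∞} (hψ : IsUnitBump ψ K) (hK : K ≠ ⊤) :
    ∃ ρ' : SubProb,
      rescaledEnergy X Z b ε ρ' ≤
        ((κ.repulsion b + (ENNReal.ofReal (ε ^ 2) * (ENNReal.ofReal (h⁻¹ ^ 2) * K)
          + ENNReal.ofReal (ε * b) * (ENNReal.ofReal (2 * r)⁻¹
            + 3 * (ENNReal.ofReal h⁻¹ * (K + 1)))) : ℝ≥0∞) : EReal) - (κ.attraction Z : EReal) ∧
      ∀ (f : C₀(E3, ℝ)) (D : ℝ), OscillationBound f h D →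
        |∫ x, f x ∂ρ'.toMeasure - ∫ x, f x ∂ρ.toMeasure| ≤ 2 * D := by
  classical
  set l := ε / κ.scale with hldef
  have hs := κ.scale_pos
  have hl0 : 0 < l := by positivity
  have hl1 : l ≤ 1 := by
    by_contra hcon
    rw [not_le] at hcon
    nlinarith
  set m : Fin M → ℝ≥0∞ := fun i => sqDensity (κ.u i) Set.univ with hm
  have hρ1 := ρ.mass_le_one
  have hmρ : ∀ i, m i ≤ 1 := fun i =>
    (hκ i).trans ((measure_mono (Set.subset_univ _)).trans hρ1)
  have hmT : ∀ i, m i ≠ ⊤ := fun i => ne_top_of_le_ne_top ENNReal.one_ne_top (hmρ i)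
  obtain ⟨ν, hν⟩ := exists_remainder hXi ρ (m := m) hκ
  have hνfin : IsFiniteMeasure ν := isFiniteMeasure_of_le ρ.toMeasure (hν ▸ Measure.le_add_right le_rfl)
  have hρr : ρ.toMeasure.real Set.univ ≤ 1 := by
    have := ENNReal.toReal_mono ENNReal.one_ne_top hρ1
    rwa [ENNReal.toReal_one] at this
  obtain ⟨w, hw0, hw1, hwf⟩ := hJ.exists_weights ν (k := 1 - ρ.toMeasure.real Set.univ)
    (by linarith)
  have hνmass : ν.real Set.univ + ∑ i, (m i).toReal = ρ.toMeasure.real Set.univ := by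
    have h1 : ν Set.univ + ∑ i, m i = ρ.toMeasure Set.univ := by
      rw [← hν]
      simp
    rw [Measure.real, Measure.real, ← ENNReal.toReal_sum fun i _ => hmT i,
      ← ENNReal.toReal_add (measure_ne_top ν _) (ENNReal.sum_ne_top.2 fun i _ => hmT i), h1]
  have hwm : ∑ c, w c + ∑ i, (m i).toReal = 1 := by rw [hw1]; linarith
  have hm0 : 0 ≤ ∑ i, (m i).toReal := Finset.sum_nonneg fun i _ => ENNReal.toReal_nonneg
  have hwle : ∑ c, w c ≤ 1 := by linarith
  -- the pieces of the square root of the density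
  let v : Fin M ⊕ J → E3 → ℝ := Sum.elim (fun i => dilate l (X i - l • X i) (κ.u i))
    (fun c x => √(w c) * dilate h c ψ x)
  let γ : Fin M ⊕ J → E3 → E3 := Sum.elim (fun i => dilateGradient l (X i - l • X i) (κ.g i))
    (fun c x => √(w c) • dilateGradient h c (gradient ψ) x)
  let S : Fin M ⊕ J → Set E3 := Sum.elim (fun i => Metric.ball (X i) h)
    (fun c => Metric.ball (c : E3) (h / 2))
  have hvw : ∀ k, HasWeakGradient (v k) (γ k) := by
    rintro (i | c)
    · exact (κ.weak i).dilate hl0.ne' _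
    · exact (hψ.contDiff.hasWeakGradient.dilate hh.ne' _).const_mul _
  have hv0 : ∀ k x, 0 ≤ v k x := by
    rintro (i | c) x
    · exact dilate_nonneg _ _ (κ.u_nonneg i) x
    · exact mul_nonneg (Real.sqrt_nonneg _) (dilate_nonneg _ _ hψ.nonneg x)
  have hvS : ∀ k, ∀ x ∉ S k, v k x = 0 := by
    rintro (i | c) x hx
    · simp [v, dilate, κ.u_eq_zero i _ (inv_smul_sub_notMem_ball hl0 hl hx)]
    · simp [v, hψ.dilate_eq_zero hh hx]
  have hγS : ∀ k, ∀ x ∉ S k, γ k x = 0 := by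
    rintro (i | c) x hx
    · simp [γ, dilateGradient, κ.g_eq_zero i _ (inv_smul_sub_notMem_ball hl0 hl hx)]
    · simp [γ, hψ.dilateGradient_eq_zero hh hx]
  -- Disjointness makes the kinetic energies add up: nuclei are 4r ≥ 4h apart, lattice points are 3h
  -- from the nuclei and h from each other, and the radii are h and h/2.
  have hS : ∀ k k', k ≠ k' → Disjoint (S k) (S k') := by
    rintro (i | c) (j | c') hne
    · refine Metric.ball_disjoint_ball ?_
      have := hX i j fun h => hne (by rw [h])
      linarith
    · refine Metric.ball_disjoint_ball ?_
      have := hJ.away c' c'.2 i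
      rw [dist_comm]
      linarith
    · refine Metric.ball_disjoint_ball ?_
      have := hJ.away c c.2 j
      linarith
    · refine Metric.ball_disjoint_ball ?_
      have := hJ.separated c c.2 c' c'.2 fun h => hne (by rw [Subtype.ext h])
      linarith
  set μ : Measure E3 := ∑ i, sqDensity (dilate l (X i - l • X i) (κ.u i)) with hμ
  set σ : Measure E3 := ∑ c, sqDensity (v (Sum.inr c)) with hσ
  have hsum : ∑ k, sqDensity (v k) = μ + σ := by rw [Fintype.sum_sum_type]; rfl
  have hvc : ∀ c, sqDensity (v (Sum.inr c))
      = ENNReal.ofReal (w c) • sqDensity (dilate h c ψ) := fun c => sqDensity_sqrt_mul (hw0 c) _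
  have hμi : ∀ i, sqDensity (dilate l (X i - l • X i) (κ.u i)) Set.univ = m i := fun i => by
    rw [sqDensity_univ, hm]
    simp only [sqDensity_univ]
    simpa using lintegral_dilate hl0 (X i - l • X i) (κ.u i) fun _ => 1
  have hσc : ∀ c, sqDensity (v (Sum.inr c)) Set.univ = ENNReal.ofReal (w c) := fun c => by
    rw [hvc, Measure.smul_apply, sqDensity_univ, hψ.mass_dilate hh, smul_eq_mul, mul_one]
  have hμu : μ Set.univ = ∑ i, m i := by
    rw [hμ, Measure.finsetSum_apply]
    exact Finset.sum_congr rfl fun i _ => hμi i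
  have hσu : σ Set.univ = ENNReal.ofReal (∑ c, w c) := by
    rw [hσ, Measure.finsetSum_apply, ENNReal.ofReal_sum_of_nonneg fun c _ => hw0 c]
    exact Finset.sum_congr rfl fun c _ => hσc c
  have hmass : μ Set.univ + σ Set.univ = 1 := by
    rw [hμu, hσu, ← ENNReal.ofReal_toReal (ENNReal.sum_ne_top.2 fun i _ => hmT i),
      ENNReal.toReal_sum fun i _ => hmT i, ← ENNReal.ofReal_add hm0
        (Finset.sum_nonneg fun c _ => hw0 c), add_comm, hwm, ENNReal.ofReal_one]
  have hprob : IsProbabilityMeasure (μ + σ) := ⟨by rw [Measure.add_apply, hmass]⟩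
  -- the energies
  have hkin : kinetic (μ + σ) ≤ ENNReal.ofReal (l⁻¹ ^ 2) * (∑ i, ∫⁻ x, ‖κ.g i x‖ₑ ^ 2)
      + ENNReal.ofReal (h⁻¹ ^ 2) * K := by
    rw [← hsum]
    refine (kinetic_sum_le hvw hv0 hS hvS hγS).trans ?_
    rw [Fintype.sum_sum_type]
    refine add_le_add (le_of_eq ?_) ?_
    · rw [Finset.mul_sum]
      exact Finset.sum_congr rfl fun i _ => lintegral_dilateGradient hl0 _ _
    · have e : ∀ c : J, ∫⁻ x, ‖γ (Sum.inr c) x‖ₑ ^ 2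
          = ENNReal.ofReal (w c) * (ENNReal.ofReal (h⁻¹ ^ 2) * K) := fun c => by
        simp only [γ, Sum.elim_inr, enorm_smul, mul_pow, enorm_sq_eq_ofReal,
          Real.sq_sqrt (hw0 c)]
        rw [lintegral_const_mul' _ _ ENNReal.ofReal_ne_top, lintegral_dilateGradient hh,
          hψ.kinetic]
      simp_rw [e]
      rw [← Finset.sum_mul, ← ENNReal.ofReal_sum_of_nonneg fun c _ => hw0 c]
      exact mul_le_of_le_one_left zero_le (ENNReal.ofReal_le_one.2 hwle)
  have hkinT : kinetic (μ + σ) < ⊤ := by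
    refine hkin.trans_lt (ENNReal.add_lt_top.2 ⟨ENNReal.mul_lt_top ENNReal.ofReal_lt_top
      (ENNReal.sum_lt_top.2 fun i _ => κ.kinetic_lt_top i),
      ENNReal.mul_lt_top ENNReal.ofReal_lt_top hK.lt_top⟩)
  obtain ⟨Q, hQ1, hQ2, hQu, hQc⟩ := κ.exists_contracted_plan hr hl0 hl1 hX
  have hQ1le : κ.plan Set.univ ≤ 1 := by
    have h1 := hQ1 Set.univ
    rw [Measure.map_apply measurable_fst MeasurableSet.univ, Set.preimage_univ, hQu] at h1
    exact h1.trans (hmass ▸ le_self_add)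
  have hcorr : correlation (μ + σ) ≤ ENNReal.ofReal l⁻¹ * ∫⁻ p, (edist p.1 p.2)⁻¹ ∂κ.plan
      + (ENNReal.ofReal (2 * r)⁻¹ + 3 * (ENNReal.ofReal h⁻¹ * (K + 1))) := by
    have hpot : ∀ x, ∫⁻ y, (edist x y)⁻¹ ∂σ ≤ ENNReal.ofReal h⁻¹ * (K + 1) := fun x => by
      rw [hσ, lintegral_finsetSum_measure]
      calc _ ≤ ∑ c : J, ENNReal.ofReal (w c) * (ENNReal.ofReal h⁻¹ * (K + 1)) := by
            refine Finset.sum_le_sum fun c _ => ?_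
            rw [hvc, lintegral_smul_measure, smul_eq_mul]
            gcongr
            exact hψ.coulomb_dilate_le hh c x
        _ ≤ _ := by
            rw [← Finset.sum_mul, ← ENNReal.ofReal_sum_of_nonneg fun c _ => hw0 c]
            exact mul_le_of_le_one_left zero_le (ENNReal.ofReal_le_one.2 hwle)
    have hmass2 : 2 * μ Set.univ ≤ Q Set.univ + 1 := by
      have h1 := κ.mass
      rw [hQu, hμu]
      rwa [Measure.finsetSum_apply] at h1
    refine (correlation_add_le hQ1 hQ2 hmass hmass2 hpot).trans ?_
    rw [← add_assoc]
    gcongr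
    exact hQc.trans (by gcongr; exact mul_le_of_le_one_right zero_le hQ1le)
  -- Attraction of a fragment by other nuclei, and of the bumps by all nuclei, is discarded; it only
  -- lowers the energy.
  have hatt : κ.attraction Z ≤ ENNReal.ofReal ε * potential X Z (μ + σ) := by
    unfold Fragments.attraction potential
    rw [Finset.mul_sum, Finset.mul_sum]
    refine Finset.sum_le_sum fun i _ => ?_
    have hed : Measurable fun x : E3 => (edist x (X i))⁻¹ := by fun_prop
    have h1 : sqDensity (v (Sum.inl i)) ≤ μ + σ := by
      rw [← hsum]
      refine Measure.le_iff.2 fun s _ => ?_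
      rw [Measure.finsetSum_apply]
      exact Finset.single_le_sum (f := fun k => sqDensity (v k) s) (fun _ _ => zero_le)
        (Finset.mem_univ (Sum.inl i))
    have h2 : ENNReal.ofReal l⁻¹ * ∫⁻ x, ENNReal.ofReal (κ.u i x ^ 2) * (edist x (X i))⁻¹
        ≤ ∫⁻ x, (edist x (X i))⁻¹ ∂(μ + σ) := by
      rw [← lintegral_dilate_coulomb hl0]
      exact ((hvw (Sum.inl i)).lintegral_sqDensity hed).symm.trans_le (lintegral_mono' h1 le_rfl)
    have h3 : ENNReal.ofReal κ.scale = ENNReal.ofReal ε * ENNReal.ofReal l⁻¹ := by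
      rw [← ENNReal.ofReal_mul hε.le, hldef]
      congr 1
      field_simp
    rw [h3]
    calc _ = ENNReal.ofReal ε * (ENNReal.ofReal (Z i) * (ENNReal.ofReal l⁻¹ *
          ∫⁻ x, ENNReal.ofReal (κ.u i x ^ 2) * (edist x (X i))⁻¹)) := by ring
      _ ≤ _ := by gcongr
  have hrep : ENNReal.ofReal (ε ^ 2) * kinetic (μ + σ) + ENNReal.ofReal (ε * b) *
      correlation (μ + σ) ≤ κ.repulsion b + (ENNReal.ofReal (ε ^ 2) * (ENNReal.ofReal (h⁻¹ ^ 2) * K)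
          + ENNReal.ofReal (ε * b) * (ENNReal.ofReal (2 * r)⁻¹
            + 3 * (ENNReal.ofReal h⁻¹ * (K + 1)))) := by
    have h1 : ENNReal.ofReal (κ.scale ^ 2)
        = ENNReal.ofReal (ε ^ 2) * ENNReal.ofReal (l⁻¹ ^ 2) := by
      rw [← ENNReal.ofReal_mul (by positivity), hldef]
      congr 1
      field_simp
    have h2 : ENNReal.ofReal (κ.scale * b) = ENNReal.ofReal (ε * b) * ENNReal.ofReal l⁻¹ := by
      rw [← ENNReal.ofReal_mul (by positivity), hldef]
      congr 1
      field_simp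
    unfold Fragments.repulsion
    rw [h1, h2]
    refine (add_le_add (mul_le_mul' le_rfl hkin) (mul_le_mul' le_rfl hcorr)).trans (le_of_eq ?_)
    ring
  refine ⟨⟨μ + σ, by rw [measure_univ]⟩, ?_, fun f D hf => ?_⟩
  · unfold rescaledEnergy
    rw [if_pos ⟨hprob, hkinT⟩]
    exact EReal.sub_le_sub (EReal.coe_ennreal_le_coe_ennreal_iff.2 hrep)
      (EReal.coe_ennreal_le_coe_ennreal_iff.2 hatt)
  · have hfi : ∀ τ : Measure E3, IsFiniteMeasure τ → Integrable f τ := fun τ _ =>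
      f.toBCF.integrable τ
    have hD := hf.nonneg hh
    have hfin : ∀ k, IsFiniteMeasure (sqDensity (v k)) := by
      rintro (i | c)
      · exact ⟨(hμi i).trans_lt (hmT i).lt_top⟩
      · exact ⟨(hσc c).trans_lt ENNReal.ofReal_lt_top⟩
    have hoff : ∀ k, sqDensity (v k) (S k)ᶜ = 0 := fun k => by
      refine sqDensity_eq_zero ?_ (hvS k)
      rcases k with i | c <;> exact Metric.isOpen_ball.measurableSet.compl
    have c1 : ∀ i, |∫ x, f x ∂sqDensity (v (Sum.inl i)) - (m i).toReal * f (X i)|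
        ≤ D * (m i).toReal := fun i => by
      have := abs_integral_sub_le_of_ball (hoff (Sum.inl i)) (hfi _ (hfin _)) (D := D)
        fun x hx => hf.1 _ _ (by have := Metric.mem_ball.1 hx; linarith)
      rwa [Measure.real, show sqDensity (v (Sum.inl i)) Set.univ = m i from hμi i] at this
    have c2 : ∀ c : J, |∫ x, f x ∂sqDensity (v (Sum.inr c)) - w c * f c| ≤ D * w c := fun c => by
      have := abs_integral_sub_le_of_ball (hoff (Sum.inr c)) (hfi _ (hfin _)) (D := D)
        fun x hx => hf.1 _ _ (by have := Metric.mem_ball.1 hx; linarith)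
      rwa [Measure.real, hσc, ENNReal.toReal_ofReal (hw0 c)] at this
    have c3 := hwf f D hf
    have e1 : ∫ x, f x ∂(μ + σ) = ∑ i, ∫ x, f x ∂sqDensity (v (Sum.inl i))
        + ∑ c, ∫ x, f x ∂sqDensity (v (Sum.inr c)) := by
      rw [← hsum, integral_finsetSum_measure fun k _ => hfi _ (hfin k), Fintype.sum_sum_type]
    have e2 : ∫ x, f x ∂ρ.toMeasure = ∫ x, f x ∂ν + ∑ i, (m i).toReal * f (X i) := by
      have hfd : ∀ i, IsFiniteMeasure (m i • Measure.dirac (X i)) := fun i =>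
        Measure.smul_finite _ (hmT i)
      rw [← hν, integral_add_measure (hfi _ hνfin)
        (integrable_finsetSum_measure.2 fun i _ => hfi _ (hfd i)),
        integral_finsetSum_measure fun i _ => hfi _ (hfd i)]
      simp [integral_smul_measure]
    -- Fragments against atoms, bumps against lattice points, lattice against remainder: the errors
    -- D∑m, D∑w and D∑w add up to at most 2D because ∑m + ∑w = 1.
    have e3 : ∫ x, f x ∂(μ + σ) - ∫ x, f x ∂ρ.toMeasure
        = ∑ i, (∫ x, f x ∂sqDensity (v (Sum.inl i)) - (m i).toReal * f (X i))
          + ∑ c, (∫ x, f x ∂sqDensity (v (Sum.inr c)) - w c * f c)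
          + (∑ c, w c * f c - ∫ x, f x ∂ν) := by
      rw [e1, e2, Finset.sum_sub_distrib, Finset.sum_sub_distrib]
      ring
    have s1 := (Finset.abs_sum_le_sum_abs _ Finset.univ).trans
      (Finset.sum_le_sum fun i _ => c1 i)
    have s2 := (Finset.abs_sum_le_sum_abs _ Finset.univ).trans
      (Finset.sum_le_sum fun c _ => c2 c)
    rw [← Finset.mul_sum] at s1 s2
    rw [e3]
    refine (abs_add_three _ _ _).trans ?_
    rw [← hw1] at c3
    nlinarith

/-! ### Near-optimal fragments and the recovery family -/

namespace Fragments

variable {M : ℕ} (X : Fin M → E3) (r : ℝ)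

/-- The empty fragments, at a given scale. -/
def empty {s : ℝ} (hs : 0 < s) : Fragments X r where
  scale := s
  scale_pos := hs
  u := fun _ _ => 0
  g := fun _ _ => 0
  u_nonneg := fun _ _ => le_rfl
  weak := fun _ => ⟨locallyIntegrable_zero, locallyIntegrable_zero, fun φ _ _ => by simp⟩
  u_eq_zero := fun _ _ _ => rfl
  g_eq_zero := fun _ _ _ => rfl
  kinetic_lt_top := fun _ => by simp
  plan := 0
  plan_fst := by simp [sqDensity]
  plan_snd := by simp [sqDensity]
  mass := by simp [sqDensity]

theorem empty_fits {s : ℝ} (hs : 0 < s) (ρ : SubProb) : (empty X r hs).Fits ρ := fun i => by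
  simp [empty, sqDensity]

theorem energy_empty {s : ℝ} (hs : 0 < s) (Z : Fin M → ℝ) (b : ℝ) :
    (empty X r hs).energy Z b = 0 := by
  simp [empty, energy, repulsion, attraction]

variable {X r} {Z : Fin M → ℝ}

/-- Excludes the value -∞ for infima of fragment energies, so that near-minimizers with a finite gap
exist. -/
theorem neg_le_energy (κ : Fragments X r) (hZ : ∀ k, 0 < Z k) (b : ℝ) {ρ : SubProb}
    (h : κ.Fits ρ) : ((-∑ i, Z i ^ 2 : ℝ) : EReal) ≤ κ.energy Z b := by
  have h0 : 0 ≤ ∑ i, Z i ^ 2 := Finset.sum_nonneg fun i _ => sq_nonneg _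
  have h1 := κ.attraction_le hZ b h
  rw [← ENNReal.ofReal_sum_of_nonneg fun i _ => sq_nonneg _] at h1
  have h2 := ereal_sub_le_sub_add (p := 0) (a := 0) (A := κ.repulsion b) (B := κ.attraction Z)
    ENNReal.zero_ne_top (κ.attraction_ne_top Z h) (∑ i, Z i ^ 2).toNNReal
    (by rw [zero_add, add_zero]; exact h1)
  rw [Real.coe_toNNReal _ h0] at h2
  simp only [EReal.coe_ennreal_zero, sub_zero] at h2
  rw [EReal.coe_neg]
  unfold energy
  rw [← zero_sub]
  exact EReal.sub_le_of_le_add h2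

theorem add_sub_attraction_le (κ : Fragments X r) (Z : Fin M → ℝ) (b : ℝ) {ρ : SubProb}
    (h : κ.Fits ρ) {e : ℝ≥0∞} {d : ℝ} (hd : 0 ≤ d) (he : e ≤ ENNReal.ofReal d) :
    ((κ.repulsion b + e : ℝ≥0∞) : EReal) - (κ.attraction Z : EReal)
      ≤ κ.energy Z b + (d : EReal) := by
  have h2 := ereal_sub_le_sub_add (p := κ.repulsion b + e) (A := κ.repulsion b)
    (κ.attraction_ne_top Z h) (κ.attraction_ne_top Z h) d.toNNReal
    (by rw [add_right_comm]; exact add_le_add le_rfl he)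
  rwa [Real.coe_toNNReal _ hd] at h2

end Fragments

theorem eventually_oscillationBound (f : C₀(E3, ℝ)) {D : ℝ} (hD : 0 < D) :
    ∀ᶠ h in 𝓝[>] (0 : ℝ), OscillationBound f h D := by
  obtain ⟨δ, hδ, hf⟩ := Metric.uniformContinuous_iff.1
    (ZeroAtInftyContinuousMap.uniformContinuous f) D hD
  have hz : ∀ᶠ x in Filter.cocompact E3, |f x| < D / 2 := by
    have h1 := (zero_at_infty f).abs
    rw [abs_zero] at h1
    exact h1.eventually (eventually_lt_nhds (half_pos hD))
  rw [← Metric.cobounded_eq_cocompact] at hz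
  obtain ⟨R, -, hR⟩ := hasBasis_cobounded_norm.eventually_iff.1 hz
  have ev1 : ∀ᶠ h in 𝓝[>] (0 : ℝ), h < δ / 9 :=
    eventually_nhdsWithin_of_eventually_nhds (eventually_lt_nhds (by positivity))
  have ev2 : ∀ᶠ h in 𝓝[>] (0 : ℝ), R ≤ h⁻¹ :=
    tendsto_inv_nhdsGT_zero.eventually (eventually_ge_atTop _)
  filter_upwards [ev1, ev2] with h h1 h2
  refine ⟨fun x y hxy => ?_, fun x hx => (hR (h2.trans hx)).le⟩
  have := hf (lt_of_le_of_lt hxy (by linarith))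
  rw [Real.dist_eq] at this
  exact this.le

theorem tendsto_sqrt_nhdsGT_zero : Tendsto Real.sqrt (𝓝[>] 0) (𝓝[>] 0) := by
  refine tendsto_nhdsWithin_iff.2 ⟨?_, ?_⟩
  · have := Real.continuous_sqrt.tendsto 0
    rw [Real.sqrt_zero] at this
    exact this.mono_left nhdsWithin_le_nhds
  · filter_upwards [self_mem_nhdsWithin] with x hx
    exact Real.sqrt_pos.2 hx

/-- A single family must serve all fragments at once, so for each ε the fragments are chosen
near-optimal among those that fit at that ε. Every fixed choice of fragments fits eventually. -/
theorem exists_recovery_family {M : ℕ} {X : Fin M → E3} (hXi : Function.Injective X) {r : ℝ}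
    (hr : 0 < r) (hX : ∀ i j, i ≠ j → 4 * r ≤ dist (X i) (X j)) {Z : Fin M → ℝ}
    (hZ : ∀ k, 0 < Z k) {b : ℝ} (hb : 0 < b) (ρ : SubProb) :
    ∃ y : ℝ → SubProb, Tendsto y (𝓝[>] 0) (𝓝 ρ) ∧
      limsup (fun ε => rescaledEnergy X Z b ε (y ε)) (𝓝[>] 0) ≤ limitEnergy X r Z b ρ := by
  obtain ⟨ψ, hψ1, hψ2, hψ3, hψ4, hψ5⟩ := exists_unit_bump
  have hψ : IsUnitBump ψ (∫⁻ x, ‖gradient ψ x‖ₑ ^ 2) :=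
    ⟨hψ1, hψ2, fun x hx => (hψ3 x hx).1, fun x hx => (hψ3 x hx).2, hψ4, rfl⟩
  obtain ⟨K, hK⟩ : ∃ K : NNReal, ∫⁻ x, ‖gradient ψ x‖ₑ ^ 2 = K := ⟨_, (ENNReal.coe_toNNReal hψ5).symm⟩
  rw [hK] at hψ
  -- The error of `exists_recovery` for mesh h = √ε: the bumps cost ε²/h² = ε in kinetic energy and
  -- ε/h = √ε in interaction.
  let err : ℝ → ℝ := fun ε => ε * K + (ε * b * (2 * r)⁻¹ + 3 * b * (K + 1) * √ε)
  have herr : ∀ ε > 0, ENNReal.ofReal (ε ^ 2) * (ENNReal.ofReal ((√ε)⁻¹ ^ 2) * K)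
      + ENNReal.ofReal (ε * b) * (ENNReal.ofReal (2 * r)⁻¹
        + 3 * (ENNReal.ofReal (√ε)⁻¹ * (K + 1))) ≤ ENNReal.ofReal (err ε) := by
    intro ε hε
    have hs : 0 < √ε := Real.sqrt_pos.2 hε
    have e1 : (K : ℝ≥0∞) = ENNReal.ofReal K := ENNReal.ofReal_coe_nnreal.symm
    have e2 : (K : ℝ≥0∞) + 1 = ENNReal.ofReal (K + 1) := by
      rw [ENNReal.ofReal_add (NNReal.coe_nonneg K) zero_le_one, ENNReal.ofReal_one, ← e1]
    have e3 : (3 : ℝ≥0∞) = ENNReal.ofReal 3 := by simp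
    rw [e2, e1, e3, ← ENNReal.ofReal_mul (by positivity), ← ENNReal.ofReal_mul (by positivity),
      ← ENNReal.ofReal_mul (by positivity), ← ENNReal.ofReal_mul (by positivity),
      ← ENNReal.ofReal_add (by positivity) (by positivity), ← ENNReal.ofReal_mul (by positivity),
      ← ENNReal.ofReal_add (by positivity) (by positivity)]
    refine ENNReal.ofReal_le_ofReal (le_of_eq ?_)
    simp only [err]
    have hsq : √ε ^ 2 = ε := Real.sq_sqrt hε.le
    rw [inv_pow, hsq]
    have e4 : ε * (√ε)⁻¹ = √ε := by
      field_simp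
      exact hsq.symm
    have e5 : ε ^ 2 * (ε⁻¹ * K) = ε * K := by field_simp
    rw [e5, mul_add, show ε * b * (3 * ((√ε)⁻¹ * (K + 1))) = 3 * b * (K + 1) * (ε * (√ε)⁻¹) by ring,
      e4]
  have herr0 : ∀ ε > 0, 0 ≤ err ε := fun ε hε => by positivity
  -- The scale restriction says that fragments of radius r, contracted by ε / `κ.scale`, fit in
  -- balls of radius √ε.
  let a : ℝ → EReal := fun ε =>
    ⨅ (κ : Fragments X r) (_ : κ.Fits ρ ∧ r * √ε ≤ κ.scale), κ.energy Z b
  have hnear : ∀ ε > 0, ∃ κ : Fragments X r, (κ.Fits ρ ∧ r * √ε ≤ κ.scale) ∧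
      κ.energy Z b < a ε + (ε : EReal) := by
    intro ε hε
    have hpos : 0 < r * √ε := mul_pos hr (Real.sqrt_pos.2 hε)
    have h1 : a ε ≤ 0 := (iInf₂_le (Fragments.empty X r hpos)
      ⟨Fragments.empty_fits X r hpos ρ, le_rfl⟩).trans (Fragments.energy_empty X r hpos Z b).le
    have h2 : ((-∑ i, Z i ^ 2 : ℝ) : EReal) ≤ a ε :=
      le_iInf₂ fun κ hκ => κ.neg_le_energy hZ b hκ.1
    have h3 : a ε ≠ ⊤ := (h1.trans_lt EReal.zero_lt_top).ne
    have h4 : a ε ≠ ⊥ := ((EReal.bot_lt_coe _).trans_le h2).ne'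
    have h5 : a ε < a ε + (ε : EReal) := by
      lift a ε to ℝ using ⟨h3, h4⟩ with a'
      rw [← EReal.coe_add, EReal.coe_lt_coe_iff]
      linarith
    obtain ⟨κ, hκ, hlt⟩ := by
      have h6 := h5
      conv_lhs at h6 => unfold a
      simpa only [iInf_lt_iff] using h6
    exact ⟨κ, hκ, hlt⟩
  have hstep : ∀ᶠ ε in 𝓝[>] (0 : ℝ), ∃ ρ' : SubProb,
      rescaledEnergy X Z b ε ρ' ≤ a ε + ((ε + err ε : ℝ) : EReal) ∧
      ∀ (f : C₀(E3, ℝ)) (D : ℝ), OscillationBound f (√ε) D →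
        |∫ x, f x ∂ρ'.toMeasure - ∫ x, f x ∂ρ.toMeasure| ≤ 2 * D := by
    have ev1 : ∀ᶠ h in 𝓝[>] (0 : ℝ), h ≤ r :=
      eventually_nhdsWithin_of_eventually_nhds (eventually_le_nhds hr)
    filter_upwards [tendsto_sqrt_nhdsGT_zero.eventually (exists_quantization hr hX),
      tendsto_sqrt_nhdsGT_zero.eventually ev1, self_mem_nhdsWithin] with ε h1 h2 hε
    have hε : 0 < ε := hε
    have hs : 0 < √ε := Real.sqrt_pos.2 hε
    obtain ⟨J, q, c₀, q1, q2, q3, q4, q5, q6, q7⟩ := h1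
    obtain ⟨κ, ⟨hκ, hκs⟩, hκe⟩ := hnear ε hε
    have hl : ε / κ.scale * r ≤ √ε := by
      have := κ.scale_pos
      rw [div_mul_eq_mul_div, div_le_iff₀ this]
      calc ε * r = √ε * (r * √ε) := by
            rw [mul_left_comm, Real.mul_self_sqrt hε.le, mul_comm]
        _ ≤ √ε * κ.scale := by gcongr
    obtain ⟨ρ', h3, h4⟩ := exists_recovery hXi hr hX Z hb κ hκ hε hs h2 hl
      ⟨q1, q2, q3, q4, q5, q6, q7⟩ hψ ENNReal.coe_ne_top
    refine ⟨ρ', (h3.trans (κ.add_sub_attraction_le Z b hκ (herr0 ε hε) (herr ε hε))).trans ?_, h4⟩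
    have hsplit : ((ε + err ε : ℝ) : EReal) = (ε : EReal) + (err ε : EReal) := EReal.coe_add _ _
    rw [hsplit, ← add_assoc]
    exact add_le_add hκe.le le_rfl
  -- Where the construction is unavailable the family takes the default value ρ; this is irrelevant,
  -- as `hstep` holds eventually.
  have hchoice : ∀ ε : ℝ, ∃ ρ' : SubProb, (∃ ρ' : SubProb,
      rescaledEnergy X Z b ε ρ' ≤ a ε + ((ε + err ε : ℝ) : EReal) ∧
      ∀ (f : C₀(E3, ℝ)) (D : ℝ), OscillationBound f (√ε) D →
        |∫ x, f x ∂ρ'.toMeasure - ∫ x, f x ∂ρ.toMeasure| ≤ 2 * D) →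
      rescaledEnergy X Z b ε ρ' ≤ a ε + ((ε + err ε : ℝ) : EReal) ∧
      ∀ (f : C₀(E3, ℝ)) (D : ℝ), OscillationBound f (√ε) D →
        |∫ x, f x ∂ρ'.toMeasure - ∫ x, f x ∂ρ.toMeasure| ≤ 2 * D := fun ε => by
    by_cases h : ∃ ρ' : SubProb,
      rescaledEnergy X Z b ε ρ' ≤ a ε + ((ε + err ε : ℝ) : EReal) ∧
      ∀ (f : C₀(E3, ℝ)) (D : ℝ), OscillationBound f (√ε) D →
        |∫ x, f x ∂ρ'.toMeasure - ∫ x, f x ∂ρ.toMeasure| ≤ 2 * D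
    · exact ⟨h.choose, fun _ => h.choose_spec⟩
    · exact ⟨ρ, fun h' => absurd h' h⟩
  choose y hy using hchoice
  refine ⟨y, tendsto_subProb_iff.2 fun f => ?_, le_iInf₂ fun κ hκ => ?_⟩
  · refine Metric.tendsto_nhds.2 fun δ hδ => ?_
    filter_upwards [hstep, tendsto_sqrt_nhdsGT_zero.eventually
      (eventually_oscillationBound f (D := δ / 4) (by positivity))] with ε h1 h2
    have := (hy ε h1).2 f (δ / 4) h2
    rw [Real.dist_eq]
    linarith
  -- For fixed κ and any c above its energy, two intermediate reals give a positive gap that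
  -- eventually absorbs ε + err ε.
  · refine le_of_forall_gt_imp_ge_of_dense fun c hc => ?_
    obtain ⟨c₁, hc1, hc2⟩ := EReal.lt_iff_exists_real_btwn.1 hc
    obtain ⟨c₂, hc3, hc4⟩ := EReal.lt_iff_exists_real_btwn.1 hc2
    have hcc : c₁ < c₂ := EReal.coe_lt_coe_iff.1 hc3
    have hsmall : ∀ᶠ ε in 𝓝[>] (0 : ℝ), ε + err ε ≤ c₂ - c₁ := by
      have hcont : Continuous fun ε : ℝ => ε + err ε := by
        have := Real.continuous_sqrt
        simp only [err]
        fun_prop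
      have ht := hcont.tendsto 0
      simp only [err, Real.sqrt_zero, zero_mul, mul_zero, add_zero] at ht
      exact eventually_nhdsWithin_of_eventually_nhds
        (ht.eventually (eventually_le_nhds (by linarith)))
    have hscale : ∀ᶠ ε in 𝓝[>] (0 : ℝ), r * √ε ≤ κ.scale := by
      have : ∀ᶠ h in 𝓝[>] (0 : ℝ), h ≤ κ.scale / r :=
        eventually_nhdsWithin_of_eventually_nhds (eventually_le_nhds (div_pos κ.scale_pos hr))
      filter_upwards [tendsto_sqrt_nhdsGT_zero.eventually this] with ε h1
      rwa [le_div_iff₀ hr, mul_comm] at h1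
    refine limsup_le_of_le (by isBoundedDefault) ?_
    filter_upwards [hstep, hsmall, hscale] with ε h1 h2 h3
    calc rescaledEnergy X Z b ε (y ε) ≤ a ε + ((ε + err ε : ℝ) : EReal) := (hy ε h1).1
      _ ≤ κ.energy Z b + ((c₂ - c₁ : ℝ) : EReal) :=
          add_le_add (iInf₂_le κ ⟨hκ, h3⟩) (EReal.coe_le_coe_iff.2 h2)
      _ ≤ (c₁ : EReal) + ((c₂ - c₁ : ℝ) : EReal) := add_le_add hc1.le le_rfl
      _ = (c₂ : EReal) := by rw [← EReal.coe_add]; congr 1; ring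
      _ ≤ c := hc4.le

theorem exists_separation {M : ℕ} {X : Fin M → E3} (hX : Function.Injective X) :
    ∃ r : ℝ, 0 < r ∧ ∀ i j, i ≠ j → 4 * r ≤ dist (X i) (X j) := by
  have ev : ∀ᶠ r in 𝓝[>] (0 : ℝ), ∀ i j, i ≠ j → 4 * r ≤ dist (X i) (X j) := by
    refine eventually_all.2 fun i => eventually_all.2 fun j => ?_
    by_cases hij : i = j
    · exact Eventually.of_forall fun r h => absurd hij h
    · have hpos : 0 < dist (X i) (X j) / 4 := by
        have := dist_pos.2 (hX.ne hij)
        positivity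
      filter_upwards [eventually_nhdsWithin_of_eventually_nhds (eventually_le_nhds hpos)]
        with r hr _
      linarith
  obtain ⟨r, h1, h2⟩ := (ev.and self_mem_nhdsWithin).exists
  exact ⟨r, h2, h1⟩

theorem SubProb.sharp_singleton {M : ℕ} {X : Fin M → E3} (hX : Function.Injective X) (ρ : SubProb)
    (i : Fin M) : (ρ.sharp X hX).toMeasure {X i} = ρ.toMeasure {X i} := by
  simp only [SubProb.sharp, Measure.finsetSum_apply, Measure.smul_apply, smul_eq_mul]
  rw [Finset.sum_eq_single i]
  · simp
  · intro j _ hj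
    rw [Measure.dirac_apply' _ (measurableSet_singleton _), Set.indicator_of_notMem, mul_zero]
    exact fun h => hj (hX h)
  · simp

end

theorem mainTheorem2 (M : ℕ) (X : Fin M → E3) (hX : Function.Injective X)
    (Z : Fin M → ℝ) (hZ : ∀ k, 0 < Z k) (b : ℝ) (hb : 0 < b) :
    ∃ G : SubProb → EReal,
      IsGammaLimit (fun ε => rescaledEnergy X Z b ε) G ∧
        ∀ ρ : SubProb, G ρ = G (ρ.sharp X hX) := by
  obtain ⟨r, hr, hsep⟩ := exists_separation hX
  refine ⟨limitEnergy X r Z b, fun ρ => ⟨fun y hy => limitEnergy_le_liminf hr hsep hZ hb hy,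
    exists_recovery_family hX hr hsep hZ hb ρ⟩, fun ρ => ?_⟩
  -- ρ enters the limit energy only through the constraint `Fits`, that is, through its atoms at the
  -- nuclei.
  simp only [limitEnergy, Fragments.Fits, SubProb.sharp_singleton hX]
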